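/- For $g\in L^2(\mathbb R)$ with compact support let $Eg(x,t)=\int_{\mathbb R} e^{i(\omega^2t+\omega x)}g(\omega)\,d\omega$, and let $B_R\subset\mathbb R^2$ be the disc of radius $R$ centred at the origin. Let $R>0$ and let $f:[-1,1]\to\mathbb C$ be smooth, extended by $0$ to $\mathbb R$. Given constants $A\ge1$ and $(K_N)_{N\ge1}$, a *wave packet decomposition of $f$ of size $R$ (with constants $A,K_N$)* is an expansion, unconditionally convergent in $L^2(\mathbb R)$, $$f=\sum_{\theta,v}f_{\theta,v}=\sum_{\theta,v}c_{\theta,v}\phi_{\theta,v},\qquad \theta\in R^{-1/2}\mathbb Z\cap[-1,1],\quad v\in R^{1/2}\mathbb Z,$$ with $c_{\theta,v}\in\mathbb C$ and $\phi_{\theta,v}\in L^2(\mathbb R)$ supported in $[\theta-3R^{-1/2},\theta+3R^{-1/2}]$, such that $$A^{-1}\|f\|_{L^2}^2\le\sum_{\theta,v}|c_{\theta,v}|^2\le A\|f\|_{L^2}^2,\qquad |c_{\theta_0,v_0}|\le A\max_{\theta,v}\|f_{\theta,v}\|_{L^2}\ \text{ for all }\theta_0,v_0,$$ $$|E\phi_{\theta,v}(x,t)|\le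 K_N R^{-1/4}\bigl(1+|x-v+2\theta t|R^{-1/2}\bigr)^{-N}\qquad\text{for all } x\in\mathbb R,\ |t|\le R,\ N\ge1.$$ Put $S=\max_{\theta,v}\|f_{\theta,v}\|_{L^2}/\|f\|_{L^2}$. **Proposition.** For every $\epsilon>0$ and all constants $A,(K_N)$ there is a constant $C=C(\epsilon,A,(K_N))$, independent of $R$, of $f$ and of the decomposition, such that $$\|Ef\|_{L^4(B_R)}\le C\,R^{\frac18+\epsilon}\,S^{\frac14-\epsilon}\,\|f\|_{L^2}$$ for every $R>0$ (with $R\ge1$ if $\epsilon>\frac18$), every smooth $f:[-1,1]\to\mathbb C$, and every wave packet decomposition of $f$ of size $R$ with constants $A,K_N$ (for $f=0$ the inequality reads $0\le0$). -/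

import Mathlib

open MeasureTheory Set Filter
open scoped NNReal ENNReal Topology

noncomputable section

namespace WavePacket

/-- The extension operator `Ef(x,t) = ∫ e^{i(ω² t + ω x)} f(ω) dω`. It is applied both to functions
that vanish outside `[-1,1]` (where it is the integral over `[-1,1]`) and to wave packets,
whose supports may stick out of `[-1,1]` by `O(R^{-1/2})`. -/
def extensionOp (f : ℝ → ℂ) (x t : ℝ) : ℂ :=
  ∫ ω : ℝ, Complex.exp (Complex.I * ((ω ^ 2 * t + ω * x : ℝ) : ℂ)) * f ω

/-- The Euclidean disc `B_R` of points `(x,t)`, centred at the origin. -/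
def disc (R : ℝ) : Set (ℝ × ℝ) := {z | z.1 ^ 2 + z.2 ^ 2 ≤ R ^ 2}

/-- Indices `(k, m)` of the wave packets of size `R`: the frequency is `θ = k R^{-1/2} ∈ [-1,1]`
and the position is `v = m R^{1/2}`. -/
abbrev Index (R : ℝ) : Type := {k : ℤ // (k : ℝ) * R ^ (-(1 / 2) : ℝ) ∈ Icc (-1 : ℝ) 1} × ℤ

/-- The frequency `θ ∈ R^{-1/2}ℤ ∩ [-1,1]` of an index. -/
def freq {R : ℝ} (q : Index R) : ℝ := ((q.1 : ℤ) : ℝ) * R ^ (-(1 / 2) : ℝ)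

/-- The position `v ∈ R^{1/2}ℤ` of an index. -/
def pos {R : ℝ} (q : Index R) : ℝ := (q.2 : ℝ) * R ^ (1 / 2 : ℝ)

/-- The wave packet `f_{θ,v} = c_{θ,v} φ_{θ,v}`. -/
def packet {R : ℝ} (c : Index R → ℂ) (φ : Index R → ℝ → ℂ) (q : Index R) : ℝ → ℂ :=
  fun ω => c q * φ q ω

/-- The size `M = max_{θ,v} ‖f_{θ,v}‖_{L²}` of the largest wave packet. -/
def maxPacket {R : ℝ} (c : Index R → ℂ) (φ : Index R → ℝ → ℂ) : ℝ≥0∞ :=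
  ⨆ q : Index R, eLpNorm (packet c φ q) 2 volume

/-- The ratio `S = max_{θ,v} ‖f_{θ,v}‖_{L²} / ‖f‖_{L²}`. -/
def sizeRatio {R : ℝ} (f : ℝ → ℂ) (c : Index R → ℂ) (φ : Index R → ℝ → ℂ) : ℝ≥0∞ :=
  maxPacket c φ / eLpNorm f 2 volume

/-- `f = ∑ c_{θ,v} φ_{θ,v}` is a wave packet decomposition of size `R`, where `A` and `K N` are
the implied constants. For the phase `ω² t + ω x` the packet `(θ,v)` travels along the line
`x = v - 2 θ t`, and it stays within a tube of width `R^{1/2}` for times `|t| ≤ R`. -/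
structure IsDecomposition (R : ℝ) (A : ℝ≥0) (K : ℕ → ℝ) (f : ℝ → ℂ)
    (c : Index R → ℂ) (φ : Index R → ℝ → ℂ) : Prop where
  memLp : ∀ q, MemLp (φ q) 2 volume
  /-- The sum of the wave packets is `f`, unconditionally in `L²`. -/
  sum_eq : Tendsto
    (fun s : Finset (Index R) => eLpNorm (fun ω => f ω - ∑ q ∈ s, packet c φ q ω) 2 volume)
    atTop (𝓝 0)
  support_subset : ∀ q, Function.support (φ q) ⊆
    Icc (freq q - 3 * R ^ (-(1 / 2) : ℝ)) (freq q + 3 * R ^ (-(1 / 2) : ℝ))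
  sum_sq_le : ∑' q, ‖c q‖ₑ ^ 2 ≤ A * eLpNorm f 2 volume ^ 2
  le_sum_sq : eLpNorm f 2 volume ^ 2 ≤ A * ∑' q, ‖c q‖ₑ ^ 2
  coeff_le : ∀ q, ‖c q‖ₑ ≤ A * maxPacket c φ
  decay : ∀ q, ∀ N : ℕ, 0 < N → ∀ x t : ℝ, |t| ≤ R →
    ‖extensionOp (φ q) x t‖ ≤ K N * R ^ (-(1 / 4) : ℝ) /
      (1 + |x - pos q + 2 * freq q * t| * R ^ (-(1 / 2) : ℝ)) ^ N

end WavePacket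

end

/-! ### Plancherel's theorem for the exponential integral -/

noncomputable section

namespace WavePacket

open scoped FourierTransform
open SchwartzMap

/-! The fourth power of the `L⁴` norm of `Ef` is the squared `L²` norm of `(Ef)²`, and the square is
expanded over pairs of wave packets. Frequencies are measured in units of `R^{-1/2}`, positions in
units of `R^{1/2}`. A Whitney decomposition (`sq_eq_diagonal_add_separated`) sorts the pairs by
frequency separation: for each dyadic `n` there are pairs of cells of `n` frequencies at distance
about `n`, and there remains a diagonal part made of neighbouring cells of 8 frequencies. At fixed
`t` the products belonging to one scale have boundedly overlapping Fourier supports in `x`, hence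
are almost orthogonal (`lintegral_sum_mul_sq_le`). There are `O(log R)` scales, so it suffices to
treat one pair at one scale.

For such a pair the bilinear `L²` estimate (`lintegral_bilinear_le`) gains the inverse of the
separation, `√R / n`. It is applied after localizing in space. The velocities in the two cells
differ by `O(n R^{-1/2})`, so during `|t| ≤ R` the packets drift apart by `O(n R^{1/2})` only. Up to
a rapidly decaying error, only packets starting in a common interval of length about `ρ n R^{1/2}`
interact, where `ρ = R^δ`. A cell has `O(ρ n²)` such packets. If all coefficients are at most `b`
and their square sum is at most `H²`, the energy of these packets is at most `min(ρ n² b², H²)`, up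
to constants, hence at most about `ρ n b H`. This factor `n` cancels the `1 / n` of the bilinear
estimate, and every scale contributes at most about `ρ² √R b H³`.

With `b` comparable to the largest packet and `H` to `‖f‖`, this gives `∫ |Ef|⁴ ≲ R^{1/2+4ε} S
‖f‖⁴`. After a fourth root, `S^{1/4}` is traded for `S^{1/4-ε}`, because `S` is bounded by Bessel's
inequality. For `R < 1` only the frequency `0` occurs, and interpolating two sup bounds is enough.
-/

theorem fourier_ae_eq_toLp {g : ℝ → ℂ} (hg : Integrable g) (hg2 : MemLp g 2 volume) :
    ∀ᵐ x, 𝓕 g x = (𝓕 (hg2.toLp g) : Lp ℂ 2 (volume : Measure ℝ)) x := by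
  have hcont : Continuous (𝓕 g) :=
    VectorFourier.fourierIntegral_continuous Real.continuous_fourierChar
      (L := innerₗ ℝ) continuous_inner hg
  -- Both sides define the same distribution: against a test function, either transform can be moved
  -- onto the test function.
  refine ae_eq_of_integral_contDiff_smul_eq hcont.locallyIntegrable
    ((Lp.memLp _).locallyIntegrable (by norm_num)) fun ψ hψ hψc => ?_
  have hg₁ : HasCompactSupport (Complex.ofRealCLM ∘ ψ) := hψc.comp_left rfl
  have hg₂ : ContDiff ℝ ((⊤ : ℕ∞) : WithTop ℕ∞) (Complex.ofRealCLM ∘ ψ) := by fun_prop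
  set Ψ : 𝓢(ℝ, ℂ) := hg₁.toSchwartzMap hg₂ with hΨ
  have hΨa : ∀ x, Ψ x = (ψ x : ℂ) := fun x => by simp [hΨ]
  have h1 : ∫ x, Ψ x • (𝓕 (hg2.toLp g) : Lp ℂ 2 (volume : Measure ℝ)) x = ∫ x, (𝓕 Ψ) x • g x := by
    have := congrArg (fun T => T Ψ) (Lp.fourier_toTemperedDistribution_eq (hg2.toLp g))
    simp only [TemperedDistribution.fourier_apply, Lp.toTemperedDistribution_apply] at this
    rw [← this]
    refine integral_congr_ae ?_
    filter_upwards [hg2.coeFn_toLp] with x hx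
    rw [hx]
  have h2 : ∫ x, (𝓕 Ψ) x • g x = ∫ x, Ψ x • 𝓕 g x := by
    have := VectorFourier.integral_fourierIntegral_smul_eq_flip (L := innerₗ ℝ)
      Real.continuous_fourierChar continuous_inner (Ψ.integrable (μ := volume)) hg
    rw [SchwartzMap.fourier_coe]
    simpa using! this
  calc ∫ x, ψ x • 𝓕 g x = ∫ x, Ψ x • 𝓕 g x := by simp [hΨa]
    _ = _ := by rw [← h2, ← h1]; simp [hΨa]

theorem eLpNorm_fourier_eq {g : ℝ → ℂ} (hg : Integrable g) (hg2 : MemLp g 2 volume) :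
    eLpNorm (𝓕 g) 2 volume = eLpNorm g 2 volume := by
  rw [eLpNorm_congr_ae (fourier_ae_eq_toLp hg hg2)]
  have h := Lp.norm_fourier_eq (hg2.toLp g)
  rw [Lp.norm_def, Lp.norm_def, ENNReal.toReal_eq_toReal_iff' (Lp.eLpNorm_ne_top _)
    (Lp.eLpNorm_ne_top _)] at h
  rw [h, eLpNorm_congr_ae hg2.coeFn_toLp]

theorem eLpNorm_two_sq {α : Type*} [MeasurableSpace α] (μ : Measure α) (g : α → ℂ) :
    eLpNorm g 2 μ ^ 2 = ∫⁻ x, ‖g x‖ₑ ^ 2 ∂μ := by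
  rw [eLpNorm_eq_lintegral_rpow_enorm_toReal (by norm_num) (by norm_num), ← ENNReal.rpow_natCast,
    ← ENNReal.rpow_mul]
  simp

/-- The exponential integral `∫ e^{iωx} g(ω) dω`. -/
def expIntegral (g : ℝ → ℂ) (x : ℝ) : ℂ :=
  ∫ ω : ℝ, Complex.exp (Complex.I * ((ω * x : ℝ) : ℂ)) * g ω

theorem expIntegral_eq_fourier (g : ℝ → ℂ) (x : ℝ) :
    expIntegral g x = 𝓕 g (-(2 * Real.pi)⁻¹ * x) := by
  rw [expIntegral, Real.fourier_real_eq_integral_exp_smul]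
  refine integral_congr_ae (Eventually.of_forall fun ω => ?_)
  simp only [smul_eq_mul]
  congr 2
  have : (Real.pi : ℂ) ≠ 0 := by exact_mod_cast Real.pi_ne_zero
  push_cast
  field_simp

/-- Plancherel's theorem. -/
theorem lintegral_expIntegral_sq {g : ℝ → ℂ} (hg : Integrable g) (hg2 : MemLp g 2 volume) :
    ∫⁻ x, ‖expIntegral g x‖ₑ ^ 2 = ENNReal.ofReal (2 * Real.pi) * ∫⁻ ω, ‖g ω‖ₑ ^ 2 := by
  have h := congrArg (· ^ 2) (eLpNorm_fourier_eq hg hg2)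
  simp only [eLpNorm_two_sq] at h
  rw [← h]
  simp_rw [expIntegral_eq_fourier]
  have hpi : -(2 * Real.pi)⁻¹ ≠ 0 := by
    have := Real.pi_pos; simp [this.ne']
  -- The Jacobian of this dilation is the source of the factor `2π`.
  have hm : Measure.map (fun x : ℝ => -(2 * Real.pi)⁻¹ * x) volume =
      ENNReal.ofReal (2 * Real.pi) • volume := by
    rw [Real.map_volume_mul_left hpi]
    congr 2
    rw [inv_neg, inv_inv, abs_neg, abs_of_pos Real.two_pi_pos]
  have hcont : Continuous (𝓕 g) :=
    VectorFourier.fourierIntegral_continuous Real.continuous_fourierChar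
      (L := innerₗ ℝ) continuous_inner hg
  rw [← lintegral_map (f := fun y => ‖𝓕 g y‖ₑ ^ 2) (g := fun x : ℝ => -(2 * Real.pi)⁻¹ * x)
    (by fun_prop) (by fun_prop), hm, lintegral_smul_measure]
  rfl

end WavePacket

end

/-! ### The bilinear `L²` estimate -/

noncomputable section

namespace WavePacket

open scoped Convolution

/-- Multiplication by the quadratic phase `e^{iω²t}`. -/
def modulate (t : ℝ) (g : ℝ → ℂ) (ω : ℝ) : ℂ :=
  Complex.exp (Complex.I * ((ω ^ 2 * t : ℝ) : ℂ)) * g ω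

theorem norm_exp_I_mul (y : ℝ) : ‖Complex.exp (Complex.I * (y : ℂ))‖ = 1 := by
  rw [mul_comm, Complex.norm_exp_ofReal_mul_I]

theorem enorm_exp_I_mul (y : ℝ) : ‖Complex.exp (Complex.I * (y : ℂ))‖ₑ = 1 := by
  rw [← ofReal_norm, norm_exp_I_mul, ENNReal.ofReal_one]

@[simp]
theorem enorm_modulate (t : ℝ) (g : ℝ → ℂ) (ω : ℝ) : ‖modulate t g ω‖ₑ = ‖g ω‖ₑ := by
  rw [modulate, enorm_mul, enorm_exp_I_mul, one_mul]

theorem norm_modulate (t : ℝ) (g : ℝ → ℂ) (ω : ℝ) : ‖modulate t g ω‖ = ‖g ω‖ := by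
  rw [modulate, norm_mul, norm_exp_I_mul, one_mul]

theorem aestronglyMeasurable_modulate (t : ℝ) {g : ℝ → ℂ} (hg : AEStronglyMeasurable g volume) :
    AEStronglyMeasurable (modulate t g) volume := by
  have : Continuous fun ω : ℝ => Complex.exp (Complex.I * ((ω ^ 2 * t : ℝ) : ℂ)) := by fun_prop
  exact this.aestronglyMeasurable.mul hg

theorem integrable_modulate (t : ℝ) {g : ℝ → ℂ} (hg : Integrable g) :
    Integrable (modulate t g) :=
  hg.congr' (aestronglyMeasurable_modulate t hg.1)
    (Eventually.of_forall fun ω => (norm_modulate t g ω).symm)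

theorem memLp_modulate (t : ℝ) {g : ℝ → ℂ} (hg : MemLp g 2 volume) :
    MemLp (modulate t g) 2 volume :=
  hg.congr_norm (aestronglyMeasurable_modulate t hg.1)
    (Eventually.of_forall fun ω => (norm_modulate t g ω).symm)

theorem extensionOp_eq_expIntegral (g : ℝ → ℂ) (x t : ℝ) :
    extensionOp g x t = expIntegral (modulate t g) x := by
  unfold extensionOp expIntegral modulate
  refine integral_congr_ae (Eventually.of_forall fun ω => ?_)
  simp only
  rw [← mul_assoc, ← Complex.exp_add]
  congr 2
  push_cast
  ring

/-- Conservation of mass: the `L²` norm of `Eg(·,t)` does not depend on `t`. -/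
theorem lintegral_extensionOp_sq {g : ℝ → ℂ} (hg : Integrable g) (hg2 : MemLp g 2 volume) (t : ℝ) :
    ∫⁻ x, ‖extensionOp g x t‖ₑ ^ 2 = ENNReal.ofReal (2 * Real.pi) * ∫⁻ ω, ‖g ω‖ₑ ^ 2 := by
  simp_rw [extensionOp_eq_expIntegral]
  rw [lintegral_expIntegral_sq (integrable_modulate t hg) (memLp_modulate t hg2)]
  simp

theorem lintegral_mul_sq_le {α : Type*} [MeasurableSpace α] {μ : Measure α} {f g : α → ℝ≥0∞}
    (hf : AEMeasurable f μ) (hg : AEMeasurable g μ) :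
    (∫⁻ a, f a * g a ∂μ) ^ 2 ≤ (∫⁻ a, f a ^ 2 ∂μ) * ∫⁻ a, g a ^ 2 ∂μ := by
  have h := ENNReal.lintegral_mul_le_Lp_mul_Lq μ Real.HolderConjugate.two_two hf hg
  simp only [Pi.mul_apply, ENNReal.rpow_ofNat] at h
  calc _ ≤ _ := pow_le_pow_left' h 2
    _ = _ := by
      rw [mul_pow, ← ENNReal.rpow_natCast, ← ENNReal.rpow_natCast, ← ENNReal.rpow_mul,
        ← ENNReal.rpow_mul]
      simp

theorem lintegral_sub_left_sq (h : ℝ → ℂ) (s : ℝ) :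
    ∫⁻ ω, ‖h (s - ω)‖ₑ ^ 2 = ∫⁻ ω, ‖h ω‖ₑ ^ 2 :=
  lintegral_sub_left_eq_self (fun ω => ‖h ω‖ₑ ^ 2) s

theorem lintegral_enorm_sq_lt_top {g : ℝ → ℂ} (hg : MemLp g 2 volume) :
    ∫⁻ ω, ‖g ω‖ₑ ^ 2 < ∞ := by
  rw [← eLpNorm_two_sq]
  exact ENNReal.pow_lt_top hg.2

theorem memLp_two_of_lintegral {α : Type*} [MeasurableSpace α] {μ : Measure α} {g : α → ℂ}
    (hg : AEStronglyMeasurable g μ) (h : ∫⁻ ω, ‖g ω‖ₑ ^ 2 ∂μ < ∞) : MemLp g 2 μ := by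
  refine ⟨hg, ?_⟩
  rw [← eLpNorm_two_sq] at h
  by_contra hc
  rw [not_lt, top_le_iff] at hc
  simp [hc] at h

theorem enorm_convolution_sq_le {g h : ℝ → ℂ} (hg : AEStronglyMeasurable g volume)
    (hh : AEStronglyMeasurable h volume) (s : ℝ) :
    ‖(g ⋆[ContinuousLinearMap.mul ℂ ℂ] h) s‖ₑ ^ 2 ≤
      (∫⁻ ω, ‖g ω‖ₑ ^ 2) * ∫⁻ ω, ‖h ω‖ₑ ^ 2 := by
  have hh' : AEStronglyMeasurable (fun ω => h (s - ω)) volume :=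
    hh.comp_quasiMeasurePreserving (quasiMeasurePreserving_sub_left volume s)
  calc _ ≤ (∫⁻ ω, ‖g ω‖ₑ * ‖h (s - ω)‖ₑ) ^ 2 := by
        gcongr
        refine (enorm_integral_le_lintegral_enorm _).trans (le_of_eq ?_)
        simp
    _ ≤ _ := lintegral_mul_sq_le hg.enorm hh'.enorm
    _ = _ := by rw [lintegral_sub_left_sq]

/-- The convolution is in `L¹` because both factors are, and bounded by Cauchy–Schwarz because both
are in `L²`; a bounded `L¹` function is in `L²`. -/
theorem memLp_convolution {g h : ℝ → ℂ} (hg : Integrable g) (hg2 : MemLp g 2 volume)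
    (hh : Integrable h) (hh2 : MemLp h 2 volume) :
    MemLp (g ⋆[ContinuousLinearMap.mul ℂ ℂ] h) 2 volume := by
  have hi := hg.integrable_convolution (ContinuousLinearMap.mul ℂ ℂ) hh
  refine memLp_two_of_lintegral hi.1 ?_
  set B := (∫⁻ ω, ‖g ω‖ₑ ^ 2) * ∫⁻ ω, ‖h ω‖ₑ ^ 2 with hB
  have hBt : B < ∞ := ENNReal.mul_lt_top (lintegral_enorm_sq_lt_top hg2)
    (lintegral_enorm_sq_lt_top hh2)
  -- The sup bound is `√B`; the larger `1 + B` avoids the square root.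
  have key : ∀ s, ‖(g ⋆[ContinuousLinearMap.mul ℂ ℂ] h) s‖ₑ ^ 2 ≤
      (1 + B) * ‖(g ⋆[ContinuousLinearMap.mul ℂ ℂ] h) s‖ₑ := by
    intro s
    have h1 := enorm_convolution_sq_le hg.1 hh.1 s
    rcases le_total ‖(g ⋆[ContinuousLinearMap.mul ℂ ℂ] h) s‖ₑ (1 + B) with h2 | h2
    · rw [sq]; gcongr
    · have h3 : ‖(g ⋆[ContinuousLinearMap.mul ℂ ℂ] h) s‖ₑ ^ 2 ≤ (1 + B) ^ 2 := by
        refine h1.trans ?_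
        rw [sq]
        calc B = 1 * B := (one_mul B).symm
          _ ≤ _ := by gcongr <;> simp
      calc _ ≤ _ := h3
        _ ≤ _ := by rw [sq]; gcongr
  calc _ ≤ ∫⁻ s, (1 + B) * ‖(g ⋆[ContinuousLinearMap.mul ℂ ℂ] h) s‖ₑ := lintegral_mono key
    _ = (1 + B) * ∫⁻ s, ‖(g ⋆[ContinuousLinearMap.mul ℂ ℂ] h) s‖ₑ :=
        lintegral_const_mul' _ _ (by simp [hBt.ne])
    _ < ∞ := ENNReal.mul_lt_top (by simp [hBt]) hi.2

theorem expIntegral_mul {g h : ℝ → ℂ} (hg : Integrable g) (hh : Integrable h) (x : ℝ) :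
    expIntegral g x * expIntegral h x = expIntegral (g ⋆[ContinuousLinearMap.mul ℂ ℂ] h) x := by
  simp only [expIntegral_eq_fourier]
  exact (Real.fourier_mul_convolution_eq hg hh _).symm

/-- The density of the push-forward of `G` under `ω ↦ (2ω - s)² / 2` on `2ω > s`. -/
def squarePush (s : ℝ) (G : ℝ → ℂ) : ℝ → ℂ :=
  (Ioi 0).indicator fun y => G ((s + √(2 * y)) / 2) / ((2 * √(2 * y) : ℝ) : ℂ)

theorem image_square_Ioi (s : ℝ) : (fun ω => (2 * ω - s) ^ 2 / 2) '' Ioi (s / 2) = Ioi 0 := by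
  ext y
  simp only [mem_image, mem_Ioi]
  constructor
  · rintro ⟨ω, hω, rfl⟩
    have : 0 < 2 * ω - s := by linarith
    positivity
  · intro hy
    have h2 : 0 < √(2 * y) := Real.sqrt_pos.2 (by linarith)
    refine ⟨(s + √(2 * y)) / 2, by linarith, ?_⟩
    have : 2 * ((s + √(2 * y)) / 2) - s = √(2 * y) := by ring
    rw [this, Real.sq_sqrt (by linarith)]
    ring

theorem injOn_square_Ioi (s : ℝ) : InjOn (fun ω => (2 * ω - s) ^ 2 / 2) (Ioi (s / 2)) := by
  intro a ha b hb hab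
  simp only [mem_Ioi] at ha hb hab
  have : (2 * a - s) ^ 2 = (2 * b - s) ^ 2 := by linarith
  have := (sq_eq_sq₀ (by linarith) (by linarith)).1 this
  linarith

theorem hasDerivWithinAt_square (s ω : ℝ) :
    HasDerivWithinAt (fun ω => (2 * ω - s) ^ 2 / 2) (2 * (2 * ω - s)) (Ioi (s / 2)) ω := by
  have h := ((((hasDerivAt_id ω).const_mul 2).sub_const s).pow 2).div_const 2
  refine (h.congr_deriv ?_).hasDerivWithinAt
  simp

theorem squarePush_apply {s ω : ℝ} (hω : s / 2 < ω) (G : ℝ → ℂ) :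
    squarePush s G ((2 * ω - s) ^ 2 / 2) = G ω / ((2 * (2 * ω - s) : ℝ) : ℂ) := by
  have h0 : 0 < 2 * ω - s := by linarith
  have h1 : √(2 * ((2 * ω - s) ^ 2 / 2)) = 2 * ω - s := by
    rw [show 2 * ((2 * ω - s) ^ 2 / 2) = (2 * ω - s) ^ 2 by ring, Real.sqrt_sq h0.le]
  rw [squarePush, indicator_of_mem (by simp only [mem_Ioi]; positivity), h1]
  congr 2
  ring

theorem setIntegral_Ioi_zero_squarePush (s : ℝ) (G : ℝ → ℂ) (e : ℝ → ℂ) :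
    ∫ y in Ioi 0, e y * squarePush s G y =
      ∫ ω in Ioi (s / 2), e ((2 * ω - s) ^ 2 / 2) * G ω := by
  rw [← image_square_Ioi s, integral_image_eq_integral_abs_deriv_smul measurableSet_Ioi
    (fun ω _ => hasDerivWithinAt_square s ω) (injOn_square_Ioi s)]
  refine setIntegral_congr_fun measurableSet_Ioi fun ω hω => ?_
  simp only [mem_Ioi] at hω
  have h0 : 0 < 2 * ω - s := by linarith
  have h1 : (((2 * (2 * ω - s) : ℝ)) : ℂ) ≠ 0 := by exact_mod_cast (by positivity)
  rw [squarePush_apply hω, abs_of_pos (by positivity), Complex.real_smul]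
  field_simp

theorem integrable_squarePush (s : ℝ) {G : ℝ → ℂ} (hG : Integrable G) :
    Integrable (squarePush s G) := by
  have h : IntegrableOn (squarePush s G) (Ioi 0) := by
    rw [← image_square_Ioi s, integrableOn_image_iff_integrableOn_abs_deriv_smul measurableSet_Ioi
      (fun ω _ => hasDerivWithinAt_square s ω) (injOn_square_Ioi s)]
    refine (hG.integrableOn (s := Ioi (s / 2))).congr_fun (fun ω hω => ?_) measurableSet_Ioi
    simp only [mem_Ioi] at hω
    have h0 : 0 < 2 * ω - s := by linarith
    have h1 : (((2 * (2 * ω - s) : ℝ)) : ℂ) ≠ 0 := by exact_mod_cast (by positivity)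
    rw [squarePush_apply hω, abs_of_pos (by positivity), Complex.real_smul]
    field_simp
  rw [← integrable_indicator_iff measurableSet_Ioi] at h
  rwa [squarePush, indicator_indicator, inter_self] at h

/-- Squaring the density produces the inverse Jacobian twice, and the substitution restores one.
What is left is `1 / (2(2ω - s))`, which is at most `1 / (2β)` on the support of `G`. -/
theorem lintegral_squarePush_sq_le {s β : ℝ} (hβ : 0 < β) {G : ℝ → ℂ}
    (hsupp : ∀ ω, G ω ≠ 0 → s + β ≤ 2 * ω) :
    ∫⁻ y, ‖squarePush s G y‖ₑ ^ 2 ≤ ENNReal.ofReal (1 / (2 * β)) * ∫⁻ ω, ‖G ω‖ₑ ^ 2 := by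
  have h : ∫⁻ y, ‖squarePush s G y‖ₑ ^ 2 = ∫⁻ y in Ioi 0, ‖squarePush s G y‖ₑ ^ 2 := by
    rw [← lintegral_indicator measurableSet_Ioi]
    refine lintegral_congr fun y => ?_
    by_cases hy : y ∈ Ioi (0 : ℝ)
    · rw [indicator_of_mem hy]
    · simp [squarePush, indicator_of_notMem hy]
  rw [h, ← image_square_Ioi s, lintegral_image_eq_lintegral_abs_deriv_mul measurableSet_Ioi
      (fun ω _ => hasDerivWithinAt_square s ω) (injOn_square_Ioi s),
      ← lintegral_const_mul' _ _ ENNReal.ofReal_ne_top]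
  refine (setLIntegral_mono' measurableSet_Ioi fun ω hω => ?_).trans (setLIntegral_le_lintegral _ _)
  simp only [mem_Ioi] at hω
  have h0 : 0 < 2 * ω - s := by linarith
  rw [squarePush_apply hω]
  by_cases hGω : G ω = 0
  · simp [hGω]
  have h1 := hsupp ω hGω
  rw [← ofReal_norm, ← ofReal_norm, ← ENNReal.ofReal_pow (norm_nonneg _),
    ← ENNReal.ofReal_pow (norm_nonneg _), ← ENNReal.ofReal_mul (abs_nonneg _),
    ← ENNReal.ofReal_mul (by positivity)]
  refine ENNReal.ofReal_le_ofReal ?_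
  rw [norm_div, Complex.norm_real, Real.norm_eq_abs, abs_of_pos (by positivity : 0 < 2 * (2 * ω - s))]
  have h2 : 1 / (2 * (2 * ω - s)) ≤ 1 / (2 * β) :=
    one_div_le_one_div_of_le (by positivity) (by linarith)
  calc 2 * (2 * ω - s) * (‖G ω‖ / (2 * (2 * ω - s))) ^ 2
      = 1 / (2 * (2 * ω - s)) * ‖G ω‖ ^ 2 := by field_simp
    _ ≤ _ := by gcongr

/-- Plancherel's theorem for the phase `(2ω - s)² t / 2`, away from its critical point. -/
theorem lintegral_phase_sq_le {s β : ℝ} (hβ : 0 < β) {G : ℝ → ℂ} (hG : Integrable G)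
    (hsupp : ∀ ω, G ω ≠ 0 → s + β ≤ 2 * ω) :
    ∫⁻ t : ℝ, ‖∫ ω, Complex.exp (Complex.I * (((2 * ω - s) ^ 2 / 2 * t : ℝ) : ℂ)) * G ω‖ₑ ^ 2 ≤
      ENNReal.ofReal (Real.pi / β) * ∫⁻ ω, ‖G ω‖ₑ ^ 2 := by
  by_cases htop : ∫⁻ ω, ‖G ω‖ₑ ^ 2 = ∞
  · rw [htop, ENNReal.mul_top]
    · exact le_top
    · simpa using div_pos Real.pi_pos hβ
  have hle := lintegral_squarePush_sq_le hβ hsupp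
  have hH := integrable_squarePush s hG
  have hH2 : MemLp (squarePush s G) 2 volume := memLp_two_of_lintegral hH.1
    (hle.trans_lt (ENNReal.mul_lt_top ENNReal.ofReal_lt_top (lt_top_iff_ne_top.2 htop)))
  -- In the variable `y = (2ω - s)² / 2` the phase is linear in `y`, so Plancherel applies in `t`.
  -- Restricting to `ω > s / 2`, where the substitution is injective, loses nothing because of the
  -- support of `G`.
  have heq : ∀ t : ℝ, ∫ ω, Complex.exp (Complex.I * (((2 * ω - s) ^ 2 / 2 * t : ℝ) : ℂ)) * G ω =
      expIntegral (squarePush s G) t := by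
    intro t
    have h := setIntegral_Ioi_zero_squarePush s G
      (fun y => Complex.exp (Complex.I * ((y * t : ℝ) : ℂ)))
    rw [setIntegral_eq_integral_of_forall_compl_eq_zero,
      setIntegral_eq_integral_of_forall_compl_eq_zero] at h
    · exact h.symm
    · intro ω hω
      have : G ω = 0 := by
        by_contra hne
        have := hsupp ω hne
        simp only [mem_Ioi] at hω
        apply hω
        linarith
      rw [this, mul_zero]
    · intro y hy
      rw [squarePush, indicator_of_notMem hy, mul_zero]
  simp_rw [heq]
  rw [lintegral_expIntegral_sq hH hH2]
  calc _ ≤ ENNReal.ofReal (2 * Real.pi) *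
        (ENNReal.ofReal (1 / (2 * β)) * ∫⁻ ω, ‖G ω‖ₑ ^ 2) := by gcongr
    _ = _ := by
      rw [← mul_assoc, ← ENNReal.ofReal_mul Real.two_pi_pos.le]
      congr 2
      field_simp

theorem integrable_mul_sub_left {g h : ℝ → ℂ} (hg : MemLp g 2 volume) (hh : MemLp h 2 volume)
    (s : ℝ) : Integrable fun ω => g ω * h (s - ω) := by
  have hh' : MemLp (fun ω => h (s - ω)) 2 volume :=
    hh.comp_measurePreserving (Measure.measurePreserving_sub_left volume s)
  exact hg.integrable_mul hh'

/-- This is the identity `ω² + (s - ω)² = s² / 2 + (2ω - s)² / 2`. The first term is a unimodular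
factor and disappears in absolute value. -/
theorem convolution_modulate (t : ℝ) (g h : ℝ → ℂ) (s : ℝ) :
    (modulate t g ⋆[ContinuousLinearMap.mul ℂ ℂ] modulate t h) s =
      Complex.exp (Complex.I * ((s ^ 2 / 2 * t : ℝ) : ℂ)) *
      ∫ ω, Complex.exp (Complex.I * (((2 * ω - s) ^ 2 / 2 * t : ℝ) : ℂ)) * (g ω * h (s - ω)) := by
  rw [← integral_const_mul]
  refine integral_congr_ae (Eventually.of_forall fun ω => ?_)
  simp only [ContinuousLinearMap.mul_apply', modulate]
  have : ∀ a b c d : ℂ, a * b * (c * d) = a * c * (b * d) := fun a b c d => by ring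
  rw [this, ← mul_assoc (Complex.exp _) (Complex.exp _) (g ω * h (s - ω)), ← Complex.exp_add,
    ← Complex.exp_add]
  congr 2
  push_cast
  ring

theorem lintegral_extensionOp_mul_sq {g h : ℝ → ℂ} (hg : Integrable g) (hg2 : MemLp g 2 volume)
    (hh : Integrable h) (hh2 : MemLp h 2 volume) (t : ℝ) :
    ∫⁻ x, ‖extensionOp g x t * extensionOp h x t‖ₑ ^ 2 = ENNReal.ofReal (2 * Real.pi) *
      ∫⁻ s, ‖(modulate t g ⋆[ContinuousLinearMap.mul ℂ ℂ] modulate t h) s‖ₑ ^ 2 := by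
  have hg' := integrable_modulate t hg
  have hh' := integrable_modulate t hh
  simp_rw [extensionOp_eq_expIntegral, expIntegral_mul hg' hh']
  exact lintegral_expIntegral_sq (hg'.integrable_convolution _ hh')
    (memLp_convolution hg' (memLp_modulate t hg2) hh' (memLp_modulate t hh2))

/-- The bilinear `L²` estimate for functions with separated supports. -/
theorem lintegral_bilinear_le {g h : ℝ → ℂ} (hg : Integrable g) (hg2 : MemLp g 2 volume)
    (hh : Integrable h) (hh2 : MemLp h 2 volume) {β : ℝ} (hβ : 0 < β)
    (hsep : ∀ a b, g a ≠ 0 → h b ≠ 0 → b + β ≤ a) :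
    ∫⁻ t, ∫⁻ x, ‖extensionOp g x t * extensionOp h x t‖ₑ ^ 2 ≤
      ENNReal.ofReal (2 * Real.pi ^ 2 / β) * ((∫⁻ ω, ‖g ω‖ₑ ^ 2) * ∫⁻ ω, ‖h ω‖ₑ ^ 2) := by
  simp_rw [lintegral_extensionOp_mul_sq hg hg2 hh hh2, convolution_modulate, enorm_mul,
    enorm_exp_I_mul, one_mul]
  -- The `t` integral is moved inside so that Plancherel in time can be used at fixed `s`. The
  -- separation of `ω` and `s - ω` says that `2ω - s ≥ β`.
  rw [lintegral_const_mul' _ _ ENNReal.ofReal_ne_top, lintegral_lintegral_swap]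
  · calc _ ≤ ENNReal.ofReal (2 * Real.pi) * ∫⁻ s, ENNReal.ofReal (Real.pi / β) *
          ∫⁻ ω, ‖g ω * h (s - ω)‖ₑ ^ 2 := by
          gcongr with s
          refine lintegral_phase_sq_le hβ (integrable_mul_sub_left hg2 hh2 s) fun ω hω => ?_
          have := hsep ω (s - ω) (left_ne_zero_of_mul hω) (right_ne_zero_of_mul hω)
          linarith
      _ = ENNReal.ofReal (2 * Real.pi) * (ENNReal.ofReal (Real.pi / β) *
          ((∫⁻ ω, ‖g ω‖ₑ ^ 2) * ∫⁻ ω, ‖h ω‖ₑ ^ 2)) := by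
          rw [lintegral_const_mul' _ _ ENNReal.ofReal_ne_top, lintegral_lintegral_swap]
          · congr 2
            rw [← lintegral_mul_const'']
            · refine lintegral_congr fun ω => ?_
              simp_rw [enorm_mul, mul_pow]
              rw [lintegral_const_mul' _ _ (by finiteness)]
              congr 1
              exact lintegral_sub_right_eq_self (fun s => ‖h s‖ₑ ^ 2) ω
            · exact hg.1.enorm.pow_const 2
          · exact (hg.1.convolution_integrand (ContinuousLinearMap.mul ℂ ℂ) hh.1).enorm.pow_const 2
      _ = _ := by
          rw [← mul_assoc, ← ENNReal.ofReal_mul Real.two_pi_pos.le]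
          congr 2
          ring
  · have h1 : AEStronglyMeasurable (fun p : ℝ × ℝ => g p.2 * h (p.1 - p.2)) (volume.prod volume) :=
      hg.1.convolution_integrand (ContinuousLinearMap.mul ℂ ℂ) hh.1
    have h2 : AEStronglyMeasurable (fun p : (ℝ × ℝ) × ℝ => g p.2 * h (p.1.2 - p.2))
        ((volume.prod volume).prod volume) := by
      have hq : Measure.QuasiMeasurePreserving (fun p : (ℝ × ℝ) × ℝ => (p.1.2, p.2))
          ((volume.prod volume).prod volume) (volume.prod volume) := by
        have e := (measurePreserving_prodAssoc (volume : Measure ℝ) (volume : Measure ℝ)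
          (volume : Measure ℝ)).quasiMeasurePreserving
        exact Measure.quasiMeasurePreserving_snd.comp e
      exact h1.comp_quasiMeasurePreserving hq
    have h3 : Continuous fun p : (ℝ × ℝ) × ℝ =>
        Complex.exp (Complex.I * (((2 * p.2 - p.1.2) ^ 2 / 2 * p.1.1 : ℝ) : ℂ)) := by fun_prop
    exact ((h3.aestronglyMeasurable.mul h2).integral_prod_right').enorm.pow_const 2

end WavePacket

end

/-! ### Bounded overlap, weights and the pointwise majorant -/

noncomputable section

namespace WavePacket

/-- Cauchy–Schwarz over the at most `n` nonzero terms. It serves both for functions with boundedly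
overlapping supports and for plain sums of `n` terms. -/
theorem norm_sum_sq_le_of_overlap {ι : Type*} (P : Finset ι) (z : ι → ℂ) (n : ℕ)
    (T : Finset ι) (hT : ∀ a ∈ P, z a ≠ 0 → a ∈ T) (hn : T.card ≤ n) :
    ‖∑ a ∈ P, z a‖ ^ 2 ≤ n * ∑ a ∈ P, ‖z a‖ ^ 2 := by
  classical
  have h1 : ∑ a ∈ P, z a = ∑ a ∈ P.filter (· ∈ T), z a := by
    rw [Finset.sum_filter]
    refine Finset.sum_congr rfl fun a ha => ?_
    split_ifs with h
    · rfl
    · by_contra hne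
      exact h (hT a ha hne)
  have hc : (P.filter (· ∈ T)).card ≤ n :=
    (Finset.card_le_card fun a ha => (Finset.mem_filter.1 ha).2).trans hn
  rw [h1]
  calc _ ≤ (∑ a ∈ P.filter (· ∈ T), ‖z a‖) ^ 2 := by gcongr; exact norm_sum_le _ _
    _ ≤ (P.filter (· ∈ T)).card * ∑ a ∈ P.filter (· ∈ T), ‖z a‖ ^ 2 := sq_sum_le_card_mul_sum_sq
    _ ≤ _ := by
      gcongr
      exact Finset.filter_subset _ _

theorem enorm_sum_sq_le_of_overlap {ι : Type*} (P : Finset ι) (z : ι → ℂ) (n : ℕ)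
    (T : Finset ι) (hT : ∀ a ∈ P, z a ≠ 0 → a ∈ T) (hn : T.card ≤ n) :
    ‖∑ a ∈ P, z a‖ₑ ^ 2 ≤ n * ∑ a ∈ P, ‖z a‖ₑ ^ 2 := by
  have h := ENNReal.ofReal_le_ofReal (norm_sum_sq_le_of_overlap P z n T hT hn)
  rw [ENNReal.ofReal_mul (by positivity), ENNReal.ofReal_sum_of_nonneg (fun _ _ => by positivity),
    ENNReal.ofReal_natCast, ENNReal.ofReal_pow (norm_nonneg _), ofReal_norm] at h
  simpa [ENNReal.ofReal_pow] using h

/-- The weight `(1 + |y|)^{-2}`. -/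
def wt (y : ℝ) : ℝ := ((1 + |y|) ^ 2)⁻¹

theorem wt_pos (y : ℝ) : 0 < wt y := by unfold wt; positivity

theorem continuous_wt : Continuous wt := by
  unfold wt
  exact Continuous.inv₀ (by fun_prop) fun y => by positivity

theorem summable_wt_int : Summable fun n : ℤ => wt n := by
  have h := (Real.summable_one_div_int_pow (p := 2)).2 (by norm_num)
  refine h.of_norm_bounded_eventually ?_
  have : ({0}ᶜ : Set ℤ) ∈ cofinite := (Set.finite_singleton 0).compl_mem_cofinite
  filter_upwards [this] with n hn
  have hn' : (n : ℝ) ≠ 0 := by exact_mod_cast hn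
  rw [Real.norm_of_nonneg (wt_pos _).le, wt, one_div]
  have h2 : (n : ℝ) ^ 2 ≤ (1 + |(n : ℝ)|) ^ 2 := by
    rw [← sq_abs (n : ℝ)]
    gcongr
    linarith
  exact inv_anti₀ (by positivity) h2

/-- A bound for the sums of `wt` over translates of `ℤ`. -/
def wtSum : ℝ := 4 * ∑' n : ℤ, wt n

theorem wtSum_nonneg : 0 ≤ wtSum := mul_nonneg (by norm_num) (tsum_nonneg fun _ => (wt_pos _).le)

theorem sum_wt_le (u : Finset ℤ) (y : ℝ) : ∑ m ∈ u, wt (y - m) ≤ wtSum := by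
  -- Rounding `y` changes `1 + |y - m|` by a factor of at most 2, hence the weight by at most 4,
  -- uniformly in `y`.
  have h : ∀ m : ℤ, wt (y - m) ≤ 4 * wt ((m - ⌊y⌋ : ℤ) : ℝ) := by
    intro m
    unfold wt
    have h1 : (1 + |((m - ⌊y⌋ : ℤ) : ℝ)|) ≤ 2 * (1 + |y - m|) := by
      have h2 : |((m - ⌊y⌋ : ℤ) : ℝ)| ≤ |y - m| + 1 := by
        push_cast
        have ha := Int.floor_le y
        have hb := Int.lt_floor_add_one y
        rw [abs_le]
        have hc := neg_abs_le (y - m)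
        have hd := le_abs_self (y - m)
        constructor <;> linarith
      linarith [abs_nonneg (y - m)]
    have h3 : (1 + |((m - ⌊y⌋ : ℤ) : ℝ)|) ^ 2 ≤ (2 * (1 + |y - m|)) ^ 2 := by gcongr
    rw [← div_eq_mul_inv, le_div_iff₀ (by positivity), inv_mul_le_iff₀ (by positivity)]
    linarith
  calc _ ≤ ∑ m ∈ u, 4 * wt ((m - ⌊y⌋ : ℤ) : ℝ) := Finset.sum_le_sum fun m _ => h m
    _ = 4 * ∑ n ∈ u.map (Equiv.subRight ⌊y⌋).toEmbedding, wt n := by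
        rw [← Finset.mul_sum, Finset.sum_map]
        rfl
    _ ≤ _ := by
        unfold wtSum
        gcongr
        exact summable_wt_int.sum_le_tsum _ fun _ _ => (wt_pos _).le

theorem lintegral_wt_le {r : ℝ} (hr : 0 < r) (a : ℝ) :
    ∫⁻ x, ENNReal.ofReal (wt (x / r - a)) ≤ ENNReal.ofReal (Real.pi * r) := by
  have hle : ∀ y, wt y ≤ (1 + y ^ 2)⁻¹ := by
    intro y
    unfold wt
    gcongr
    rw [← sq_abs y]
    nlinarith [abs_nonneg y]
  have hI : Integrable fun x : ℝ => (1 + (x / r - a) ^ 2)⁻¹ :=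
    (integrable_inv_one_add_sq.comp_sub_right a).comp_div hr.ne'
  have hval : ∫ x : ℝ, (1 + (x / r - a) ^ 2)⁻¹ = Real.pi * r := by
    rw [Measure.integral_comp_div (fun x : ℝ => (1 + (x - a) ^ 2)⁻¹) r,
      integral_sub_right_eq_self (fun x : ℝ => (1 + x ^ 2)⁻¹) a, integral_univ_inv_one_add_sq,
      abs_of_pos hr, smul_eq_mul, mul_comm]
  calc _ ≤ ∫⁻ x, ENNReal.ofReal ((1 + (x / r - a) ^ 2)⁻¹) :=
        lintegral_mono fun x => ENNReal.ofReal_le_ofReal (hle _)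
    _ = _ := by
        rw [← ofReal_integral_eq_lintegral_ofReal hI
          (Eventually.of_forall fun x => by positivity), hval]

/-- The pointwise majorant `∑ |c_q| (1 + |X - m + 2kT|)^{-2}` of a sum of wave packets. -/
def majorant (c : ℤ × ℤ → ℂ) (u : Finset (ℤ × ℤ)) (X T : ℝ) : ℝ :=
  ∑ q ∈ u, ‖c q‖ * wt (X - q.2 + 2 * q.1 * T)

theorem majorant_nonneg (c : ℤ × ℤ → ℂ) (u : Finset (ℤ × ℤ)) (X T : ℝ) : 0 ≤ majorant c u X T :=
  Finset.sum_nonneg fun _ _ => mul_nonneg (norm_nonneg _) (wt_pos _).le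

theorem majorant_mono (c : ℤ × ℤ → ℂ) {u v : Finset (ℤ × ℤ)} (h : u ⊆ v) (X T : ℝ) :
    majorant c u X T ≤ majorant c v X T :=
  Finset.sum_le_sum_of_subset_of_nonneg h fun _ _ _ => mul_nonneg (norm_nonneg _) (wt_pos _).le

theorem continuous_majorant (c : ℤ × ℤ → ℂ) (u : Finset (ℤ × ℤ)) {f g : ℝ × ℝ → ℝ}
    (hf : Continuous f) (hg : Continuous g) : Continuous fun z => majorant c u (f z) (g z) := by
  unfold majorant
  refine continuous_finsetSum _ fun q _ => continuous_const.mul (continuous_wt.comp ?_)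
  fun_prop

/-- At a fixed point the packets of one frequency have centres in a translate of `ℤ`, so each
frequency costs one `wtSum`. -/
theorem sum_wt_packets_le {u : Finset (ℤ × ℤ)} {κ : Finset ℤ} (hu : ∀ q ∈ u, q.1 ∈ κ) (X T : ℝ) :
    ∑ q ∈ u, wt (X - q.2 + 2 * q.1 * T) ≤ κ.card * wtSum := by
  classical
  have hsub : u ⊆ κ ×ˢ u.image Prod.snd := fun q hq =>
    Finset.mem_product.2 ⟨hu q hq, Finset.mem_image_of_mem _ hq⟩
  calc _ ≤ ∑ q ∈ κ ×ˢ u.image Prod.snd, wt (X - q.2 + 2 * q.1 * T) :=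
        Finset.sum_le_sum_of_subset_of_nonneg hsub fun _ _ _ => (wt_pos _).le
    _ = ∑ k ∈ κ, ∑ m ∈ u.image Prod.snd, wt (X + 2 * k * T - m) := by
        rw [Finset.sum_product]
        refine Finset.sum_congr rfl fun k _ => Finset.sum_congr rfl fun m _ => ?_
        congr 1
        ring
    _ ≤ ∑ k ∈ κ, wtSum := Finset.sum_le_sum fun k _ => sum_wt_le _ _
    _ = _ := by simp

theorem majorant_le {c : ℤ × ℤ → ℂ} {u : Finset (ℤ × ℤ)} {κ : Finset ℤ} (hu : ∀ q ∈ u, q.1 ∈ κ)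
    {b : ℝ} (hb : 0 ≤ b) (hc : ∀ q ∈ u, ‖c q‖ ≤ b) (X T : ℝ) :
    majorant c u X T ≤ b * (κ.card * wtSum) := by
  calc _ ≤ ∑ q ∈ u, b * wt (X - q.2 + 2 * q.1 * T) :=
        Finset.sum_le_sum fun q hq => mul_le_mul_of_nonneg_right (hc q hq) (wt_pos _).le
    _ ≤ _ := by
        rw [← Finset.mul_sum]
        gcongr
        exact sum_wt_packets_le hu X T

/-- Cauchy–Schwarz with the weight split evenly between the two factors. -/
theorem majorant_sq_le (c : ℤ × ℤ → ℂ) {u : Finset (ℤ × ℤ)} {κ : Finset ℤ}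
    (hu : ∀ q ∈ u, q.1 ∈ κ) (X T : ℝ) :
    majorant c u X T ^ 2 ≤
      κ.card * wtSum * ∑ q ∈ u, ‖c q‖ ^ 2 * wt (X - q.2 + 2 * q.1 * T) := by
  have h := Finset.sum_sq_le_sum_mul_sum_of_sq_le_mul u
    (r := fun q => ‖c q‖ * wt (X - q.2 + 2 * q.1 * T))
    (f := fun q => wt (X - q.2 + 2 * q.1 * T))
    (g := fun q => ‖c q‖ ^ 2 * wt (X - q.2 + 2 * q.1 * T)) (fun _ _ => (wt_pos _).le)
    (fun _ _ => mul_nonneg (sq_nonneg _) (wt_pos _).le) (fun _ _ => le_of_eq (by ring))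
  refine h.trans ?_
  gcongr
  · exact Finset.sum_nonneg fun _ _ => mul_nonneg (sq_nonneg _) (wt_pos _).le
  · exact sum_wt_packets_le hu X T

theorem lintegral_majorant_sq_le (c : ℤ × ℤ → ℂ) {u : Finset (ℤ × ℤ)} {κ : Finset ℤ}
    (hu : ∀ q ∈ u, q.1 ∈ κ) {r : ℝ} (hr : 0 < r) (T : ℝ) :
    ∫⁻ x, ENNReal.ofReal (majorant c u (x / r) T ^ 2) ≤
      ENNReal.ofReal (κ.card * wtSum * (Real.pi * r) * ∑ q ∈ u, ‖c q‖ ^ 2) := by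
  have hW := wtSum_nonneg
  have hpi := Real.pi_pos
  calc _ ≤ ∫⁻ x, ENNReal.ofReal (κ.card * wtSum) *
        ∑ q ∈ u, ENNReal.ofReal (‖c q‖ ^ 2) * ENNReal.ofReal (wt (x / r - (q.2 - 2 * q.1 * T))) := by
        refine lintegral_mono fun x => (ENNReal.ofReal_le_ofReal
          (majorant_sq_le c hu (x / r) T)).trans (le_of_eq ?_)
        rw [ENNReal.ofReal_mul (by positivity), ENNReal.ofReal_sum_of_nonneg
          (fun _ _ => mul_nonneg (sq_nonneg _) (wt_pos _).le)]
        congr 1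
        refine Finset.sum_congr rfl fun q _ => ?_
        rw [ENNReal.ofReal_mul (by positivity)]
        congr 3
        ring
    _ = ENNReal.ofReal (κ.card * wtSum) * ∑ q ∈ u, ENNReal.ofReal (‖c q‖ ^ 2) *
        ∫⁻ x, ENNReal.ofReal (wt (x / r - (q.2 - 2 * q.1 * T))) := by
        have hm : ∀ a : ℝ, Measurable fun x : ℝ => ENNReal.ofReal (wt (x / r - a)) := fun a =>
          (continuous_wt.comp (by fun_prop)).measurable.ennreal_ofReal
        rw [lintegral_const_mul' _ _ ENNReal.ofReal_ne_top,
          lintegral_finsetSum _ fun q _ => (hm _).const_mul _]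
        congr 1
        refine Finset.sum_congr rfl fun q _ => ?_
        rw [lintegral_const_mul' _ _ ENNReal.ofReal_ne_top]
    _ ≤ ENNReal.ofReal (κ.card * wtSum) * ∑ q ∈ u, ENNReal.ofReal (‖c q‖ ^ 2) *
        ENNReal.ofReal (Real.pi * r) := by
        gcongr with q hq
        exact lintegral_wt_le hr _
    _ = _ := by
        rw [← Finset.sum_mul, ← ENNReal.ofReal_sum_of_nonneg (fun _ _ => sq_nonneg _),
          ← ENNReal.ofReal_mul (Finset.sum_nonneg fun _ _ => sq_nonneg _),
          ← ENNReal.ofReal_mul (by positivity)]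
        congr 1
        ring

end WavePacket

end

/-! ### Almost orthogonality and Bessel's inequality for wave packets -/

noncomputable section

namespace WavePacket

open scoped Convolution

theorem integrable_exp_mul {g : ℝ → ℂ} (hg : Integrable g) {p : ℝ → ℝ} (hp : Continuous p) :
    Integrable fun ω => Complex.exp (Complex.I * (p ω : ℂ)) * g ω := by
  have hc : Continuous fun ω => Complex.exp (Complex.I * (p ω : ℂ)) := by fun_prop
  refine hg.congr' (hc.aestronglyMeasurable.mul hg.1) (Eventually.of_forall fun ω => ?_)
  rw [norm_mul, norm_exp_I_mul, one_mul]

theorem expIntegral_sum {ι : Type*} (P : Finset ι) {G : ι → ℝ → ℂ}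
    (hG : ∀ p ∈ P, Integrable (G p)) (x : ℝ) :
    expIntegral (fun s => ∑ p ∈ P, G p s) x = ∑ p ∈ P, expIntegral (G p) x := by
  unfold expIntegral
  simp_rw [Finset.mul_sum]
  exact integral_finsetSum _ fun p hp => integrable_exp_mul (hG p hp) (by fun_prop)

theorem extensionOp_sum {ι : Type*} (P : Finset ι) {G : ι → ℝ → ℂ}
    (hG : ∀ p ∈ P, Integrable (G p)) (x t : ℝ) :
    extensionOp (fun s => ∑ p ∈ P, G p s) x t = ∑ p ∈ P, extensionOp (G p) x t := by
  unfold extensionOp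
  simp_rw [Finset.mul_sum]
  exact integral_finsetSum _ fun p hp => integrable_exp_mul (hG p hp) (by fun_prop)

theorem extensionOp_const_mul (a : ℂ) (g : ℝ → ℂ) (x t : ℝ) :
    extensionOp (fun s => a * g s) x t = a * extensionOp g x t := by
  unfold extensionOp
  rw [← integral_const_mul]
  congr 1
  ext ω
  ring

/-- Products of pairs of functions with neighbouring frequencies are almost orthogonal. -/
theorem lintegral_sum_mul_sq_le {g : ℤ → ℝ → ℂ} (hg : ∀ i, Integrable (g i))
    (hg2 : ∀ i, MemLp (g i) 2 volume) {n : ℕ} (hn : 8 ≤ n) {r : ℝ}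
    (hsupp : ∀ i ω, g i ω ≠ 0 → (n * i - 3 : ℝ) ≤ ω * r ∧ ω * r ≤ n * i + n + 2)
    (P : Finset (ℤ × ℤ)) (hP : ∀ p ∈ P, |p.1 - p.2| ≤ 3) (t : ℝ) :
    ∫⁻ x, ‖∑ p ∈ P, extensionOp (g p.1) x t * extensionOp (g p.2) x t‖ₑ ^ 2 ≤
      28 * ∑ p ∈ P, ∫⁻ x, ‖extensionOp (g p.1) x t * extensionOp (g p.2) x t‖ₑ ^ 2 := by
  classical
  set G : ℤ × ℤ → ℝ → ℂ := fun p =>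
    modulate t (g p.1) ⋆[ContinuousLinearMap.mul ℂ ℂ] modulate t (g p.2) with hGdef
  have hGi : ∀ p, Integrable (G p) := fun p =>
    (integrable_modulate t (hg _)).integrable_convolution _ (integrable_modulate t (hg _))
  have hG2 : ∀ p, MemLp (G p) 2 volume := fun p =>
    memLp_convolution (integrable_modulate t (hg _)) (memLp_modulate t (hg2 _))
      (integrable_modulate t (hg _)) (memLp_modulate t (hg2 _))
  have hsum : ∀ x, ∑ p ∈ P, extensionOp (g p.1) x t * extensionOp (g p.2) x t =
      expIntegral (fun s => ∑ p ∈ P, G p s) x := by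
    intro x
    rw [expIntegral_sum P fun p _ => hGi p]
    refine Finset.sum_congr rfl fun p _ => ?_
    rw [extensionOp_eq_expIntegral, extensionOp_eq_expIntegral,
      expIntegral_mul (integrable_modulate t (hg _)) (integrable_modulate t (hg _))]
  have hn' : (8 : ℝ) ≤ n := by exact_mod_cast hn
  -- The Fourier support of a product lies in the sum of the two frequency supports.
  have hGsupp : ∀ p s, G p s ≠ 0 →
      (n * (p.1 + p.2) - 6 : ℝ) ≤ s * r ∧ s * r ≤ n * (p.1 + p.2) + 2 * n + 4 := by
    intro p s hne
    by_contra hcon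
    apply hne
    rw [hGdef]
    simp only [convolution]
    rw [integral_eq_zero_of_ae (Eventually.of_forall fun ω => ?_)]
    simp only [ContinuousLinearMap.mul_apply', Pi.zero_apply, modulate]
    by_contra hω
    have h1 : g p.1 ω ≠ 0 := fun h => hω (by rw [h]; simp)
    have h2 : g p.2 (s - ω) ≠ 0 := fun h => hω (by rw [h]; simp)
    have h3 := hsupp _ _ h1
    have h4 := hsupp _ _ h2
    apply hcon
    constructor <;> nlinarith [h3.1, h3.2, h4.1, h4.2]
  -- For given `s` the sum `p.1 + p.2` lies in an interval of length `2 + 10 / n < 4`, which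
  -- contains at most 4 integers; the difference takes at most 7 values. Sum and difference
  -- determine the pair, and `4 * 7 = 28`.
  have hover : ∀ s, ‖∑ p ∈ P, G p s‖ₑ ^ 2 ≤ 28 * ∑ p ∈ P, ‖G p s‖ₑ ^ 2 := by
    intro s
    set a : ℤ := ⌈(s * r - 2 * n - 4) / n⌉ with ha
    set T : Finset (ℤ × ℤ) := P.filter fun p => p.1 + p.2 ∈ Finset.Icc a (a + 3) with hT
    refine enorm_sum_sq_le_of_overlap P (fun p => G p s) 28 T ?_ ?_
    · intro p hp hne
      obtain ⟨h1, h2⟩ := hGsupp p s hne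
      rw [hT, Finset.mem_filter, Finset.mem_Icc]
      refine ⟨hp, ?_, ?_⟩
      · rw [ha, Int.ceil_le, div_le_iff₀ (by linarith)]
        push_cast
        linarith
      · have h5 : (s * r - 2 * n - 4) / n ≤ a := Int.le_ceil _
        rw [div_le_iff₀ (by linarith)] at h5
        have h6 : ((p.1 + p.2 : ℤ) : ℝ) < (a + 3 + 1 : ℤ) := by
          push_cast
          by_contra hge
          push Not at hge
          have : (n : ℝ) * (a + 3 + 1) ≤ n * (p.1 + p.2) := by gcongr
          nlinarith
        exact Int.lt_add_one_iff.1 (by exact_mod_cast h6)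
    · have hcard : T.card ≤ (Finset.Icc a (a + 3) ×ˢ Finset.Icc (-3 : ℤ) 3).card := by
        refine Finset.card_le_card_of_injOn (fun p => (p.1 + p.2, p.1 - p.2)) ?_ ?_
        · intro p hp
          have hp' := Finset.mem_filter.1 (Finset.mem_coe.1 hp)
          have := abs_le.1 (hP p hp'.1)
          simp only [Finset.coe_product, mem_prod, Finset.mem_coe]
          exact ⟨hp'.2, Finset.mem_Icc.2 this⟩
        · intro p _ p' _ h
          simp only [Prod.mk.injEq] at h
          ext <;> omega
      refine hcard.trans (le_of_eq ?_)
      rw [Finset.card_product, Int.card_Icc, Int.card_Icc]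
      have : (a + 3 + 1 - a).toNat = 4 := by
        rw [show a + 3 + 1 - a = 4 by ring]; rfl
      rw [this]
      rfl
  have hsumi : Integrable fun s => ∑ p ∈ P, G p s := integrable_finsetSum _ fun p _ => hGi p
  have hsum2 : MemLp (fun s => ∑ p ∈ P, G p s) 2 volume := memLp_finsetSum _ fun p _ => hG2 p
  simp_rw [hsum]
  rw [lintegral_expIntegral_sq hsumi hsum2]
  simp_rw [lintegral_extensionOp_mul_sq (hg _) (hg2 _) (hg _) (hg2 _) t]
  rw [← Finset.mul_sum, mul_left_comm]
  gcongr
  rw [← lintegral_finsetSum' _ fun p _ => (hGi p).1.enorm.pow_const 2,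
    ← lintegral_const_mul' _ _ (by norm_num)]
  exact lintegral_mono hover

/-- A family of functions with the support and decay properties of wave packets of size `R`,
indexed by all of `ℤ × ℤ`. -/
structure PacketFamily (R : ℝ) (K : ℕ → ℝ) (φ : ℤ × ℤ → ℝ → ℂ) : Prop where
  memLp : ∀ q, MemLp (φ q) 2 volume
  support : ∀ q ω, φ q ω ≠ 0 → |ω * √R - q.1| ≤ 3
  decay : ∀ q, ∀ N : ℕ, 0 < N → ∀ x t : ℝ, |t| ≤ R → ‖extensionOp (φ q) x t‖ ≤
    K N * R ^ (-(1 / 4) : ℝ) / (1 + |x / √R - q.2 + 2 * q.1 * (t / R)|) ^ N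

/-- The sum of the wave packets in `u`. -/
def synth (c : ℤ × ℤ → ℂ) (φ : ℤ × ℤ → ℝ → ℂ) (u : Finset (ℤ × ℤ)) : ℝ → ℂ :=
  fun ω => ∑ q ∈ u, c q * φ q ω

theorem integrable_of_memLp_of_support {g : ℝ → ℂ} (hg : MemLp g 2 volume) {a b : ℝ}
    (h : Function.support g ⊆ Icc a b) : Integrable g := by
  have h1 : IntegrableOn g (Icc a b) := (hg.restrict (Icc a b)).integrable (by norm_num)
  rwa [integrableOn_iff_integrable_of_support_subset h] at h1

namespace PacketFamily

variable {R : ℝ} {K : ℕ → ℝ} {φ : ℤ × ℤ → ℝ → ℂ}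

theorem K_nonneg (hφ : PacketFamily R K φ) (hR : 0 < R) {N : ℕ} (hN : 0 < N) : 0 ≤ K N := by
  have h := (norm_nonneg _).trans (hφ.decay 0 N hN 0 0 (by simpa using hR.le))
  have h2 : 0 < R ^ (-(1 / 4) : ℝ) := Real.rpow_pos_of_pos hR _
  by_contra hK
  push Not at hK
  have : K N * R ^ (-(1 / 4) : ℝ) / (1 + |0 / √R - ((0 : ℤ × ℤ).2 : ℝ) +
    2 * ((0 : ℤ × ℤ).1 : ℝ) * (0 / R)|) ^ N < 0 :=
    div_neg_of_neg_of_pos (mul_neg_of_neg_of_pos hK h2) (by positivity)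
  linarith

theorem integrable (hφ : PacketFamily R K φ) (hR : 0 < R) (q : ℤ × ℤ) : Integrable (φ q) := by
  have hr : 0 < √R := Real.sqrt_pos.2 hR
  refine integrable_of_memLp_of_support (hφ.memLp q) (a := (q.1 - 3) / √R) (b := (q.1 + 3) / √R)
    fun ω hω => ?_
  have := abs_le.1 (hφ.support q ω hω)
  rw [mem_Icc, div_le_iff₀ hr, le_div_iff₀ hr]
  constructor <;> linarith

theorem integrable_synth (hφ : PacketFamily R K φ) (hR : 0 < R) (c : ℤ × ℤ → ℂ)
    (u : Finset (ℤ × ℤ)) : Integrable (synth c φ u) :=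
  integrable_finsetSum _ fun q _ => (hφ.integrable hR q).const_mul _

theorem memLp_synth (hφ : PacketFamily R K φ) (c : ℤ × ℤ → ℂ)
    (u : Finset (ℤ × ℤ)) : MemLp (synth c φ u) 2 volume :=
  memLp_finsetSum _ fun q _ => (hφ.memLp q).const_mul _

theorem extensionOp_synth (hφ : PacketFamily R K φ) (hR : 0 < R) (c : ℤ × ℤ → ℂ)
    (u : Finset (ℤ × ℤ)) (x t : ℝ) :
    extensionOp (synth c φ u) x t = ∑ q ∈ u, c q * extensionOp (φ q) x t := by
  unfold synth
  rw [extensionOp_sum u fun q _ => (hφ.integrable hR q).const_mul _]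
  simp_rw [extensionOp_const_mul]

/-- Of the `N + 2` powers of decay, `N` are spent on the distance `ρ` and two are kept as the
summable weight of the majorant. -/
theorem norm_extensionOp_synth_le_of_far (hφ : PacketFamily R K φ) (hR : 0 < R) (c : ℤ × ℤ → ℂ)
    (u : Finset (ℤ × ℤ)) {x t : ℝ} (ht : |t| ≤ R) (N : ℕ) {ρ : ℝ} (hρ : 0 < ρ)
    (hu : ∀ q ∈ u, ρ ≤ 1 + |x / √R - q.2 + 2 * q.1 * (t / R)|) :
    ‖extensionOp (synth c φ u) x t‖ ≤
      K (N + 2) * R ^ (-(1 / 4) : ℝ) * (ρ ^ N)⁻¹ * majorant c u (x / √R) (t / R) := by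
  rw [hφ.extensionOp_synth hR, majorant, Finset.mul_sum]
  refine (norm_sum_le _ _).trans (Finset.sum_le_sum fun q hq => ?_)
  have hK := hφ.K_nonneg hR (N := N + 2) (by omega)
  have h2 : 0 < R ^ (-(1 / 4) : ℝ) := Real.rpow_pos_of_pos hR _
  rw [norm_mul]
  calc _ ≤ ‖c q‖ * (K (N + 2) * R ^ (-(1 / 4) : ℝ) /
        (1 + |x / √R - q.2 + 2 * q.1 * (t / R)|) ^ (N + 2)) := by
        gcongr
        exact hφ.decay q (N + 2) (by omega) x t ht
    _ = ‖c q‖ * (K (N + 2) * R ^ (-(1 / 4) : ℝ) *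
        ((1 + |x / √R - q.2 + 2 * q.1 * (t / R)|) ^ N)⁻¹ *
        wt (x / √R - q.2 + 2 * q.1 * (t / R))) := by
        rw [pow_add, wt]
        field_simp
    _ ≤ ‖c q‖ * (K (N + 2) * R ^ (-(1 / 4) : ℝ) * (ρ ^ N)⁻¹ *
        wt (x / √R - q.2 + 2 * q.1 * (t / R))) := by
        have := (wt_pos (x / √R - q.2 + 2 * q.1 * (t / R))).le
        gcongr
        exact hu q hq
    _ = _ := by ring

theorem norm_extensionOp_synth_le (hφ : PacketFamily R K φ) (hR : 0 < R) (c : ℤ × ℤ → ℂ)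
    (u : Finset (ℤ × ℤ)) {x t : ℝ} (ht : |t| ≤ R) :
    ‖extensionOp (synth c φ u) x t‖ ≤
      K 2 * R ^ (-(1 / 4) : ℝ) * majorant c u (x / √R) (t / R) := by
  simpa using hφ.norm_extensionOp_synth_le_of_far hR c u ht 0 one_pos fun q _ => by
    linarith [abs_nonneg (x / √R - q.2 + 2 * q.1 * (t / R))]

theorem rpow_neg_quarter_sq (hR : 0 < R) : (R ^ (-(1 / 4) : ℝ)) ^ 2 = (√R)⁻¹ := by
  rw [← Real.rpow_natCast, ← Real.rpow_mul hR.le, Real.sqrt_eq_rpow, ← Real.rpow_neg hR.le]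
  norm_num

/-- Packets of one frequency are not assumed orthogonal. Their almost orthogonality comes from the
decay: Plancherel carries the norm to `t = 0`, where they concentrate at different positions. -/
theorem lintegral_synth_sq_le_of_freq (hφ : PacketFamily R K φ) (hR : 0 < R) (c : ℤ × ℤ → ℂ)
    {u : Finset (ℤ × ℤ)} {k : ℤ} (hu : ∀ q ∈ u, q.1 = k) :
    ∫⁻ ω, ‖synth c φ u ω‖ₑ ^ 2 ≤ ENNReal.ofReal (K 2 ^ 2 * wtSum * ∑ q ∈ u, ‖c q‖ ^ 2) := by
  have hr : 0 < √R := Real.sqrt_pos.2 hR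
  have hK := hφ.K_nonneg hR (N := 2) (by omega)
  have h1 := lintegral_extensionOp_sq (hφ.integrable_synth hR c u) (hφ.memLp_synth c u) 0
  have hW := wtSum_nonneg
  have hS : 0 ≤ ∑ q ∈ u, ‖c q‖ ^ 2 := Finset.sum_nonneg fun _ _ => sq_nonneg _
  have h2 : ∫⁻ x, ‖extensionOp (synth c φ u) x 0‖ₑ ^ 2 ≤
      ENNReal.ofReal (K 2 ^ 2 * wtSum * Real.pi * ∑ q ∈ u, ‖c q‖ ^ 2) := by
    calc _ ≤ ∫⁻ x, ENNReal.ofReal (K 2 ^ 2 * (√R)⁻¹) *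
          ENNReal.ofReal (majorant c u (x / √R) (0 / R) ^ 2) := by
          refine lintegral_mono fun x => ?_
          rw [← ofReal_norm, ← ENNReal.ofReal_pow (norm_nonneg _),
            ← ENNReal.ofReal_mul (by positivity)]
          refine ENNReal.ofReal_le_ofReal ?_
          rw [← rpow_neg_quarter_sq hR, ← mul_pow, ← mul_pow]
          gcongr
          exact hφ.norm_extensionOp_synth_le hR c u (by simpa using hR.le)
      _ ≤ ENNReal.ofReal (K 2 ^ 2 * (√R)⁻¹) * ENNReal.ofReal
          (({k} : Finset ℤ).card * wtSum * (Real.pi * √R) * ∑ q ∈ u, ‖c q‖ ^ 2) := by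
          rw [lintegral_const_mul' _ _ ENNReal.ofReal_ne_top]
          gcongr
          exact lintegral_majorant_sq_le c (fun q hq => by simp [hu q hq]) hr _
      _ = _ := by
          rw [← ENNReal.ofReal_mul (by positivity)]
          congr 1
          simp
          field_simp
  rw [h1] at h2
  have h3 : ENNReal.ofReal (K 2 ^ 2 * wtSum * Real.pi * ∑ q ∈ u, ‖c q‖ ^ 2) ≤
      ENNReal.ofReal (2 * Real.pi) * ENNReal.ofReal (K 2 ^ 2 * wtSum * ∑ q ∈ u, ‖c q‖ ^ 2) := by
    rw [← ENNReal.ofReal_mul Real.two_pi_pos.le]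
    refine ENNReal.ofReal_le_ofReal ?_
    have : 0 ≤ K 2 ^ 2 * wtSum * Real.pi * ∑ q ∈ u, ‖c q‖ ^ 2 := by
      have := Real.pi_pos
      positivity
    linarith
  exact (ENNReal.mul_le_mul_iff_right (by simpa using Real.pi_pos) ENNReal.ofReal_ne_top).1
    (h2.trans h3)

/-- Bessel's inequality for wave packets. -/
theorem lintegral_synth_sq_le (hφ : PacketFamily R K φ) (hR : 0 < R) (c : ℤ × ℤ → ℂ)
    (u : Finset (ℤ × ℤ)) :
    ∫⁻ ω, ‖synth c φ u ω‖ₑ ^ 2 ≤ ENNReal.ofReal (7 * K 2 ^ 2 * wtSum * ∑ q ∈ u, ‖c q‖ ^ 2) := by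
  classical
  have hW := wtSum_nonneg
  set κ := u.image Prod.fst with hκ
  have hdec : ∀ ω, synth c φ u ω = ∑ k ∈ κ, synth c φ (u.filter fun q => q.1 = k) ω := by
    intro ω
    unfold synth
    exact (Finset.sum_fiberwise_of_maps_to (fun q hq => Finset.mem_image_of_mem _ hq) _).symm
  have hover : ∀ ω, ‖synth c φ u ω‖ₑ ^ 2 ≤
      7 * ∑ k ∈ κ, ‖synth c φ (u.filter fun q => q.1 = k) ω‖ₑ ^ 2 := by
    intro ω
    rw [hdec]
    -- At most 7 integers lie within distance 3 of `ω √R`.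
    refine enorm_sum_sq_le_of_overlap κ _ 7 (Finset.Icc (⌈ω * √R - 3⌉) (⌈ω * √R - 3⌉ + 6)) ?_ ?_
    · intro k _ hne
      obtain ⟨q, hq, hqne⟩ := Finset.exists_ne_zero_of_sum_ne_zero hne
      have hqk := (Finset.mem_filter.1 hq).2
      have h := abs_le.1 (hφ.support q ω (right_ne_zero_of_mul hqne))
      rw [hqk] at h
      rw [Finset.mem_Icc, Int.ceil_le]
      refine ⟨by linarith [h.2], ?_⟩
      have h2 := Int.le_ceil (ω * √R - 3)
      have : (k : ℝ) ≤ ((⌈ω * √R - 3⌉ + 6 : ℤ) : ℝ) := by push_cast; linarith [h.1]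
      exact_mod_cast this
    · rw [Int.card_Icc]
      omega
  calc _ ≤ ∫⁻ ω, 7 * ∑ k ∈ κ, ‖synth c φ (u.filter fun q => q.1 = k) ω‖ₑ ^ 2 :=
        lintegral_mono hover
    _ = 7 * ∑ k ∈ κ, ∫⁻ ω, ‖synth c φ (u.filter fun q => q.1 = k) ω‖ₑ ^ 2 := by
        rw [lintegral_const_mul' _ _ (by norm_num), lintegral_finsetSum' _ fun k _ =>
          (hφ.memLp_synth c _).1.enorm.pow_const 2]
    _ ≤ 7 * ∑ k ∈ κ, ENNReal.ofReal (K 2 ^ 2 * wtSum *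
          ∑ q ∈ u.filter fun q => q.1 = k, ‖c q‖ ^ 2) := by
        gcongr with k _
        exact hφ.lintegral_synth_sq_le_of_freq hR c fun q hq => (Finset.mem_filter.1 hq).2
    _ = _ := by
        rw [← ENNReal.ofReal_sum_of_nonneg fun k _ => mul_nonneg (by positivity)
          (Finset.sum_nonneg fun _ _ => sq_nonneg _), ← Finset.mul_sum,
          Finset.sum_fiberwise_of_maps_to (fun q hq => Finset.mem_image_of_mem _ hq),
          ← ENNReal.ofReal_ofNat, ← ENNReal.ofReal_mul (by norm_num)]
        congr 1
        ring

end PacketFamily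

end WavePacket

end

/-! ### Frequency cells and spatial localization -/

noncomputable section

namespace WavePacket

theorem continuous_extensionOp {g : ℝ → ℂ} (hg : Integrable g) :
    Continuous fun z : ℝ × ℝ => extensionOp g z.1 z.2 := by
  unfold extensionOp
  refine continuous_of_dominated (bound := fun ω => ‖g ω‖) (fun z => ?_) (fun z => ?_) hg.norm
    (Eventually.of_forall fun ω => by fun_prop)
  · exact (integrable_exp_mul hg (by fun_prop)).1
  · refine Eventually.of_forall fun ω => ?_
    rw [norm_mul, norm_exp_I_mul, one_mul]

/-- Lebesgue measure on the strip of all `(x,t)` with `|t| ≤ R`. -/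
def strip (R : ℝ) : Measure (ℝ × ℝ) := (volume : Measure ℝ).prod (volume.restrict (Icc (-R) R))

theorem lintegral_strip (R : ℝ) {G : ℝ × ℝ → ℝ≥0∞} (hG : Measurable G) :
    ∫⁻ z, G z ∂strip R = ∫⁻ t in Icc (-R) R, ∫⁻ x, G (x, t) :=
  lintegral_prod_symm' _ hG

theorem ae_strip_abs_le (R : ℝ) : ∀ᵐ z ∂strip R, |z.2| ≤ R := by
  have h1 : ∀ᵐ t ∂(volume.restrict (Icc (-R) R)), |t| ≤ R := by
    filter_upwards [ae_restrict_mem measurableSet_Icc] with t ht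
    exact abs_le.2 ht
  exact Measure.quasiMeasurePreserving_snd.ae h1

/-- The packets of `s` whose frequency index lies in the `i`-th interval of length `n`. -/
def cell (n : ℕ) (s : Finset (ℤ × ℤ)) (i : ℤ) : Finset (ℤ × ℤ) := s.filter fun q => q.1 / (n : ℤ) = i

/-- The indices of the spatial intervals of length `n` that are within `ρ + 9` lengths of `m`. -/
def nearIndices (n : ℕ) (ρ : ℝ) (m : ℤ) : Finset ℤ :=
  Finset.Icc ⌈(m / n : ℝ) - (ρ + 9)⌉ ⌊(m / n : ℝ) + (ρ + 9)⌋

/-- The packets of `u` that are near the `j`-th spatial interval of length `n`. -/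
def near (n : ℕ) (ρ : ℝ) (u : Finset (ℤ × ℤ)) (j : ℤ) : Finset (ℤ × ℤ) :=
  u.filter fun q => j ∈ nearIndices n ρ q.2

theorem near_subset (n : ℕ) (ρ : ℝ) (u : Finset (ℤ × ℤ)) (j : ℤ) : near n ρ u j ⊆ u :=
  Finset.filter_subset _ _

theorem cell_subset (n : ℕ) (s : Finset (ℤ × ℤ)) (i : ℤ) : cell n s i ⊆ s :=
  Finset.filter_subset _ _

theorem mem_cell_bounds {n : ℕ} (hn : 0 < n) {s : Finset (ℤ × ℤ)} {i : ℤ} {q : ℤ × ℤ}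
    (hq : q ∈ cell n s i) : n * i ≤ q.1 ∧ q.1 ≤ n * i + n - 1 := by
  have h := (Finset.mem_filter.1 hq).2
  have hn' : (0 : ℤ) < n := by exact_mod_cast hn
  have h1 := Int.emod_add_mul_ediv q.1 n
  have h2 := Int.emod_nonneg q.1 hn'.ne'
  have h3 := Int.emod_lt_of_pos q.1 hn'
  rw [h] at h1
  constructor <;> linarith

/-- An interval of length `2(ρ + 9)` contains at most `2ρ + 19` integers, and this is at most `21ρ`
since `ρ ≥ 1`. -/
theorem card_nearIndices_le (n : ℕ) {ρ : ℝ} (hρ : 1 ≤ ρ) (m : ℤ) :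
    ((nearIndices n ρ m).card : ℝ) ≤ 21 * ρ := by
  rw [nearIndices, Int.card_Icc]
  set a := ⌈(m / n : ℝ) - (ρ + 9)⌉
  set b := ⌊(m / n : ℝ) + (ρ + 9)⌋
  have ha : (m / n : ℝ) - (ρ + 9) ≤ a := Int.le_ceil _
  have hb : (b : ℝ) ≤ (m / n : ℝ) + (ρ + 9) := Int.floor_le _
  rcases le_total (b + 1 - a) 0 with h | h
  · rw [Int.toNat_of_nonpos h]
    simp
    linarith
  · have : (((b + 1 - a).toNat : ℤ) : ℝ) = b + 1 - a := by
      rw [Int.toNat_of_nonneg h]; push_cast; ring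
    rw [← Int.cast_natCast, this]
    linarith

theorem le_of_notMem_nearIndices {n : ℕ} (hn : 0 < n) {ρ : ℝ} {m j : ℤ}
    (h : j ∉ nearIndices n ρ m) :
    (ρ + 9) * n < m - n * j ∨ (ρ + 9) * n < n * j - m := by
  have hn' : (0 : ℝ) < n := by exact_mod_cast hn
  have e : (m / n : ℝ) * n = m := by field_simp
  rw [nearIndices, Finset.mem_Icc, not_and_or, Int.ceil_le, Int.le_floor, not_le, not_le] at h
  rcases h with h | h
  · left
    have := mul_lt_mul_of_pos_right h hn'
    nlinarith
  · right
    have := mul_lt_mul_of_pos_right h hn'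
    nlinarith

theorem le_of_mem_nearIndices {n : ℕ} (hn : 0 < n) {ρ : ℝ} {m j : ℤ}
    (h : j ∈ nearIndices n ρ m) :
    (n * j - (ρ + 9) * n : ℝ) ≤ m ∧ (m : ℝ) ≤ n * j + (ρ + 9) * n := by
  have hn' : (0 : ℝ) < n := by exact_mod_cast hn
  have e : (m / n : ℝ) * n = m := by field_simp
  rw [nearIndices, Finset.mem_Icc, Int.ceil_le, Int.le_floor] at h
  have h1 := mul_le_mul_of_nonneg_right h.1 hn'.le
  have h2 := mul_le_mul_of_nonneg_right h.2 hn'.le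
  constructor <;> nlinarith

/-- Packets which are not near the spatial interval of a point are far from the point. -/
theorem far_of_notMem_nearIndices {n : ℕ} (hn : 0 < n) {ρ : ℝ} (hρ : 1 ≤ ρ) {i : ℤ} {q : ℤ × ℤ}
    (hq : |(q.1 : ℝ) - n * i| ≤ 4 * n) {X T : ℝ} (hT : |T| ≤ 1)
    (h : ⌊(X + 2 * (n * i) * T) / n⌋ ∉ nearIndices n ρ q.2) :
    ρ ≤ 1 + |X - q.2 + 2 * q.1 * T| := by
  have hn' : (1 : ℝ) ≤ n := by exact_mod_cast hn
  have hn0 : (0 : ℝ) < n := by linarith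
  set j := ⌊(X + 2 * (n * i) * T) / n⌋
  have h1 : (j : ℝ) ≤ (X + 2 * (n * i) * T) / n := Int.floor_le _
  have h2 : (X + 2 * (n * i) * T) / n < j + 1 := Int.lt_floor_add_one _
  rw [le_div_iff₀ hn0] at h1
  rw [div_lt_iff₀ hn0] at h2
  have h3 : |((q.1 : ℝ) - n * i) * T| ≤ 4 * n := by
    rw [abs_mul]
    exact (mul_le_mul hq hT (abs_nonneg _) (by positivity)).trans_eq (mul_one _)
  have h4 := abs_le.1 h3
  have h5 : ρ ≤ ρ * n := by nlinarith
  -- The choice of 9: the point transported to time `0` with frequency `n i` lies in `[n j, n j +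
  -- n)`, and replacing `n i` by `q.1` moves it by at most `8 n`. Out of the distance `(ρ + 9) n` at
  -- least `ρ n` survives.
  have e : X - q.2 + 2 * q.1 * T =
      (X + 2 * (n * i) * T) - q.2 + 2 * (((q.1 : ℝ) - n * i) * T) := by ring
  rw [e]
  rcases le_of_notMem_nearIndices hn h with h | h
  · refine le_trans ?_ (add_le_add_right (neg_le_abs _) 1)
    nlinarith [h4.2]
  · refine le_trans ?_ (add_le_add_right (le_abs_self _) 1)
    nlinarith [h4.1]

theorem abs_sub_le_of_mem_cell {n : ℕ} (hn : 0 < n) {s : Finset (ℤ × ℤ)} {i i' : ℤ}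
    (hi : |i - i'| ≤ 3) {q : ℤ × ℤ} (hq : q ∈ cell n s i') : |(q.1 : ℝ) - n * i| ≤ 4 * n := by
  obtain ⟨h1, h2⟩ := mem_cell_bounds hn hq
  obtain ⟨h3, h4⟩ := abs_le.1 hi
  have h5 : (n : ℤ) * i ≤ n * (i' + 3) := by gcongr; linarith
  have h6 : (n : ℤ) * (i' - 3) ≤ n * i := by gcongr; linarith
  have : |q.1 - n * i| ≤ 4 * n := by
    rw [abs_le]
    constructor <;> linarith
  exact_mod_cast this

/-- There are `n` frequencies, and for each of them at most `2(ρ + 9) n + 1 ≤ 21 ρ n` positions. -/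
theorem card_near_cell_le {n : ℕ} (hn : 0 < n) {ρ : ℝ} (hρ : 1 ≤ ρ) (s : Finset (ℤ × ℤ)) (i j : ℤ) :
    ((near n ρ (cell n s i) j).card : ℝ) ≤ 21 * ρ * n ^ 2 := by
  have hn' : (1 : ℝ) ≤ n := by exact_mod_cast hn
  set a := ⌈(n * j - (ρ + 9) * n : ℝ)⌉
  set b := ⌊(n * j + (ρ + 9) * n : ℝ)⌋
  have hsub : near n ρ (cell n s i) j ⊆
      Finset.Icc ((n : ℤ) * i) (n * i + n - 1) ×ˢ Finset.Icc a b := by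
    intro q hq
    have h1 := Finset.mem_filter.1 hq
    have h2 := mem_cell_bounds hn h1.1
    have h3 := le_of_mem_nearIndices hn h1.2
    rw [Finset.mem_product, Finset.mem_Icc, Finset.mem_Icc, Int.ceil_le, Int.le_floor]
    exact ⟨h2, h3⟩
  have h := Finset.card_le_card hsub
  rw [Finset.card_product, Int.card_Icc, Int.card_Icc] at h
  have e1 : ((n : ℤ) * i + n - 1 + 1 - n * i).toNat = n := by
    rw [show (n : ℤ) * i + n - 1 + 1 - n * i = n by ring, Int.toNat_natCast]
  rw [e1] at h
  have h' : ((near n ρ (cell n s i) j).card : ℝ) ≤ n * ((b + 1 - a).toNat : ℝ) := by exact_mod_cast h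
  have e2 : (((b + 1 - a).toNat : ℕ) : ℝ) ≤ 21 * ρ * n := by
    have ha : (n * j - (ρ + 9) * n : ℝ) ≤ a := Int.le_ceil _
    have hb : (b : ℝ) ≤ (n * j + (ρ + 9) * n : ℝ) := Int.floor_le _
    have h9 : (n : ℝ) ≤ ρ * n := by nlinarith
    rcases le_total (b + 1 - a) 0 with h | h
    · rw [Int.toNat_of_nonpos h]
      simp only [Nat.cast_zero]
      positivity
    · have : (((b + 1 - a).toNat : ℤ) : ℝ) = b + 1 - a := by
        rw [Int.toNat_of_nonneg h]; push_cast; ring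
      rw [← Int.cast_natCast, this]
      nlinarith
  calc _ ≤ _ := h'
    _ ≤ n * (21 * ρ * n) := by gcongr
    _ = _ := by ring

/-- The near part of a cell has few packets, hence small energy. -/
theorem sum_near_cell_sq_le {n : ℕ} (hn : 0 < n) {ρ : ℝ} (hρ : 1 ≤ ρ) {s : Finset (ℤ × ℤ)} (i j : ℤ)
    {c : ℤ × ℤ → ℂ} {b H : ℝ} (hb : 0 ≤ b) (hH : 0 ≤ H) (hcb : ∀ q ∈ s, ‖c q‖ ≤ b)
    (hcH : ∑ q ∈ s, ‖c q‖ ^ 2 ≤ H ^ 2) :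
    ∑ q ∈ near n ρ (cell n s i) j, ‖c q‖ ^ 2 ≤ 21 * ρ * n * (b * H) := by
  have hsub : near n ρ (cell n s i) j ⊆ s := (near_subset _ _ _ _).trans (cell_subset _ _ _)
  set S := ∑ q ∈ near n ρ (cell n s i) j, ‖c q‖ ^ 2
  have hS0 : 0 ≤ S := Finset.sum_nonneg fun _ _ => sq_nonneg _
  have h1 : S ≤ H ^ 2 :=
    (Finset.sum_le_sum_of_subset_of_nonneg hsub fun _ _ _ => sq_nonneg _).trans hcH
  have h2 : S ≤ 21 * ρ * n ^ 2 * b ^ 2 := by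
    calc S ≤ ∑ q ∈ near n ρ (cell n s i) j, b ^ 2 :=
          Finset.sum_le_sum fun q hq => by
            have := hcb q (hsub hq)
            gcongr
      _ = (near n ρ (cell n s i) j).card * b ^ 2 := by simp
      _ ≤ _ := by gcongr; exact card_near_cell_le hn hρ s i j
  -- Geometric mean of the energy bound `H²` and the counting bound. It is linear in `n`, which is
  -- exactly what the factor `1 / n` of the bilinear estimate can absorb.
  refine le_of_sq_le_sq ?_ (by positivity)
  calc S ^ 2 = S * S := sq S
    _ ≤ (21 * ρ * n ^ 2 * b ^ 2) * H ^ 2 := by gcongr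
    _ = (21 * ρ) * (n ^ 2 * b ^ 2 * H ^ 2) := by ring
    _ ≤ (21 * ρ) ^ 2 * (n ^ 2 * b ^ 2 * H ^ 2) := by
        gcongr
        nlinarith
    _ = _ := by ring

/-- Each packet is near at most `21ρ` spatial intervals. -/
theorem sum_sum_near_sq_le (n : ℕ) {ρ : ℝ} (hρ : 1 ≤ ρ) (u : Finset (ℤ × ℤ)) (J : Finset ℤ)
    (c : ℤ × ℤ → ℂ) :
    ∑ j ∈ J, ∑ q ∈ near n ρ u j, ‖c q‖ ^ 2 ≤ 21 * ρ * ∑ q ∈ u, ‖c q‖ ^ 2 := by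
  simp_rw [near, Finset.sum_filter]
  rw [Finset.sum_comm, Finset.mul_sum]
  refine Finset.sum_le_sum fun q _ => ?_
  rw [← Finset.sum_filter, Finset.sum_const, nsmul_eq_mul]
  gcongr
  refine le_trans ?_ (card_nearIndices_le n hρ q.2)
  exact_mod_cast Finset.card_le_card fun j hj => (Finset.mem_filter.1 hj).2

end WavePacket

end

/-! ### The estimate for one pair of separated cells -/

noncomputable section

namespace WavePacket

theorem enorm_sq_eq_ofReal (z : ℂ) : ‖z‖ₑ ^ 2 = ENNReal.ofReal (‖z‖ ^ 2) := by
  rw [← ofReal_norm, ENNReal.ofReal_pow (norm_nonneg _)]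

namespace PacketFamily

variable {R : ℝ} {K : ℕ → ℝ} {φ : ℤ × ℤ → ℝ → ℂ}

theorem measurable_mul_sq (hφ : PacketFamily R K φ) (hR : 0 < R) (c : ℤ × ℤ → ℂ)
    (u v : Finset (ℤ × ℤ)) : Measurable fun z : ℝ × ℝ =>
      ‖extensionOp (synth c φ u) z.1 z.2 * extensionOp (synth c φ v) z.1 z.2‖ₑ ^ 2 :=
  ((continuous_extensionOp (hφ.integrable_synth hR c u)).mul
    (continuous_extensionOp (hφ.integrable_synth hR c v))).measurable.enorm.pow_const 2

theorem synth_support (hφ : PacketFamily R K φ) {c : ℤ × ℤ → ℂ} {n : ℕ} (hn : 0 < n)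
    {s u : Finset (ℤ × ℤ)} {i : ℤ} (hu : u ⊆ cell n s i) {ω : ℝ} (hω : synth c φ u ω ≠ 0) :
    (n * i - 3 : ℝ) ≤ ω * √R ∧ ω * √R ≤ n * i + n + 2 := by
  obtain ⟨q, hq, hne⟩ := Finset.exists_ne_zero_of_sum_ne_zero hω
  have h := abs_le.1 (hφ.support q ω (right_ne_zero_of_mul hne))
  obtain ⟨h1, h2⟩ := mem_cell_bounds hn (hu hq)
  have h1' : (n * i : ℝ) ≤ q.1 := by exact_mod_cast h1
  have h2' : (q.1 : ℝ) ≤ n * i + n - 1 := by exact_mod_cast h2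
  constructor <;> linarith [h.1, h.2]

/-- The bilinear estimate for sums of wave packets in two separated frequency intervals. -/
theorem lintegral_bilinear_cells_le (hφ : PacketFamily R K φ) (hR : 0 < R) (c : ℤ × ℤ → ℂ)
    {n : ℕ} (hn : 8 ≤ n) {s u v : Finset (ℤ × ℤ)} {i i' : ℤ} (hu : u ⊆ cell n s i)
    (hv : v ⊆ cell n s i') (hi : 2 ≤ |i - i'|) :
    ∫⁻ z, ‖extensionOp (synth c φ u) z.1 z.2 * extensionOp (synth c φ v) z.1 z.2‖ₑ ^ 2 ∂strip R ≤
      ENNReal.ofReal (6 * Real.pi ^ 2 * (7 * K 2 ^ 2 * wtSum) ^ 2 * (√R / n) *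
        ((∑ q ∈ u, ‖c q‖ ^ 2) * ∑ q ∈ v, ‖c q‖ ^ 2)) := by
  wlog h : i' + 2 ≤ i generalizing u v i i'
  · have hi' : 2 ≤ |i' - i| := by rwa [abs_sub_comm]
    have h' : i + 2 ≤ i' := by
      rcases le_abs.1 hi with h1 | h1 <;> linarith
    simpa only [mul_comm] using this hv hu hi' h'
  have hr : 0 < √R := Real.sqrt_pos.2 hR
  have hn0 : (8 : ℝ) ≤ n := by exact_mod_cast hn
  have hnp : (0 : ℝ) < n := by linarith
  -- Supports of cells at index distance at least 2 are separated by `n - 5` in units of `R^{-1/2}`: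
  -- a full cell lies between them, and packet supports stick out. For `n ≥ 8` this is at least `3n
  -- / 8`.
  have hβ : 0 < 3 * n / (8 * √R) := by positivity
  have hW := wtSum_nonneg
  have hSu : 0 ≤ ∑ q ∈ u, ‖c q‖ ^ 2 := Finset.sum_nonneg fun _ _ => sq_nonneg _
  have hSv : 0 ≤ ∑ q ∈ v, ‖c q‖ ^ 2 := Finset.sum_nonneg fun _ _ => sq_nonneg _
  have hbil := lintegral_bilinear_le (hφ.integrable_synth hR c u) (hφ.memLp_synth c u)
    (hφ.integrable_synth hR c v) (hφ.memLp_synth c v) hβ (fun a b ha hb => by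
      have h1 := (hφ.synth_support (by omega) hu ha).1
      have h2 := (hφ.synth_support (by omega) hv hb).2
      have h3 : (n * (i' + 2) : ℝ) ≤ n * i := by
        gcongr
        exact_mod_cast h
      rw [← sub_nonneg]
      have : 0 ≤ (a - (b + 3 * n / (8 * √R))) * √R := by
        have e : (a - (b + 3 * n / (8 * √R))) * √R = a * √R - b * √R - 3 * n / 8 := by
          field_simp
          ring
        rw [e]
        nlinarith
      exact nonneg_of_mul_nonneg_left this hr)
  rw [lintegral_strip R (hφ.measurable_mul_sq hR c u v)]
  calc _ ≤ _ := (setLIntegral_le_lintegral _ _).trans hbil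
    _ ≤ ENNReal.ofReal (2 * Real.pi ^ 2 / (3 * n / (8 * √R))) *
        (ENNReal.ofReal (7 * K 2 ^ 2 * wtSum * ∑ q ∈ u, ‖c q‖ ^ 2) *
        ENNReal.ofReal (7 * K 2 ^ 2 * wtSum * ∑ q ∈ v, ‖c q‖ ^ 2)) := by
        gcongr
        · exact hφ.lintegral_synth_sq_le hR c u
        · exact hφ.lintegral_synth_sq_le hR c v
    _ ≤ _ := by
        rw [← ENNReal.ofReal_mul (by positivity), ← ENNReal.ofReal_mul (by positivity)]
        refine ENNReal.ofReal_le_ofReal ?_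
        have e : 2 * Real.pi ^ 2 / (3 * n / (8 * √R)) = 16 / 3 * Real.pi ^ 2 * (√R / n) := by
          field_simp
          ring
        rw [e]
        have h0 : 0 ≤ Real.pi ^ 2 * (√R / n) * ((7 * K 2 ^ 2 * wtSum) ^ 2 *
          ((∑ q ∈ u, ‖c q‖ ^ 2) * ∑ q ∈ v, ‖c q‖ ^ 2)) := by positivity
        nlinarith

/-- The pointwise error of replacing a pair of cells by their near parts. -/
def pairError (R : ℝ) (K : ℕ → ℝ) (c : ℤ × ℤ → ℂ) (s : Finset (ℤ × ℤ)) (N : ℕ) (ρ : ℝ)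
    (z : ℝ × ℝ) : ℝ :=
  8 * (K 2 ^ 2 * K (N + 2) ^ 2 * R⁻¹ * ((ρ ^ N)⁻¹) ^ 2) * majorant c s (z.1 / √R) (z.2 / R) ^ 4

/-- Near a given point both cells are dominated by the packets that start in one common spatial
interval. A single `j` serves both because their velocities are close. -/
theorem norm_mul_sq_le_near (hφ : PacketFamily R K φ) (hR : 0 < R) (c : ℤ × ℤ → ℂ)
    (s : Finset (ℤ × ℤ)) {n : ℕ} (hn : 0 < n) {i i' : ℤ} (hi : |i - i'| ≤ 3) {ρ : ℝ} (hρ : 1 ≤ ρ)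
    (N : ℕ) {z : ℝ × ℝ} (hz : |z.2| ≤ R) :
    ∃ j : ℤ, ‖extensionOp (synth c φ (cell n s i)) z.1 z.2 *
        extensionOp (synth c φ (cell n s i')) z.1 z.2‖ ^ 2 ≤
      2 * ‖extensionOp (synth c φ (near n ρ (cell n s i) j)) z.1 z.2 *
        extensionOp (synth c φ (near n ρ (cell n s i') j)) z.1 z.2‖ ^ 2 +
      pairError R K c s N ρ z := by
  obtain ⟨x, t⟩ := z
  simp only at hz ⊢
  have hT : |t / R| ≤ 1 := by
    rw [abs_div, abs_of_pos hR, div_le_one hR]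
    exact hz
  -- The interval reached by following the line of frequency `n i` from the point back to time `0`.
  set j := ⌊(x / √R + 2 * (n * i) * (t / R)) / n⌋ with hj
  refine ⟨j, ?_⟩
  set a := K 2 * R ^ (-(1 / 4) : ℝ) * majorant c s (x / √R) (t / R) with ha
  set e := K (N + 2) * R ^ (-(1 / 4) : ℝ) * (ρ ^ N)⁻¹ * majorant c s (x / √R) (t / R) with he
  have hK2 := hφ.K_nonneg hR (N := 2) (by omega)
  have hKN := hφ.K_nonneg hR (N := N + 2) (by omega)
  have hR4 : 0 < R ^ (-(1 / 4) : ℝ) := Real.rpow_pos_of_pos hR _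
  have hM := majorant_nonneg c s (x / √R) (t / R)
  have hpt : ∀ u ⊆ s, ‖extensionOp (synth c φ u) x t‖ ≤ a := by
    intro u hu
    refine (hφ.norm_extensionOp_synth_le hR c u hz).trans ?_
    rw [ha]
    gcongr
    exact majorant_mono c hu _ _
  have hfar : ∀ l, |i - l| ≤ 3 →
      ‖extensionOp (synth c φ (cell n s l)) x t -
        extensionOp (synth c φ (near n ρ (cell n s l) j)) x t‖ ≤ e := by
    intro l hl
    have hsplit : extensionOp (synth c φ (cell n s l)) x t -
        extensionOp (synth c φ (near n ρ (cell n s l) j)) x t =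
        extensionOp (synth c φ ((cell n s l).filter fun q => j ∉ nearIndices n ρ q.2)) x t := by
      simp only [hφ.extensionOp_synth hR]
      rw [sub_eq_iff_eq_add, near, add_comm]
      exact (Finset.sum_filter_add_sum_filter_not (cell n s l) _ _).symm
    rw [hsplit]
    refine (hφ.norm_extensionOp_synth_le_of_far hR c _ hz N (ρ := ρ) (by linarith)
      fun q hq => ?_).trans ?_
    · have hq' := Finset.mem_filter.1 hq
      exact far_of_notMem_nearIndices hn hρ (abs_sub_le_of_mem_cell hn hl hq'.1) hT hq'.2
    · rw [he]
      gcongr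
      exact majorant_mono c ((Finset.filter_subset _ _).trans (cell_subset _ _ _)) _ _
  have h1 := hpt _ (cell_subset n s i')
  have h2 := hpt _ ((near_subset n ρ (cell n s i) j).trans (cell_subset n s i))
  have h3 := hfar i (by simp)
  have h4 := hfar i' hi
  set F := extensionOp (synth c φ (cell n s i)) x t
  set F' := extensionOp (synth c φ (cell n s i')) x t
  set G := extensionOp (synth c φ (near n ρ (cell n s i) j)) x t
  set G' := extensionOp (synth c φ (near n ρ (cell n s i') j)) x t
  have ha0 : 0 ≤ a := by positivity
  have he0 : 0 ≤ e := by positivity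
  have h5 : ‖F * F'‖ ≤ ‖G * G'‖ + 2 * (e * a) := by
    have e1 : F * F' = G * G' + ((F - G) * F' + G * (F' - G')) := by ring
    calc ‖F * F'‖ = ‖G * G' + ((F - G) * F' + G * (F' - G'))‖ := by rw [← e1]
      _ ≤ ‖G * G'‖ + (‖F - G‖ * ‖F'‖ + ‖G‖ * ‖F' - G'‖) := by
          refine (norm_add_le _ _).trans ?_
          gcongr
          refine (norm_add_le _ _).trans ?_
          rw [norm_mul, norm_mul]
      _ ≤ ‖G * G'‖ + (e * a + a * e) := by gcongr
      _ = _ := by ring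
  have h6 : pairError R K c s N ρ (x, t) = 8 * (e * a) ^ 2 := by
    have hq : (R ^ (-(1 / 4) : ℝ)) ^ 4 = R⁻¹ := by
      rw [show (4 : ℕ) = 2 * 2 by norm_num, pow_mul, rpow_neg_quarter_sq hR, inv_pow,
        Real.sq_sqrt hR.le]
    rw [pairError, he, ha, ← hq]
    ring
  rw [h6]
  calc ‖F * F'‖ ^ 2 ≤ (‖G * G'‖ + 2 * (e * a)) ^ 2 := by gcongr
    _ ≤ _ := by nlinarith [sq_nonneg (‖G * G'‖ - 2 * (e * a))]

/-- The contribution of a pair of separated cells. -/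
theorem lintegral_pair_le (hφ : PacketFamily R K φ) (hR : 0 < R) {c : ℤ × ℤ → ℂ}
    {s : Finset (ℤ × ℤ)} {n : ℕ} (hn : 8 ≤ n) {i i' : ℤ} (hi2 : 2 ≤ |i - i'|) (hi : |i - i'| ≤ 3)
    {ρ : ℝ} (hρ : 1 ≤ ρ) (N : ℕ) {b H : ℝ} (hb : 0 ≤ b) (hH : 0 ≤ H) (hcb : ∀ q ∈ s, ‖c q‖ ≤ b)
    (hcH : ∑ q ∈ s, ‖c q‖ ^ 2 ≤ H ^ 2) :
    ∫⁻ z, ‖extensionOp (synth c φ (cell n s i)) z.1 z.2 *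
        extensionOp (synth c φ (cell n s i')) z.1 z.2‖ₑ ^ 2 ∂strip R ≤
      ENNReal.ofReal (12 * 21 ^ 2 * Real.pi ^ 2 * (7 * K 2 ^ 2 * wtSum) ^ 2 * ρ ^ 2 *
        √R * (b * H) * ∑ q ∈ cell n s i, ‖c q‖ ^ 2) +
      ∫⁻ z, ENNReal.ofReal (pairError R K c s N ρ z) ∂strip R := by
  classical
  have hn0 : (8 : ℝ) ≤ n := by exact_mod_cast hn
  have hnp : (0 : ℝ) < n := by linarith
  have hW := wtSum_nonneg
  -- The interval `j` depends on the point, so the near product is bounded by the sum over all `j`.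
  -- Outside this finite set the near parts are empty.
  set J : Finset ℤ := s.biUnion fun q => nearIndices n ρ q.2 with hJ
  have hpt : ∀ᵐ z ∂strip R, ‖extensionOp (synth c φ (cell n s i)) z.1 z.2 *
        extensionOp (synth c φ (cell n s i')) z.1 z.2‖ₑ ^ 2 ≤
      2 * ∑ j ∈ J, ‖extensionOp (synth c φ (near n ρ (cell n s i) j)) z.1 z.2 *
        extensionOp (synth c φ (near n ρ (cell n s i') j)) z.1 z.2‖ₑ ^ 2 +
      ENNReal.ofReal (pairError R K c s N ρ z) := by
    filter_upwards [ae_strip_abs_le R] with z hz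
    obtain ⟨j, hj⟩ := hφ.norm_mul_sq_le_near hR c s (n := n) (by omega) hi hρ N hz
    have h1 := ENNReal.ofReal_le_ofReal hj
    rw [ENNReal.ofReal_add (by positivity) (by unfold pairError; positivity),
      ENNReal.ofReal_mul (by norm_num), ← enorm_sq_eq_ofReal, ← enorm_sq_eq_ofReal,
      ENNReal.ofReal_ofNat] at h1
    refine h1.trans ?_
    gcongr
    by_cases hjJ : j ∈ J
    · exact Finset.single_le_sum (f := fun j =>
        ‖extensionOp (synth c φ (near n ρ (cell n s i) j)) z.1 z.2 *
        extensionOp (synth c φ (near n ρ (cell n s i') j)) z.1 z.2‖ₑ ^ 2)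
        (fun _ _ => zero_le) hjJ
    · have hempty : near n ρ (cell n s i) j = ∅ := by
        rw [near, Finset.filter_eq_empty_iff]
        intro q hq hjq
        exact hjJ (Finset.mem_biUnion.2 ⟨q, cell_subset n s i hq, hjq⟩)
      rw [hempty, hφ.extensionOp_synth hR]
      simp
  refine (lintegral_mono_ae hpt).trans ?_
  have hmeas : ∀ j, Measurable fun z : ℝ × ℝ =>
      ‖extensionOp (synth c φ (near n ρ (cell n s i) j)) z.1 z.2 *
        extensionOp (synth c φ (near n ρ (cell n s i') j)) z.1 z.2‖ₑ ^ 2 := fun j =>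
    hφ.measurable_mul_sq hR c _ _
  rw [lintegral_add_left ((Finset.measurable_sum J fun j _ => hmeas j).const_mul 2)]
  gcongr
  rw [lintegral_const_mul' _ _ (by norm_num), lintegral_finsetSum _ fun j _ => hmeas j]
  -- The near energy of the cell `i'` is bounded uniformly in `j` and cancels the `n` of `√R / n`;
  -- the near energies of the cell `i` are kept and summed over `j`.
  calc _ ≤ 2 * ∑ j ∈ J, ENNReal.ofReal (6 * Real.pi ^ 2 * (7 * K 2 ^ 2 * wtSum) ^ 2 * (√R / n) *
        ((∑ q ∈ near n ρ (cell n s i) j, ‖c q‖ ^ 2) * (21 * ρ * n * (b * H)))) := by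
        gcongr with j hj
        refine (hφ.lintegral_bilinear_cells_le hR c hn (near_subset n ρ (cell n s i) j)
          (near_subset n ρ (cell n s i') j) hi2).trans (ENNReal.ofReal_le_ofReal ?_)
        gcongr
        exact sum_near_cell_sq_le (by omega) hρ i' j hb hH hcb hcH
    _ = ENNReal.ofReal (12 * 21 * Real.pi ^ 2 * (7 * K 2 ^ 2 * wtSum) ^ 2 * √R * ρ * (b * H) *
        ∑ j ∈ J, ∑ q ∈ near n ρ (cell n s i) j, ‖c q‖ ^ 2) := by
        rw [← ENNReal.ofReal_sum_of_nonneg, ← ENNReal.ofReal_ofNat,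
          ← ENNReal.ofReal_mul (by norm_num), ← Finset.mul_sum, ← Finset.sum_mul]
        · congr 1
          field_simp
          ring
        · intro j _
          have : 0 ≤ ∑ q ∈ near n ρ (cell n s i) j, ‖c q‖ ^ 2 :=
            Finset.sum_nonneg fun _ _ => sq_nonneg _
          positivity
    _ ≤ _ := by
        refine ENNReal.ofReal_le_ofReal ?_
        calc _ ≤ 12 * 21 * Real.pi ^ 2 * (7 * K 2 ^ 2 * wtSum) ^ 2 * √R * ρ * (b * H) *
              (21 * ρ * ∑ q ∈ cell n s i, ‖c q‖ ^ 2) := by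
              gcongr
              exact sum_sum_near_sq_le n hρ _ J c
          _ = _ := by ring

end PacketFamily

end WavePacket

end

/-! ### Summation over the pairs of one scale -/

noncomputable section

namespace WavePacket

/-- Each index has at most 7 partners within distance 3. -/
theorem sum_pairs_le {I : Finset ℤ} {P : Finset (ℤ × ℤ)} (hI : ∀ p ∈ P, p.1 ∈ I)
    (hP : ∀ p ∈ P, |p.1 - p.2| ≤ 3) {g : ℤ → ℝ} (hg : ∀ i, 0 ≤ g i) :
    ∑ p ∈ P, g p.1 ≤ 7 * ∑ i ∈ I, g i := by
  classical
  rw [← Finset.sum_fiberwise_of_maps_to hI, Finset.mul_sum]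
  refine Finset.sum_le_sum fun i _ => ?_
  rw [Finset.sum_congr rfl (g := fun _ => g i) fun p hp => by rw [(Finset.mem_filter.1 hp).2],
    Finset.sum_const, nsmul_eq_mul]
  refine mul_le_mul_of_nonneg_right ?_ (hg i)
  have : (P.filter fun p => p.1 = i).card ≤ (Finset.Icc (i - 3) (i + 3)).card := by
    refine Finset.card_le_card_of_injOn Prod.snd (fun p hp => ?_) fun p hp p' hp' h => ?_
    · have hp' := Finset.mem_filter.1 (Finset.mem_coe.1 hp)
      have := abs_le.1 (hP p hp'.1)
      rw [Finset.mem_coe, Finset.mem_Icc]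
      constructor <;> linarith [this.1, this.2, hp'.2]
    · have h1 := (Finset.mem_filter.1 (Finset.mem_coe.1 hp)).2
      have h2 := (Finset.mem_filter.1 (Finset.mem_coe.1 hp')).2
      exact Prod.ext (h1.trans h2.symm) h
  rw [Int.card_Icc, show i + 3 + 1 - (i - 3) = 7 by ring] at this
  exact_mod_cast this

theorem card_image_fst_le {R : ℝ} (hR : 1 ≤ R) {s : Finset (ℤ × ℤ)}
    (hs : ∀ q ∈ s, |(q.1 : ℝ)| ≤ √R) : ((s.image Prod.fst).card : ℝ) ≤ 3 * √R := by
  have hr : 1 ≤ √R := Real.one_le_sqrt.2 hR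
  have hsub : s.image Prod.fst ⊆ Finset.Icc (-⌊√R⌋) ⌊√R⌋ := by
    intro k hk
    obtain ⟨q, hq, rfl⟩ := Finset.mem_image.1 hk
    have h := abs_le.1 (hs q hq)
    have h1 : -q.1 ≤ ⌊√R⌋ := Int.le_floor.2 (by push_cast; linarith [h.1])
    exact Finset.mem_Icc.2 ⟨by linarith, Int.le_floor.2 h.2⟩
  have h := Finset.card_le_card hsub
  rw [Int.card_Icc] at h
  have h0 : 0 ≤ ⌊√R⌋ := Int.floor_nonneg.2 (by linarith)
  have h2 : (((⌊√R⌋ + 1 - -⌊√R⌋).toNat : ℤ) : ℝ) = 2 * ⌊√R⌋ + 1 := by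
    rw [Int.toNat_of_nonneg (by linarith)]; push_cast; ring
  have h3 : (⌊√R⌋ : ℝ) ≤ √R := Int.floor_le _
  calc ((s.image Prod.fst).card : ℝ) ≤ ((⌊√R⌋ + 1 - -⌊√R⌋).toNat : ℝ) := by exact_mod_cast h
    _ = 2 * ⌊√R⌋ + 1 := by rw [← h2]; norm_cast
    _ ≤ _ := by linarith

theorem card_image_ediv_le (n : ℕ) (s : Finset (ℤ × ℤ)) :
    (s.image fun q => q.1 / (n : ℤ)).card ≤ (s.image Prod.fst).card := by
  have : (s.image fun q => q.1 / (n : ℤ)) = (s.image Prod.fst).image fun k => k / (n : ℤ) := by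
    rw [Finset.image_image]; rfl
  rw [this]
  exact Finset.card_image_le

theorem sum_cells (n : ℕ) (s : Finset (ℤ × ℤ)) (g : ℤ × ℤ → ℝ) :
    ∑ i ∈ s.image (fun q => q.1 / (n : ℤ)), ∑ q ∈ cell n s i, g q = ∑ q ∈ s, g q :=
  Finset.sum_fiberwise_of_maps_to (fun _ hq => Finset.mem_image_of_mem _ hq) _

theorem volume_Icc_neg (R : ℝ) :
    (volume.restrict (Icc (-R) R)) univ = ENNReal.ofReal (2 * R) := by
  rw [Measure.restrict_apply_univ, Real.volume_Icc]
  congr 1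
  ring

namespace PacketFamily

variable {R : ℝ} {K : ℕ → ℝ} {φ : ℤ × ℤ → ℝ → ℂ}

/-- Two of the four majorants are bounded by their supremum, which is `O(√R b)` as there are `O(√R)`
frequencies; the other two are integrated. The total is `R² ρ^{-2N} b² H²` up to constants, and `hN`
turns this into a gain of `R⁻¹`, which later pays for the number of cells. -/
theorem lintegral_pairError_le (hR : 1 ≤ R) {c : ℤ × ℤ → ℂ} {s : Finset (ℤ × ℤ)}
    (hs : ∀ q ∈ s, |(q.1 : ℝ)| ≤ √R) {N : ℕ} {ρ : ℝ} (hρ : 1 ≤ ρ) (hN : R ^ 3 ≤ (ρ ^ N) ^ 2)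
    {b H : ℝ} (hb : 0 ≤ b) (hcb : ∀ q ∈ s, ‖c q‖ ≤ b)
    (hcH : ∑ q ∈ s, ‖c q‖ ^ 2 ≤ H ^ 2) :
    ∫⁻ z, ENNReal.ofReal (pairError R K c s N ρ z) ∂strip R ≤
      ENNReal.ofReal (432 * Real.pi * K 2 ^ 2 * K (N + 2) ^ 2 * wtSum ^ 3 * R⁻¹ *
        (b ^ 2 * H ^ 2)) := by
  have hR0 : 0 < R := by linarith
  have hr : 0 < √R := Real.sqrt_pos.2 hR0
  have hW := wtSum_nonneg
  have hpi := Real.pi_pos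
  have hκ : ∀ q ∈ s, q.1 ∈ s.image Prod.fst := fun q hq => Finset.mem_image_of_mem _ hq
  have hcard := card_image_fst_le hR hs
  set A := 8 * (K 2 ^ 2 * K (N + 2) ^ 2 * R⁻¹ * ((ρ ^ N)⁻¹) ^ 2) with hA
  have hA0 : 0 ≤ A := by positivity
  have hmajc : Continuous fun z : ℝ × ℝ => majorant c s (z.1 / √R) (z.2 / R) :=
    continuous_majorant c s (by fun_prop) (by fun_prop)
  have hmajm : Measurable fun z : ℝ × ℝ =>
      ENNReal.ofReal (majorant c s (z.1 / √R) (z.2 / R) ^ 2) :=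
    (hmajc.measurable.pow_const 2).ennreal_ofReal
  have hpt : ∀ z : ℝ × ℝ, ENNReal.ofReal (pairError R K c s N ρ z) ≤
      ENNReal.ofReal (A * (b * (3 * √R * wtSum)) ^ 2) *
        ENNReal.ofReal (majorant c s (z.1 / √R) (z.2 / R) ^ 2) := by
    intro z
    rw [← ENNReal.ofReal_mul (by positivity)]
    refine ENNReal.ofReal_le_ofReal ?_
    have h1 : majorant c s (z.1 / √R) (z.2 / R) ≤ b * (3 * √R * wtSum) :=
      (majorant_le hκ hb hcb _ _).trans (by gcongr)
    have h0 := majorant_nonneg c s (z.1 / √R) (z.2 / R)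
    rw [pairError, ← hA, show (4 : ℕ) = 2 + 2 by norm_num, pow_add, ← mul_assoc]
    gcongr
  calc _ ≤ ∫⁻ z, ENNReal.ofReal (A * (b * (3 * √R * wtSum)) ^ 2) *
        ENNReal.ofReal (majorant c s (z.1 / √R) (z.2 / R) ^ 2) ∂strip R := lintegral_mono hpt
    _ = ENNReal.ofReal (A * (b * (3 * √R * wtSum)) ^ 2) * ∫⁻ t in Icc (-R) R,
        ∫⁻ x, ENNReal.ofReal (majorant c s (x / √R) (t / R) ^ 2) := by
        rw [lintegral_const_mul' _ _ ENNReal.ofReal_ne_top,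
          lintegral_strip R hmajm]
    _ ≤ ENNReal.ofReal (A * (b * (3 * √R * wtSum)) ^ 2) * ∫⁻ _ in Icc (-R) R,
        ENNReal.ofReal (3 * √R * wtSum * (Real.pi * √R) * H ^ 2) := by
        gcongr with t
        refine (lintegral_majorant_sq_le c hκ hr _).trans (ENNReal.ofReal_le_ofReal ?_)
        gcongr
    _ = ENNReal.ofReal (A * (b * (3 * √R * wtSum)) ^ 2 *
        (3 * √R * wtSum * (Real.pi * √R) * H ^ 2 * (2 * R))) := by
        rw [lintegral_const, volume_Icc_neg, ← ENNReal.ofReal_mul (by positivity),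
          ← ENNReal.ofReal_mul (by positivity)]
    _ ≤ _ := by
        refine ENNReal.ofReal_le_ofReal ?_
        have hsq : √R ^ 2 = R := Real.sq_sqrt hR0.le
        have h4 : √R ^ 4 = R ^ 2 := by rw [show √R ^ 4 = (√R ^ 2) ^ 2 by ring, hsq]
        have hρN : 0 < ρ ^ N := by positivity
        have e : A * (b * (3 * √R * wtSum)) ^ 2 *
            (3 * √R * wtSum * (Real.pi * √R) * H ^ 2 * (2 * R)) =
            432 * Real.pi * K 2 ^ 2 * K (N + 2) ^ 2 * wtSum ^ 3 *
            (R ^ 2 * ((ρ ^ N) ^ 2)⁻¹) * (b ^ 2 * H ^ 2) := by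
          rw [hA, ← h4]
          field_simp
          ring
        rw [e]
        have : R ^ 2 * ((ρ ^ N) ^ 2)⁻¹ ≤ R⁻¹ := by
          rw [← div_eq_mul_inv, div_le_iff₀ (by positivity), inv_mul_eq_div, le_div_iff₀ hR0]
          linarith [show R ^ 2 * R = R ^ 3 by ring]
        gcongr

theorem lintegral_sum_pairs_le (hφ : PacketFamily R K φ) (hR : 0 < R) (c : ℤ × ℤ → ℂ)
    (s : Finset (ℤ × ℤ)) {n : ℕ} (hn : 8 ≤ n) {P : Finset (ℤ × ℤ)}
    (hP : ∀ p ∈ P, |p.1 - p.2| ≤ 3) :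
    ∫⁻ z, ‖∑ p ∈ P, extensionOp (synth c φ (cell n s p.1)) z.1 z.2 *
        extensionOp (synth c φ (cell n s p.2)) z.1 z.2‖ₑ ^ 2 ∂strip R ≤
      28 * ∑ p ∈ P, ∫⁻ z, ‖extensionOp (synth c φ (cell n s p.1)) z.1 z.2 *
        extensionOp (synth c φ (cell n s p.2)) z.1 z.2‖ₑ ^ 2 ∂strip R := by
  have hc : ∀ u, Continuous fun z : ℝ × ℝ => extensionOp (synth c φ u) z.1 z.2 := fun u =>
    continuous_extensionOp (hφ.integrable_synth hR c u)
  have hm : Measurable fun z : ℝ × ℝ => ‖∑ p ∈ P, extensionOp (synth c φ (cell n s p.1)) z.1 z.2 *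
        extensionOp (synth c φ (cell n s p.2)) z.1 z.2‖ₑ ^ 2 :=
    (continuous_finsetSum _ fun p _ => (hc _).mul (hc _)).measurable.enorm.pow_const 2
  have hm2 : ∀ p : ℤ × ℤ, Measurable fun z : ℝ × ℝ =>
      ‖extensionOp (synth c φ (cell n s p.1)) z.1 z.2 *
        extensionOp (synth c φ (cell n s p.2)) z.1 z.2‖ₑ ^ 2 := fun p =>
    hφ.measurable_mul_sq hR c _ _
  rw [lintegral_strip R hm]
  calc _ ≤ ∫⁻ t in Icc (-R) R, 28 * ∑ p ∈ P, ∫⁻ x,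
        ‖extensionOp (synth c φ (cell n s p.1)) x t *
        extensionOp (synth c φ (cell n s p.2)) x t‖ₑ ^ 2 :=
        lintegral_mono fun t => lintegral_sum_mul_sq_le
          (g := fun i => synth c φ (cell n s i)) (fun i => hφ.integrable_synth hR c _)
          (fun i => hφ.memLp_synth c _) hn
          (fun i ω hω => hφ.synth_support (by omega) Finset.Subset.rfl hω) P hP t
    _ = _ := by
        rw [lintegral_const_mul' _ _ (by norm_num), lintegral_finsetSum]
        · congr 1
          refine Finset.sum_congr rfl fun p _ => ?_
          rw [lintegral_strip R (hm2 p)]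
        · intro p _
          exact Measurable.lintegral_prod_left' (hm2 p)

/-- The contribution of all pairs of cells at one dyadic distance. -/
theorem lintegral_separated_pairs_le (hφ : PacketFamily R K φ) (hR : 1 ≤ R) {c : ℤ × ℤ → ℂ}
    {s : Finset (ℤ × ℤ)} (hs : ∀ q ∈ s, |(q.1 : ℝ)| ≤ √R) {n : ℕ} (hn : 8 ≤ n)
    {P : Finset (ℤ × ℤ)} (hPI : ∀ p ∈ P, p.1 ∈ s.image fun q => q.1 / (n : ℤ))
    (hP2 : ∀ p ∈ P, 2 ≤ |p.1 - p.2|) (hP : ∀ p ∈ P, |p.1 - p.2| ≤ 3)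
    {N : ℕ} {ρ : ℝ} (hρ : 1 ≤ ρ) (hN : R ^ 3 ≤ (ρ ^ N) ^ 2)
    {b H : ℝ} (hb : 0 ≤ b) (hbH : b ≤ H) (hcb : ∀ q ∈ s, ‖c q‖ ≤ b)
    (hcH : ∑ q ∈ s, ‖c q‖ ^ 2 ≤ H ^ 2) :
    ∫⁻ z, ‖∑ p ∈ P, extensionOp (synth c φ (cell n s p.1)) z.1 z.2 *
        extensionOp (synth c φ (cell n s p.2)) z.1 z.2‖ₑ ^ 2 ∂strip R ≤
      ENNReal.ofReal (28 * (7 * (12 * 21 ^ 2 * Real.pi ^ 2 * (7 * K 2 ^ 2 * wtSum) ^ 2) +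
        21 * (432 * Real.pi * K 2 ^ 2 * K (N + 2) ^ 2 * wtSum ^ 3)) *
        (ρ ^ 2 * √R * (b * H ^ 3))) := by
  have hR0 : 0 < R := by linarith
  have hr1 : 1 ≤ √R := Real.one_le_sqrt.2 hR
  have hW := wtSum_nonneg
  have hpi := Real.pi_pos
  have hH : 0 ≤ H := hb.trans hbH
  set I := s.image fun q => q.1 / (n : ℤ) with hI
  set C₁ := 12 * 21 ^ 2 * Real.pi ^ 2 * (7 * K 2 ^ 2 * wtSum) ^ 2 with hC₁
  set C₂ := 432 * Real.pi * K 2 ^ 2 * K (N + 2) ^ 2 * wtSum ^ 3 with hC₂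
  have hC₁0 : 0 ≤ C₁ := by positivity
  have hC₂0 : 0 ≤ C₂ := by positivity
  refine (hφ.lintegral_sum_pairs_le hR0 c s hn hP).trans ?_
  calc _ ≤ 28 * ∑ p ∈ P, (ENNReal.ofReal (C₁ * ρ ^ 2 * √R * (b * H) *
        ∑ q ∈ cell n s p.1, ‖c q‖ ^ 2) + ENNReal.ofReal (C₂ * R⁻¹ * (b ^ 2 * H ^ 2))) := by
        gcongr with p hp
        refine (hφ.lintegral_pair_le hR0 hn (hP2 p hp) (hP p hp) hρ N hb hH hcb hcH).trans ?_
        gcongr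
        exact lintegral_pairError_le hR hs hρ hN hb hcb hcH
    _ = ENNReal.ofReal (28 * ∑ p ∈ P, (C₁ * ρ ^ 2 * √R * (b * H) *
        ∑ q ∈ cell n s p.1, ‖c q‖ ^ 2 + C₂ * R⁻¹ * (b ^ 2 * H ^ 2))) := by
        have hnn : ∀ p : ℤ × ℤ, 0 ≤ ∑ q ∈ cell n s p.1, ‖c q‖ ^ 2 := fun p =>
          Finset.sum_nonneg fun _ _ => sq_nonneg _
        rw [ENNReal.ofReal_mul (p := 28) (by norm_num), ENNReal.ofReal_sum_of_nonneg, ENNReal.ofReal_ofNat]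
        · congr 1
          refine Finset.sum_congr rfl fun p _ => ?_
          have := hnn p
          rw [ENNReal.ofReal_add (by positivity) (by positivity)]
        · intro p _
          have := hnn p
          positivity
    _ ≤ _ := by
        refine ENNReal.ofReal_le_ofReal ?_
        have h1 := sum_pairs_le hPI hP (g := fun i => C₁ * ρ ^ 2 * √R * (b * H) *
          ∑ q ∈ cell n s i, ‖c q‖ ^ 2 + C₂ * R⁻¹ * (b ^ 2 * H ^ 2)) (fun i => by
            have : 0 ≤ ∑ q ∈ cell n s i, ‖c q‖ ^ 2 := Finset.sum_nonneg fun _ _ => sq_nonneg _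
            positivity)
        rw [Finset.sum_add_distrib (s := I), ← Finset.mul_sum I, sum_cells, Finset.sum_const,
          nsmul_eq_mul] at h1
        have hcard : (I.card : ℝ) ≤ 3 * R := by
          calc (I.card : ℝ) ≤ (s.image Prod.fst).card := by exact_mod_cast card_image_ediv_le n s
            _ ≤ 3 * √R := card_image_fst_le hR hs
            _ ≤ 3 * R := by
              gcongr
              exact Real.sqrt_le_self_iff.2 (Or.inr hR)
        -- The `R⁻¹` in the error absorbs the number of cells. The 3 here and the 7 partners of each
        -- cell give the 21 in the constant.
        have h2 : (I.card : ℝ) * (C₂ * R⁻¹ * (b ^ 2 * H ^ 2)) ≤ 3 * C₂ * (b ^ 2 * H ^ 2) := by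
          calc _ ≤ 3 * R * (C₂ * R⁻¹ * (b ^ 2 * H ^ 2)) := by gcongr
            _ = _ := by field_simp
        have h3 : C₁ * ρ ^ 2 * √R * (b * H) * ∑ q ∈ s, ‖c q‖ ^ 2 ≤
            C₁ * ρ ^ 2 * √R * (b * H) * H ^ 2 := by gcongr
        have h4 : b ^ 2 * H ^ 2 ≤ ρ ^ 2 * √R * (b * H ^ 3) := by
          have h5 : b ^ 2 * H ^ 2 ≤ b * H ^ 3 := by
            calc b ^ 2 * H ^ 2 = b * H ^ 2 * b := by ring
              _ ≤ b * H ^ 2 * H := by gcongr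
              _ = _ := by ring
          have h6 : 1 ≤ ρ ^ 2 * √R := one_le_mul_of_one_le_of_one_le (one_le_pow₀ hρ) hr1
          calc _ ≤ 1 * (b * H ^ 3) := by linarith
            _ ≤ _ := by gcongr
        have h7 : C₂ * (b ^ 2 * H ^ 2) ≤ C₂ * (ρ ^ 2 * √R * (b * H ^ 3)) := by gcongr
        have e : C₁ * ρ ^ 2 * √R * (b * H) * H ^ 2 = C₁ * (ρ ^ 2 * √R * (b * H ^ 3)) := by ring
        rw [e] at h3
        have h8 := h1.trans (mul_le_mul_of_nonneg_left (add_le_add h3 h2) (by norm_num : (0 : ℝ) ≤ 7))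
        linarith

/-- The contribution of pairs of neighbouring cells of bounded length. -/
theorem lintegral_diagonal_pairs_le (hφ : PacketFamily R K φ) (hR : 1 ≤ R) {c : ℤ × ℤ → ℂ}
    {s : Finset (ℤ × ℤ)} {P : Finset (ℤ × ℤ)}
    (hPI : ∀ p ∈ P, p.1 ∈ s.image fun q => q.1 / ((8 : ℕ) : ℤ)) (hP : ∀ p ∈ P, |p.1 - p.2| ≤ 3)
    {b H : ℝ} (hb : 0 ≤ b) (hbH : b ≤ H) (hcb : ∀ q ∈ s, ‖c q‖ ≤ b)
    (hcH : ∑ q ∈ s, ‖c q‖ ^ 2 ≤ H ^ 2) :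
    ∫⁻ z, ‖∑ p ∈ P, extensionOp (synth c φ (cell 8 s p.1)) z.1 z.2 *
        extensionOp (synth c φ (cell 8 s p.2)) z.1 z.2‖ₑ ^ 2 ∂strip R ≤
      ENNReal.ofReal (28 * (7 * (256 * Real.pi * K 2 ^ 2 * wtSum ^ 2 * (7 * K 2 ^ 2 * wtSum))) *
        (√R * (b * H ^ 3))) := by
  have hR0 : 0 < R := by linarith
  have hr : 0 < √R := Real.sqrt_pos.2 hR0
  have hW := wtSum_nonneg
  have hpi := Real.pi_pos
  have hH : 0 ≤ H := hb.trans hbH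
  have hK2 := hφ.K_nonneg hR0 (N := 2) (by omega)
  have hR4 : 0 < R ^ (-(1 / 4) : ℝ) := Real.rpow_pos_of_pos hR0 _
  set D := 256 * Real.pi * K 2 ^ 2 * wtSum ^ 2 * (7 * K 2 ^ 2 * wtSum) with hD
  have hD0 : 0 ≤ D := by positivity
  have hpair : ∀ i i' : ℤ, ∫⁻ z, ‖extensionOp (synth c φ (cell 8 s i)) z.1 z.2 *
        extensionOp (synth c φ (cell 8 s i')) z.1 z.2‖ₑ ^ 2 ∂strip R ≤
      ENNReal.ofReal (D * √R * b ^ 2 * ∑ q ∈ cell 8 s i, ‖c q‖ ^ 2) := by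
    intro i i'
    have hS : 0 ≤ ∑ q ∈ cell 8 s i, ‖c q‖ ^ 2 := Finset.sum_nonneg fun _ _ => sq_nonneg _
    -- Without separation no bilinear gain is available, but a cell of 8 frequencies is pointwise
    -- `O(R^{-1/4} b)`. The other factor is integrated by conservation of mass over a time interval
    -- of length `2R`, and `R^{-1/2} R = √R`.
    have hpt : ∀ᵐ z ∂strip R, ‖extensionOp (synth c φ (cell 8 s i)) z.1 z.2 *
        extensionOp (synth c φ (cell 8 s i')) z.1 z.2‖ₑ ^ 2 ≤
        ENNReal.ofReal (K 2 ^ 2 * (√R)⁻¹ * (b * (8 * wtSum)) ^ 2) *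
        ‖extensionOp (synth c φ (cell 8 s i)) z.1 z.2‖ₑ ^ 2 := by
      filter_upwards [ae_strip_abs_le R] with z hz
      rw [enorm_mul, mul_pow, mul_comm]
      gcongr
      rw [enorm_sq_eq_ofReal, ← rpow_neg_quarter_sq hR0, ← mul_pow, ← mul_pow]
      refine ENNReal.ofReal_le_ofReal ?_
      gcongr
      refine (hφ.norm_extensionOp_synth_le hR0 c _ hz).trans ?_
      gcongr
      have h := majorant_le (c := c) (u := cell 8 s i')
        (κ := Finset.Icc (((8 : ℕ) : ℤ) * i') (((8 : ℕ) : ℤ) * i' + ((8 : ℕ) : ℤ) - 1))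
        (fun q hq => Finset.mem_Icc.2 (mem_cell_bounds (by norm_num) hq)) hb
        (fun q hq => hcb q (cell_subset _ _ _ hq)) (z.1 / √R) (z.2 / R)
      rw [Int.card_Icc, show ((8 : ℕ) : ℤ) * i' + ((8 : ℕ) : ℤ) - 1 + 1 - ((8 : ℕ) : ℤ) * i' =
        ((8 : ℕ) : ℤ) by ring, Int.toNat_natCast] at h
      exact_mod_cast h
    have hm : Measurable fun z : ℝ × ℝ => ‖extensionOp (synth c φ (cell 8 s i)) z.1 z.2‖ₑ ^ 2 :=
      (continuous_extensionOp (hφ.integrable_synth hR0 c _)).measurable.enorm.pow_const 2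
    refine (lintegral_mono_ae hpt).trans ?_
    rw [lintegral_const_mul' _ _ ENNReal.ofReal_ne_top, lintegral_strip R hm]
    simp_rw [lintegral_extensionOp_sq (hφ.integrable_synth hR0 c _) (hφ.memLp_synth c _)]
    rw [lintegral_const, volume_Icc_neg]
    calc _ ≤ ENNReal.ofReal (K 2 ^ 2 * (√R)⁻¹ * (b * (8 * wtSum)) ^ 2) *
          (ENNReal.ofReal (2 * Real.pi) * ENNReal.ofReal
            (7 * K 2 ^ 2 * wtSum * ∑ q ∈ cell 8 s i, ‖c q‖ ^ 2) * ENNReal.ofReal (2 * R)) := by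
          gcongr
          exact hφ.lintegral_synth_sq_le hR0 c _
      _ = _ := by
          rw [← ENNReal.ofReal_mul (by positivity), ← ENNReal.ofReal_mul (by positivity),
            ← ENNReal.ofReal_mul (by positivity)]
          congr 1
          have hsq : √R ^ 2 = R := Real.sq_sqrt hR0.le
          rw [hD]
          nth_rewrite 2 [← hsq]
          field_simp
          ring
  refine (hφ.lintegral_sum_pairs_le hR0 c s le_rfl hP).trans ?_
  calc _ ≤ 28 * ∑ p ∈ P, ENNReal.ofReal (D * √R * b ^ 2 * ∑ q ∈ cell 8 s p.1, ‖c q‖ ^ 2) := by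
        gcongr with p hp
        exact hpair p.1 p.2
    _ = ENNReal.ofReal (28 * ∑ p ∈ P, D * √R * b ^ 2 * ∑ q ∈ cell 8 s p.1, ‖c q‖ ^ 2) := by
        rw [ENNReal.ofReal_mul (p := 28) (by norm_num), ENNReal.ofReal_sum_of_nonneg, ENNReal.ofReal_ofNat]
        intro p _
        have : 0 ≤ ∑ q ∈ cell 8 s p.1, ‖c q‖ ^ 2 := Finset.sum_nonneg fun _ _ => sq_nonneg _
        positivity
    _ ≤ _ := by
        refine ENNReal.ofReal_le_ofReal ?_
        have h1 := sum_pairs_le hPI hP (g := fun i => D * √R * b ^ 2 *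
          ∑ q ∈ cell 8 s i, ‖c q‖ ^ 2) (fun i => by
            have : 0 ≤ ∑ q ∈ cell 8 s i, ‖c q‖ ^ 2 := Finset.sum_nonneg fun _ _ => sq_nonneg _
            positivity)
        rw [← Finset.mul_sum (s.image fun q => q.1 / ((8 : ℕ) : ℤ)), sum_cells] at h1
        have h3 : D * √R * b ^ 2 * ∑ q ∈ s, ‖c q‖ ^ 2 ≤ D * (√R * (b * H ^ 3)) := by
          calc _ ≤ D * √R * (b * H) * H ^ 2 := by
                rw [sq b]
                gcongr
            _ = _ := by ring
        linarith

end PacketFamily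

end WavePacket

end

/-! ### The Whitney decomposition and the `L⁴` estimate for finite sums -/

noncomputable section

namespace WavePacket

theorem sum_filter_pairs_eq (s : Finset (ℤ × ℤ)) (a : ℤ × ℤ → ℂ) (n : ℕ) (p : ℤ → ℤ → Prop)
    [∀ i j, Decidable (p i j)] :
    ∑ x ∈ (s ×ˢ s).filter (fun x => p (x.1.1 / (n : ℤ)) (x.2.1 / (n : ℤ))), a x.1 * a x.2 =
      ∑ y ∈ ((s.image fun q => q.1 / (n : ℤ)) ×ˢ (s.image fun q => q.1 / (n : ℤ))).filter
        (fun y => p y.1 y.2), (∑ q ∈ cell n s y.1, a q) * ∑ q ∈ cell n s y.2, a q := by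
  classical
  rw [← Finset.sum_fiberwise_of_maps_to
    (g := fun x : (ℤ × ℤ) × ℤ × ℤ => (x.1.1 / (n : ℤ), x.2.1 / (n : ℤ)))
    (t := ((s.image fun q => q.1 / (n : ℤ)) ×ˢ (s.image fun q => q.1 / (n : ℤ))).filter
        (fun y => p y.1 y.2))]
  · refine Finset.sum_congr rfl fun y hy => ?_
    rw [Finset.sum_mul_sum, ← Finset.sum_product']
    refine Finset.sum_congr ?_ fun _ _ => rfl
    have hp := (Finset.mem_filter.1 hy).2
    ext x
    simp only [Finset.mem_filter, Finset.mem_product, cell, Prod.ext_iff]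
    constructor
    · rintro ⟨⟨⟨h1, h2⟩, _⟩, h3, h4⟩
      exact ⟨⟨h1, h3⟩, h2, h4⟩
    · rintro ⟨⟨h1, h3⟩, h2, h4⟩
      refine ⟨⟨⟨h1, h2⟩, ?_⟩, h3, h4⟩
      rwa [h3, h4]
  · intro x hx
    obtain ⟨h1, h2⟩ := Finset.mem_filter.1 hx
    obtain ⟨h3, h4⟩ := Finset.mem_product.1 h1
    exact Finset.mem_filter.2 ⟨Finset.mem_product.2 ⟨Finset.mem_image_of_mem _ h3,
      Finset.mem_image_of_mem _ h4⟩, h2⟩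

/-- The indices of the cells of length `n` that meet `s`. -/
def cellIndices (n : ℕ) (s : Finset (ℤ × ℤ)) : Finset ℤ := s.image fun q => q.1 / (n : ℤ)

/-- Pairs of neighbouring cells. -/
def diagonalPairs (n : ℕ) (s : Finset (ℤ × ℤ)) : Finset (ℤ × ℤ) :=
  (cellIndices n s ×ˢ cellIndices n s).filter fun y => |y.1 - y.2| ≤ 1

/-- Pairs of cells which are not neighbours, but whose parents are. -/
def separatedPairs (n : ℕ) (s : Finset (ℤ × ℤ)) : Finset (ℤ × ℤ) :=
  (cellIndices n s ×ˢ cellIndices n s).filter fun y =>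
    |y.1 / 2 - y.2 / 2| ≤ 1 ∧ ¬|y.1 - y.2| ≤ 1

/-- Neighbouring parents have four children in all, consecutive in index, so the distance is at most
3. -/
theorem separatedPairs_bounds {n : ℕ} {s : Finset (ℤ × ℤ)} {p : ℤ × ℤ}
    (hp : p ∈ separatedPairs n s) : 2 ≤ |p.1 - p.2| ∧ |p.1 - p.2| ≤ 3 := by
  obtain ⟨h1, h2⟩ := (Finset.mem_filter.1 hp).2
  rw [abs_le] at h1
  refine ⟨by omega, ?_⟩
  rw [abs_le]
  omega

/-- One Whitney step: neighbouring parents are split into pairs of children, which either are again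
neighbours or are separated for the first time. -/
theorem sum_diagonalPairs_succ (s : Finset (ℤ × ℤ)) (a : ℤ × ℤ → ℂ) (l : ℕ) :
    ∑ y ∈ diagonalPairs (2 ^ (l + 1)) s,
        (∑ q ∈ cell (2 ^ (l + 1)) s y.1, a q) * ∑ q ∈ cell (2 ^ (l + 1)) s y.2, a q =
      ∑ y ∈ diagonalPairs (2 ^ l) s,
        (∑ q ∈ cell (2 ^ l) s y.1, a q) * ∑ q ∈ cell (2 ^ l) s y.2, a q +
      ∑ y ∈ separatedPairs (2 ^ l) s,
        (∑ q ∈ cell (2 ^ l) s y.1, a q) * ∑ q ∈ cell (2 ^ l) s y.2, a q := by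
  classical
  unfold diagonalPairs separatedPairs cellIndices
  rw [← sum_filter_pairs_eq s a (2 ^ (l + 1)) fun i j => |i - j| ≤ 1,
    ← sum_filter_pairs_eq s a (2 ^ l) fun i j => |i - j| ≤ 1,
    ← sum_filter_pairs_eq s a (2 ^ l) fun i j => |i / 2 - j / 2| ≤ 1 ∧ ¬|i - j| ≤ 1,
    ← Finset.sum_filter_add_sum_filter_not (Finset.filter _ _)
      (fun x : (ℤ × ℤ) × ℤ × ℤ => |x.1.1 / ((2 ^ l : ℕ) : ℤ) - x.2.1 / ((2 ^ l : ℕ) : ℤ)| ≤ 1),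
    Finset.filter_filter, Finset.filter_filter]
  have hdiv : ∀ k : ℤ, k / ((2 ^ (l + 1) : ℕ) : ℤ) = k / ((2 ^ l : ℕ) : ℤ) / 2 := by
    intro k
    rw [Int.ediv_ediv_of_nonneg (by positivity)]
    congr 1
  congr 1
  -- Neighbouring cells automatically have equal or neighbouring parents.
  · refine Finset.sum_congr (Finset.filter_congr fun x _ => ?_) fun _ _ => rfl
    rw [hdiv, hdiv, and_iff_right_iff_imp]
    intro h
    rw [abs_le] at h ⊢
    omega
  · refine Finset.sum_congr (Finset.filter_congr fun x _ => ?_) fun _ _ => rfl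
    rw [hdiv, hdiv]

/-- At the coarsest scale only the cells `-1` and `0` occur, so every pair is diagonal. -/
theorem sum_diagonalPairs_eq_sq {s : Finset (ℤ × ℤ)} {n : ℕ} (hs : ∀ q ∈ s, |q.1| < n)
    (a : ℤ × ℤ → ℂ) :
    ∑ y ∈ diagonalPairs n s, (∑ q ∈ cell n s y.1, a q) * ∑ q ∈ cell n s y.2, a q =
      (∑ q ∈ s, a q) ^ 2 := by
  unfold diagonalPairs cellIndices
  rw [← sum_filter_pairs_eq s a n fun i j => |i - j| ≤ 1, sq, Finset.sum_mul_sum,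
    ← Finset.sum_product', Finset.filter_true_of_mem]
  have hq : ∀ q ∈ s, -1 ≤ q.1 / (n : ℤ) ∧ q.1 / (n : ℤ) ≤ 0 := by
    intro q hq
    have h := abs_lt.1 (hs q hq)
    have hn : (0 : ℤ) < n := (abs_nonneg _).trans_lt (hs q hq)
    constructor
    · rw [Int.le_ediv_iff_mul_le hn]
      linarith [h.1]
    · exact Int.lt_add_one_iff.1 (Int.ediv_lt_of_lt_mul hn (by linarith [h.2]))
  intro x hx
  obtain ⟨h1, h2⟩ := Finset.mem_product.1 hx
  have := hq _ h1
  have := hq _ h2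
  rw [abs_le]
  omega

/-- The Whitney decomposition of a square. -/
theorem sq_eq_diagonal_add_separated {s : Finset (ℤ × ℤ)} {l₀ L : ℕ}
    (hs : ∀ q ∈ s, |q.1| < ((2 ^ (l₀ + L) : ℕ) : ℤ)) (a : ℤ × ℤ → ℂ) :
    (∑ q ∈ s, a q) ^ 2 =
      ∑ y ∈ diagonalPairs (2 ^ l₀) s,
        (∑ q ∈ cell (2 ^ l₀) s y.1, a q) * ∑ q ∈ cell (2 ^ l₀) s y.2, a q +
      ∑ l ∈ Finset.range L, ∑ y ∈ separatedPairs (2 ^ (l₀ + l)) s,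
        (∑ q ∈ cell (2 ^ (l₀ + l)) s y.1, a q) * ∑ q ∈ cell (2 ^ (l₀ + l)) s y.2, a q := by
  rw [← sum_diagonalPairs_eq_sq hs]
  clear hs
  induction L with
  | zero => simp
  | succ L ih => rw [← add_assoc, sum_diagonalPairs_succ, ih, Finset.sum_range_succ, add_assoc]

theorem enorm_add_sq_le (x y : ℂ) : ‖x + y‖ₑ ^ 2 ≤ 2 * ‖x‖ₑ ^ 2 + 2 * ‖y‖ₑ ^ 2 := by
  have h : ‖x + y‖ ^ 2 ≤ 2 * ‖x‖ ^ 2 + 2 * ‖y‖ ^ 2 := by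
    calc ‖x + y‖ ^ 2 ≤ (‖x‖ + ‖y‖) ^ 2 := by gcongr; exact norm_add_le _ _
      _ ≤ _ := by nlinarith [sq_nonneg (‖x‖ - ‖y‖)]
  have h' := ENNReal.ofReal_le_ofReal h
  rw [ENNReal.ofReal_add (by positivity) (by positivity), ENNReal.ofReal_mul (by norm_num),
    ENNReal.ofReal_mul (by norm_num), ENNReal.ofReal_ofNat] at h'
  simpa only [enorm_sq_eq_ofReal] using h'

namespace PacketFamily

/-- All scales together, with the number `L` of scales and the localization parameter `ρ` still
free. The constant is fixed before `R`, the packets and the coefficients. -/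
theorem exists_lintegral_pow_four_le_log (K : ℕ → ℝ) (N : ℕ) : ∃ C : ℝ, 0 ≤ C ∧
    ∀ {R : ℝ} {φ : ℤ × ℤ → ℝ → ℂ}, PacketFamily R K φ → 1 ≤ R →
    ∀ {c : ℤ × ℤ → ℂ} {s : Finset (ℤ × ℤ)}, (∀ q ∈ s, |(q.1 : ℝ)| ≤ √R) →
    ∀ {ρ : ℝ}, 1 ≤ ρ → R ^ 3 ≤ (ρ ^ N) ^ 2 →
    ∀ {L : ℕ}, √R < 2 ^ L →
    ∀ {b H : ℝ}, 0 ≤ b → b ≤ H → (∀ q ∈ s, ‖c q‖ ≤ b) → (∑ q ∈ s, ‖c q‖ ^ 2 ≤ H ^ 2) →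
    ∫⁻ z, ‖extensionOp (synth c φ s) z.1 z.2‖ₑ ^ 4 ∂strip R ≤
      ENNReal.ofReal (C * (L + 1) ^ 2 * (ρ ^ 2 * √R * (b * H ^ 3))) := by
  have hW := wtSum_nonneg
  have hpi := Real.pi_pos
  set C₁ := 28 * (7 * (12 * 21 ^ 2 * Real.pi ^ 2 * (7 * K 2 ^ 2 * wtSum) ^ 2) +
        21 * (432 * Real.pi * K 2 ^ 2 * K (N + 2) ^ 2 * wtSum ^ 3)) with hC₁
  set C₂ := 28 * (7 * (256 * Real.pi * K 2 ^ 2 * wtSum ^ 2 * (7 * K 2 ^ 2 * wtSum))) with hC₂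
  have hC₁0 : 0 ≤ C₁ := by positivity
  have hC₂0 : 0 ≤ C₂ := by positivity
  refine ⟨2 * C₁ + 2 * C₂, by positivity, ?_⟩
  intro R φ hφ hR c s hs ρ hρ hN L hL b H hb hbH hcb hcH
  have hR0 : 0 < R := by linarith
  have hH : 0 ≤ H := hb.trans hbH
  set F : ℕ → ℤ → ℝ × ℝ → ℂ := fun n i z => extensionOp (synth c φ (cell n s i)) z.1 z.2 with hF
  have hcont : ∀ n i, Continuous (F n i) := fun n i =>
    continuous_extensionOp (hφ.integrable_synth hR0 c _)
  -- The finest cells have length `8 = 2 ^ 3`, the smallest length admitted in the separated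
  -- estimate.
  set Q : ℝ × ℝ → ℂ := fun z => ∑ p ∈ diagonalPairs 8 s, F 8 p.1 z * F 8 p.2 z with hQ
  set D : ℕ → ℝ × ℝ → ℂ := fun l z =>
    ∑ p ∈ separatedPairs (2 ^ (3 + l)) s, F (2 ^ (3 + l)) p.1 z * F (2 ^ (3 + l)) p.2 z with hD
  have hQc : Continuous Q := continuous_finsetSum _ fun p _ => (hcont _ _).mul (hcont _ _)
  have hDc : ∀ l, Continuous (D l) := fun l =>
    continuous_finsetSum _ fun p _ => (hcont _ _).mul (hcont _ _)
  have hsq : ∀ z, extensionOp (synth c φ s) z.1 z.2 ^ 2 = Q z + ∑ l ∈ Finset.range L, D l z := by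
    intro z
    have hs' : ∀ q ∈ s, |q.1| < ((2 ^ (3 + L) : ℕ) : ℤ) := by
      intro q hq
      have h1 : |(q.1 : ℝ)| < 2 ^ (3 + L) := by
        refine (hs q hq).trans_lt (hL.trans_le ?_)
        exact pow_le_pow_right₀ (by norm_num) (by omega)
      exact_mod_cast h1
    have h := sq_eq_diagonal_add_separated hs' fun q => c q * extensionOp (φ q) z.1 z.2
    simp only [hQ, hD, hF, hφ.extensionOp_synth hR0]
    exact h
  have hQint : ∫⁻ z, ‖Q z‖ₑ ^ 2 ∂strip R ≤ ENNReal.ofReal (C₂ * (√R * (b * H ^ 3))) :=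
    hφ.lintegral_diagonal_pairs_le hR
      (fun p hp => (Finset.mem_product.1 (Finset.mem_filter.1 hp).1).1)
      (fun p hp => (Finset.mem_filter.1 hp).2.trans (by norm_num)) hb hbH hcb hcH
  have hDint : ∀ l, ∫⁻ z, ‖D l z‖ₑ ^ 2 ∂strip R ≤
      ENNReal.ofReal (C₁ * (ρ ^ 2 * √R * (b * H ^ 3))) := fun l =>
    hφ.lintegral_separated_pairs_le hR hs
      (by
        calc 8 = 2 ^ 3 := by norm_num
          _ ≤ 2 ^ (3 + l) := Nat.pow_le_pow_right (by norm_num) (by omega))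
      (fun p hp => (Finset.mem_product.1 (Finset.mem_filter.1 hp).1).1)
      (fun p hp => (separatedPairs_bounds hp).1) (fun p hp => (separatedPairs_bounds hp).2)
      hρ hN hb hbH hcb hcH
  have hpt : ∀ z, ‖extensionOp (synth c φ s) z.1 z.2‖ₑ ^ 4 ≤
      2 * ‖Q z‖ₑ ^ 2 + 2 * (L * ∑ l ∈ Finset.range L, ‖D l z‖ₑ ^ 2) := by
    intro z
    rw [show (4 : ℕ) = 2 * 2 by norm_num, pow_mul, ← enorm_pow, hsq z]
    refine (enorm_add_sq_le _ _).trans ?_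
    gcongr
    -- Cauchy–Schwarz over the scales costs `L`, and summing `L` equal bounds costs another `L`;
    -- this is harmless since `L` will be logarithmic in `R`.
    exact enorm_sum_sq_le_of_overlap _ _ L (Finset.range L) (fun l hl _ => hl) (by simp)
  refine (lintegral_mono hpt).trans ?_
  rw [lintegral_add_left ((hQc.measurable.enorm.pow_const 2).const_mul 2),
    lintegral_const_mul' _ _ (by norm_num), lintegral_const_mul' _ _ (by norm_num),
    lintegral_const_mul' _ _ (by simp),
    lintegral_finsetSum _ fun l _ => (hDc l).measurable.enorm.pow_const 2]
  calc _ ≤ 2 * ENNReal.ofReal (C₂ * (√R * (b * H ^ 3))) +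
        2 * (L * ∑ l ∈ Finset.range L, ENNReal.ofReal (C₁ * (ρ ^ 2 * √R * (b * H ^ 3)))) := by
        gcongr with l _
        exact hDint l
    _ = ENNReal.ofReal (2 * (C₂ * (√R * (b * H ^ 3))) +
        2 * (L * (L * (C₁ * (ρ ^ 2 * √R * (b * H ^ 3)))))) := by
        rw [Finset.sum_const, Finset.card_range, nsmul_eq_mul,
          ENNReal.ofReal_add (by positivity) (by positivity), ENNReal.ofReal_mul (p := 2) (by norm_num),
          ENNReal.ofReal_mul (p := 2) (by norm_num), ENNReal.ofReal_mul (p := (L : ℝ)) (by positivity),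
          ENNReal.ofReal_mul (p := (L : ℝ)) (by positivity), ENNReal.ofReal_ofNat,
          ENNReal.ofReal_natCast]
    _ ≤ _ := by
        refine ENNReal.ofReal_le_ofReal ?_
        set Y := ρ ^ 2 * √R * (b * H ^ 3) with hY
        have hY0 : 0 ≤ Y := by positivity
        have h1 : √R * (b * H ^ 3) ≤ Y := by
          rw [hY, mul_assoc]
          exact le_mul_of_one_le_left (by positivity) (one_le_pow₀ hρ)
        have hL0 : (0 : ℝ) ≤ L := by positivity
        have h2 : C₂ * (√R * (b * H ^ 3)) ≤ (L + 1) ^ 2 * (C₂ * Y) := by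
          calc _ ≤ 1 * (C₂ * Y) := by rw [one_mul]; gcongr
            _ ≤ _ := by
              gcongr
              nlinarith
        have h3 : L * (L * (C₁ * Y)) ≤ (L + 1) ^ 2 * (C₁ * Y) := by
          rw [← mul_assoc]
          gcongr
          nlinarith
        linarith [show (2 * C₁ + 2 * C₂) * (L + 1) ^ 2 * Y =
          2 * ((L + 1) ^ 2 * (C₂ * Y)) + 2 * ((L + 1) ^ 2 * (C₁ * Y)) by ring]

/-- The `L⁴` estimate for finite sums of wave packets. -/
theorem exists_lintegral_pow_four_le (K : ℕ → ℝ) {δ : ℝ} (hδ : 0 < δ) : ∃ C : ℝ, 0 ≤ C ∧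
    ∀ {R : ℝ} {φ : ℤ × ℤ → ℝ → ℂ}, PacketFamily R K φ → 1 ≤ R →
    ∀ {c : ℤ × ℤ → ℂ} {s : Finset (ℤ × ℤ)}, (∀ q ∈ s, |(q.1 : ℝ)| ≤ √R) →
    ∀ {b H : ℝ}, 0 ≤ b → b ≤ H → (∀ q ∈ s, ‖c q‖ ≤ b) → (∑ q ∈ s, ‖c q‖ ^ 2 ≤ H ^ 2) →
    ∫⁻ z, ‖extensionOp (synth c φ s) z.1 z.2‖ₑ ^ 4 ∂strip R ≤
      ENNReal.ofReal (C * R ^ (1 / 2 + 4 * δ) * (b * H ^ 3)) := by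
  -- With `ρ = R^δ` this makes `ρ^{2N} ≥ R³`, as the far error requires.
  obtain ⟨N, hN⟩ := exists_nat_ge (3 / (2 * δ))
  obtain ⟨C, hC0, hC⟩ := exists_lintegral_pow_four_le_log K N
  have hlog2 : 0 < Real.log 2 := Real.log_pos (by norm_num)
  refine ⟨C * (1 / (δ * Real.log 2) + 2) ^ 2, by positivity, ?_⟩
  intro R φ hφ hR c s hs b H hb hbH hcb hcH
  have hR0 : 0 < R := by linarith
  have hH : 0 ≤ H := hb.trans hbH
  have hρ : 1 ≤ R ^ δ := Real.one_le_rpow hR hδ.le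
  have hN' : R ^ 3 ≤ ((R ^ δ) ^ N) ^ 2 := by
    rw [← pow_mul, ← Real.rpow_natCast, ← Real.rpow_natCast, ← Real.rpow_mul hR0.le]
    refine Real.rpow_le_rpow_of_exponent_le hR ?_
    rw [div_le_iff₀ (by positivity)] at hN
    push_cast
    linarith
  set L := Nat.log 2 ⌊R⌋₊ + 1 with hLdef
  have hfl : ⌊R⌋₊ ≠ 0 := (Nat.floor_pos.2 hR).ne'
  have hL : √R < 2 ^ L := by
    have h1 : ⌊R⌋₊ < 2 ^ L := Nat.lt_pow_succ_log_self (by norm_num) _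
    have h2 : R < (2 : ℝ) ^ L := by exact_mod_cast (Nat.floor_lt hR0.le).1 h1
    exact (Real.sqrt_le_self_iff.2 (Or.inr hR)).trans_lt h2
  have hLle : (L : ℝ) + 1 ≤ (1 / (δ * Real.log 2) + 2) * R ^ δ := by
    have h1 : (2 : ℝ) ^ Nat.log 2 ⌊R⌋₊ ≤ R := by
      have h := Nat.pow_log_le_self 2 hfl
      calc (2 : ℝ) ^ Nat.log 2 ⌊R⌋₊ ≤ ⌊R⌋₊ := by exact_mod_cast h
        _ ≤ R := Nat.floor_le hR0.le
    have h2 : (Nat.log 2 ⌊R⌋₊ : ℝ) * Real.log 2 ≤ Real.log R := by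
      rw [← Real.log_pow]
      exact Real.log_le_log (by positivity) h1
    have h3 := Real.log_le_rpow_div hR0.le hδ
    have h4 : (Nat.log 2 ⌊R⌋₊ : ℝ) ≤ R ^ δ / δ / Real.log 2 := by
      rw [le_div_iff₀ hlog2]
      exact h2.trans h3
    have e : R ^ δ / δ / Real.log 2 = 1 / (δ * Real.log 2) * R ^ δ := by field_simp
    rw [e] at h4
    rw [hLdef]
    push_cast
    linarith
  refine (hC hφ hR hs hρ hN' hL hb hbH hcb hcH).trans (ENNReal.ofReal_le_ofReal ?_)
  -- Of the loss `4δ`, one half comes from the logarithms `(L + 1)²` and one half from `ρ²`.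
  have e : R ^ (1 / 2 + 4 * δ) = (R ^ δ) ^ 2 * ((R ^ δ) ^ 2 * √R) := by
    rw [Real.sqrt_eq_rpow, ← Real.rpow_natCast, ← Real.rpow_mul hR0.le, ← Real.rpow_add hR0,
      ← Real.rpow_add hR0]
    congr 1
    push_cast
    ring
  calc _ ≤ C * ((1 / (δ * Real.log 2) + 2) * R ^ δ) ^ 2 * ((R ^ δ) ^ 2 * √R * (b * H ^ 3)) := by
        gcongr
    _ = _ := by rw [e]; ring

end PacketFamily

end WavePacket

end

/-! ### From wave packet decompositions to packet families -/

noncomputable section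

namespace WavePacket

theorem rpow_neg_half_eq {R : ℝ} (hR : 0 < R) : R ^ (-(1 / 2) : ℝ) = (√R)⁻¹ := by
  rw [Real.rpow_neg hR.le, Real.sqrt_eq_rpow]

/-- The inclusion of the indices of wave packets of size `R` into `ℤ × ℤ`. -/
def indexEmb (R : ℝ) : Index R ↪ ℤ × ℤ where
  toFun q := (q.1, q.2)
  inj' := by
    rintro ⟨⟨k, hk⟩, m⟩ ⟨⟨k', hk'⟩, m'⟩ h
    simp only [Prod.mk.injEq] at h
    obtain ⟨rfl, rfl⟩ := h
    rfl

/-- The extension by zero of a function of the indices to `ℤ × ℤ`. -/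
def extendIndex {R : ℝ} {α : Type*} [Zero α] (a : Index R → α) : ℤ × ℤ → α :=
  Function.extend (indexEmb R) a 0

theorem extendIndex_emb {R : ℝ} {α : Type*} [Zero α] (a : Index R → α) (q : Index R) :
    extendIndex a (indexEmb R q) = a q :=
  (indexEmb R).injective.extend_apply _ _ _

theorem extendIndex_cases {R : ℝ} {α : Type*} [Zero α] (a : Index R → α) (p : ℤ × ℤ) :
    (∃ q, indexEmb R q = p ∧ extendIndex a p = a q) ∨ extendIndex a p = 0 := by
  by_cases h : ∃ q, indexEmb R q = p
  · obtain ⟨q, rfl⟩ := h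
    exact Or.inl ⟨q, rfl, extendIndex_emb a q⟩
  · exact Or.inr (Function.extend_apply' _ _ _ h)

theorem freq_eq {R : ℝ} (hR : 0 < R) (q : Index R) : freq q = (indexEmb R q).1 / √R := by
  have h : ∀ k : ℝ, k * R ^ (-(1 / 2) : ℝ) = k / √R := fun k => by
    rw [rpow_neg_half_eq hR, div_eq_mul_inv]
  exact h _

theorem pos_eq {R : ℝ} (q : Index R) : pos q = (indexEmb R q).2 * √R := by
  have h : ∀ m : ℝ, m * R ^ (1 / 2 : ℝ) = m * √R := fun m => by rw [Real.sqrt_eq_rpow]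
  exact h _

theorem abs_indexEmb_fst_le {R : ℝ} (hR : 0 < R) (q : Index R) :
    |((indexEmb R q).1 : ℝ)| ≤ √R := by
  have h : freq q ∈ Icc (-1 : ℝ) 1 := q.1.2
  have hr : 0 < √R := Real.sqrt_pos.2 hR
  rw [freq_eq hR, mem_Icc, le_div_iff₀ hr, div_le_iff₀ hr] at h
  rw [abs_le]
  exact ⟨by linarith [h.1], by linarith [h.2]⟩

/-- Cauchy–Schwarz on the support; it makes `L²` convergence of the packet sums uniform convergence
after extension. -/
theorem enorm_extensionOp_le {g : ℝ → ℂ} (hg : AEStronglyMeasurable g volume) {a b : ℝ}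
    (hsupp : Function.support g ⊆ Icc a b) (x t : ℝ) :
    ‖extensionOp g x t‖ₑ ≤ ENNReal.ofReal (b - a) ^ (1 / 2 : ℝ) * eLpNorm g 2 volume := by
  calc ‖extensionOp g x t‖ₑ ≤ ∫⁻ ω, ‖g ω‖ₑ := by
        refine (enorm_integral_le_lintegral_enorm _).trans (le_of_eq ?_)
        simp_rw [enorm_mul, enorm_exp_I_mul, one_mul]
    _ = ∫⁻ ω in Icc a b, ‖g ω‖ₑ := by
        rw [← lintegral_indicator measurableSet_Icc]
        refine lintegral_congr fun ω => ?_
        by_cases hω : ω ∈ Icc a b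
        · rw [indicator_of_mem hω]
        · have : g ω = 0 := by
            by_contra h
            exact hω (hsupp h)
          rw [indicator_of_notMem hω, this, enorm_zero]
    _ = eLpNorm g 1 (volume.restrict (Icc a b)) := eLpNorm_one_eq_lintegral_enorm.symm
    _ ≤ _ := eLpNorm_le_eLpNorm_mul_rpow_measure_univ (q := 2) (by norm_num) hg.restrict
    _ ≤ _ := by
        rw [Measure.restrict_apply_univ, Real.volume_Icc, mul_comm]
        have e : 1 / (1 : ℝ≥0∞).toReal - 1 / (2 : ℝ≥0∞).toReal = (1 / 2 : ℝ) := by norm_num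
        rw [e]
        gcongr
        exact Measure.restrict_le_self

theorem memLp_of_contDiffOn {f : ℝ → ℂ} {n : WithTop ℕ∞} (hf : ContDiffOn ℝ n f (Icc (-1) 1))
    (hsupp : Function.support f ⊆ Icc (-1) 1) : MemLp f 2 volume := by
  have hc := hf.continuousOn
  obtain ⟨C, hC⟩ := isCompact_Icc.exists_bound_of_continuousOn hc
  have h1 : MemLp f 2 (volume.restrict (Icc (-1) 1)) :=
    MemLp.of_bound (hc.aestronglyMeasurable measurableSet_Icc) C
      (ae_restrict_of_forall_mem measurableSet_Icc hC)
  rw [← memLp_indicator_iff_restrict measurableSet_Icc] at h1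
  rwa [indicator_eq_self.2 hsupp] at h1

theorem restrict_disc_le_strip {R : ℝ} (hR : 0 ≤ R) : volume.restrict (disc R) ≤ strip R := by
  have h : strip R = (volume : Measure (ℝ × ℝ)).restrict (univ ×ˢ Icc (-R) R) := by
    rw [strip, Measure.volume_eq_prod, ← Measure.prod_restrict, Measure.restrict_univ]
  rw [h]
  refine Measure.restrict_mono_set _ fun z hz => ⟨mem_univ _, ?_⟩
  have : z.1 ^ 2 + z.2 ^ 2 ≤ R ^ 2 := hz
  exact abs_le.1 (abs_le_of_sq_le_sq (by nlinarith [sq_nonneg z.1]) hR)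

theorem volume_disc_le {R : ℝ} (hR : 0 ≤ R) : volume (disc R) ≤ ENNReal.ofReal (4 * R ^ 2) := by
  have hsub : disc R ⊆ Icc (-R) R ×ˢ Icc (-R) R := by
    intro z hz
    have : z.1 ^ 2 + z.2 ^ 2 ≤ R ^ 2 := hz
    exact ⟨abs_le.1 (abs_le_of_sq_le_sq (by nlinarith [sq_nonneg z.2]) hR),
      abs_le.1 (abs_le_of_sq_le_sq (by nlinarith [sq_nonneg z.1]) hR)⟩
  refine (measure_mono hsub).trans (le_of_eq ?_)
  rw [Measure.volume_eq_prod, Measure.prod_prod, Real.volume_Icc,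
    ← ENNReal.ofReal_mul (by linarith)]
  congr 1
  ring

namespace IsDecomposition

variable {R : ℝ} {A : ℝ≥0} {K : ℕ → ℝ} {f : ℝ → ℂ} {c : Index R → ℂ} {φ : Index R → ℝ → ℂ}

/-- The absolute values make the decay bound nonnegative, hence valid also for the zero functions at
the added indices. -/
theorem packetFamily (h : IsDecomposition R A K f c φ) (hR : 0 < R) :
    PacketFamily R (fun N => |K N|) (extendIndex φ) where
  memLp p := by
    rcases extendIndex_cases φ p with ⟨q, -, hq⟩ | hq
    · rw [hq]; exact h.memLp q
    · rw [hq]; exact MemLp.zero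
  support p ω hω := by
    have hr : 0 < √R := Real.sqrt_pos.2 hR
    rcases extendIndex_cases φ p with ⟨q, rfl, hq⟩ | hq
    · rw [hq] at hω
      have h1 := h.support_subset q hω
      rw [freq_eq hR, rpow_neg_half_eq hR, ← div_eq_mul_inv, mem_Icc, ← sub_div, ← add_div,
        div_le_iff₀ hr, le_div_iff₀ hr] at h1
      rw [abs_le]
      exact ⟨by linarith [h1.1], by linarith [h1.2]⟩
    · simp [hq] at hω
  decay p N hN x t ht := by
    have hr : 0 < √R := Real.sqrt_pos.2 hR
    have hR4 : 0 < R ^ (-(1 / 4) : ℝ) := Real.rpow_pos_of_pos hR _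
    rcases extendIndex_cases φ p with ⟨q, rfl, hq⟩ | hq
    · rw [hq]
      refine (h.decay q N hN x t ht).trans ?_
      have e : |x - pos q + 2 * freq q * t| * R ^ (-(1 / 2) : ℝ) =
          |x / √R - ((indexEmb R q).2 : ℝ) + 2 * ((indexEmb R q).1 : ℝ) * (t / R)| := by
        rw [pos_eq, freq_eq hR, rpow_neg_half_eq hR]
        nth_rewrite 1 [← abs_of_pos (inv_pos.2 hr)]
        rw [← abs_mul]
        congr 1
        have hsq : R = √R * √R := (Real.mul_self_sqrt hR.le).symm
        have e2 : t / R = t * (√R)⁻¹ * (√R)⁻¹ := by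
          rw [div_eq_mul_inv]
          nth_rewrite 1 [hsq]
          rw [mul_inv, mul_assoc]
        rw [e2]
        field_simp
      rw [e]
      gcongr
      exact le_abs_self _
    · rw [hq]
      have : extensionOp (0 : ℝ → ℂ) x t = 0 := by simp [extensionOp]
      rw [this, norm_zero]
      positivity

theorem synth_map (c : Index R → ℂ) (φ : Index R → ℝ → ℂ) (s : Finset (Index R)) (ω : ℝ) :
    synth (extendIndex c) (extendIndex φ) (s.map (indexEmb R)) ω = ∑ q ∈ s, packet c φ q ω := by
  rw [synth, Finset.sum_map]
  refine Finset.sum_congr rfl fun q _ => ?_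
  rw [extendIndex_emb, extendIndex_emb, packet]

theorem abs_fst_le_of_mem_map (hR : 0 < R) {s : Finset (Index R)} {p : ℤ × ℤ}
    (hp : p ∈ s.map (indexEmb R)) : |(p.1 : ℝ)| ≤ √R := by
  obtain ⟨q, -, rfl⟩ := Finset.mem_map.1 hp
  exact abs_indexEmb_fst_le hR q

/-- Finite sums of wave packets converge to `f` after the extension operator is applied. -/
theorem tendsto_extensionOp (h : IsDecomposition R A K f c φ) (hR : 0 < R) (hf : MemLp f 2 volume)
    (hsupp : Function.support f ⊆ Icc (-1) 1) (x t : ℝ) :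
    Tendsto (fun s : Finset (Index R) =>
      extensionOp (synth (extendIndex c) (extendIndex φ) (s.map (indexEmb R))) x t) atTop
      (𝓝 (extensionOp f x t)) := by
  have hr : 0 < √R := Real.sqrt_pos.2 hR
  -- `[-a, a]` contains the supports of `f` and of all packets, which may stick out of `[-1, 1]` by
  -- `3 R^{-1/2}`.
  set a : ℝ := 1 + 3 / √R with ha
  have hfi := integrable_of_memLp_of_support hf hsupp
  have hpf := h.packetFamily hR
  rw [tendsto_iff_edist_tendsto_0]
  have hle : ∀ s : Finset (Index R),
      edist (extensionOp (synth (extendIndex c) (extendIndex φ) (s.map (indexEmb R))) x t)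
        (extensionOp f x t) ≤ ENNReal.ofReal (a - -a) ^ (1 / 2 : ℝ) *
        eLpNorm (fun ω => f ω - ∑ q ∈ s, packet c φ q ω) 2 volume := by
    intro s
    set g := synth (extendIndex c) (extendIndex φ) (s.map (indexEmb R)) with hg
    have hgi : Integrable g := hpf.integrable_synth hR _ _
    have hsub : extensionOp f x t - extensionOp g x t = extensionOp (fun ω => f ω - g ω) x t := by
      unfold extensionOp
      rw [← integral_sub (integrable_exp_mul hfi (by fun_prop))
        (integrable_exp_mul hgi (by fun_prop))]
      congr 1
      ext ω
      ring
    have hfun : (fun ω => f ω - g ω) = fun ω => f ω - ∑ q ∈ s, packet c φ q ω := by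
      ext ω
      rw [hg, synth_map]
    rw [edist_comm, edist_eq_enorm_sub, hsub, ← hfun]
    refine enorm_extensionOp_le (hf.1.sub hgi.1) (fun ω hω => ?_) x t
    have hpos : 0 < 3 / √R := by positivity
    by_cases hfω : f ω = 0
    · have hgω : g ω ≠ 0 := by
        intro h0
        apply hω
        simp [hfω, h0]
      obtain ⟨p, hp, hne⟩ := Finset.exists_ne_zero_of_sum_ne_zero hgω
      have h1 := abs_le.1 (hpf.support p ω (right_ne_zero_of_mul hne))
      have h2 := abs_le.1 (abs_fst_le_of_mem_map hR hp)
      have e : a * √R = √R + 3 := by rw [ha]; field_simp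
      constructor
      · refine le_of_mul_le_mul_right ?_ hr
        linarith [h1.1, h2.1]
      · refine le_of_mul_le_mul_right ?_ hr
        linarith [h1.2, h2.2]
    · have := hsupp hfω
      exact ⟨by linarith [this.1], by linarith [this.2]⟩
  have hlim := ENNReal.Tendsto.const_mul (a := ENNReal.ofReal (a - -a) ^ (1 / 2 : ℝ)) h.sum_eq
    (Or.inr (ENNReal.rpow_ne_top_of_nonneg (by norm_num) ENNReal.ofReal_ne_top))
  rw [mul_zero] at hlim
  exact tendsto_of_tendsto_of_tendsto_of_le_of_le tendsto_const_nhds hlim (fun _ => zero_le) hle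

theorem sum_sq_map_le (h : IsDecomposition R A K f c φ) (hf : MemLp f 2 volume)
    (s : Finset (Index R)) :
    ∑ p ∈ s.map (indexEmb R), ‖extendIndex c p‖ ^ 2 ≤
      (√A * (eLpNorm f 2 volume).toReal) ^ 2 := by
  have h1 : ∑ q ∈ s, ‖c q‖ₑ ^ 2 ≤ A * eLpNorm f 2 volume ^ 2 :=
    (ENNReal.sum_le_tsum s).trans h.sum_sq_le
  have h2 := ENNReal.toReal_mono (ENNReal.mul_ne_top ENNReal.coe_ne_top
    (ENNReal.pow_ne_top hf.2.ne)) h1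
  rw [ENNReal.toReal_sum (fun q _ => by finiteness)] at h2
  simp only [ENNReal.toReal_mul, ENNReal.toReal_pow, toReal_enorm, ENNReal.coe_toReal] at h2
  rw [Finset.sum_map, mul_pow, Real.sq_sqrt A.coe_nonneg]
  simpa only [extendIndex_emb] using h2

theorem norm_coeff_le (h : IsDecomposition R A K f c φ) (hf : MemLp f 2 volume) (q : Index R) :
    ‖c q‖ ≤ √A * (eLpNorm f 2 volume).toReal := by
  have h1 := h.sum_sq_map_le hf {q}
  rw [Finset.map_singleton, Finset.sum_singleton, extendIndex_emb] at h1
  exact le_of_sq_le_sq h1 (by positivity)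

/-- The wave packets are bounded by `f`, so the size ratio is bounded. -/
theorem maxPacket_le (h : IsDecomposition R A K f c φ) (hR : 0 < R) (hf : MemLp f 2 volume) :
    maxPacket c φ ≤ ENNReal.ofReal (√(7 * |K 2| ^ 2 * wtSum) *
      (√A * (eLpNorm f 2 volume).toReal)) := by
  have hW := wtSum_nonneg
  refine iSup_le fun q => ?_
  have h1 := (h.packetFamily hR).lintegral_synth_sq_le hR (extendIndex c)
    (({q} : Finset (Index R)).map (indexEmb R))
  simp_rw [synth_map, Finset.sum_singleton] at h1
  rw [Finset.map_singleton, Finset.sum_singleton, extendIndex_emb, ← eLpNorm_two_sq] at h1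
  refine (ENNReal.pow_le_pow_left_iff two_ne_zero).1 (h1.trans ?_)
  rw [← ENNReal.ofReal_pow (by positivity)]
  refine ENNReal.ofReal_le_ofReal ?_
  rw [mul_pow, Real.sq_sqrt (by positivity)]
  have := h.norm_coeff_le hf q
  gcongr

/-- If all packets vanished, `coeff_le` would kill every coefficient and `le_sum_sq` would then kill
`f`. Positivity is needed since the power of `S` may be negative. -/
theorem maxPacket_ne_zero (h : IsDecomposition R A K f c φ) (hf0 : eLpNorm f 2 volume ≠ 0) :
    maxPacket c φ ≠ 0 := by
  intro hM
  apply hf0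
  have hc : ∀ q, ‖c q‖ₑ = 0 := fun q => by
    have := h.coeff_le q
    rw [hM, mul_zero] at this
    exact le_antisymm this zero_le
  have := h.le_sum_sq
  simp only [hc] at this
  simpa using this

theorem norm_coeff_le_maxPacket (h : IsDecomposition R A K f c φ) (hR : 0 < R)
    (hf : MemLp f 2 volume) (q : Index R) : ‖c q‖ ≤ A * (maxPacket c φ).toReal := by
  have h1 := ENNReal.toReal_mono (ENNReal.mul_ne_top ENNReal.coe_ne_top
    ((h.maxPacket_le hR hf).trans_lt ENNReal.ofReal_lt_top).ne) (h.coeff_le q)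
  simpa using h1

end IsDecomposition

end WavePacket

end

/-! ### Large scales, small scales and the conclusion -/

noncomputable section

namespace WavePacket

theorem le_rpow_mul_rpow {x a b θ : ℝ} (hx : 0 ≤ x) (ha : x ≤ a) (hb : x ≤ b) (hθ : 0 ≤ θ)
    (hθ1 : θ ≤ 1) : x ≤ a ^ θ * b ^ (1 - θ) := by
  calc x = x ^ (θ + (1 - θ)) := by rw [add_sub_cancel, Real.rpow_one]
    _ = x ^ θ * x ^ (1 - θ) := Real.rpow_add_of_nonneg hx hθ (by linarith)
    _ ≤ _ := by
      have : 0 ≤ a := hx.trans ha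
      gcongr

namespace IsDecomposition

variable {R : ℝ} {A : ℝ≥0} {K : ℕ → ℝ} {f : ℝ → ℂ} {c : Index R → ℂ} {φ : Index R → ℝ → ℂ}

theorem sizeRatio_eq (h : IsDecomposition R A K f c φ) (hR : 0 < R) (hf : MemLp f 2 volume)
    (hf0 : eLpNorm f 2 volume ≠ 0) :
    0 < (maxPacket c φ).toReal / (eLpNorm f 2 volume).toReal ∧
    sizeRatio f c φ = ENNReal.ofReal ((maxPacket c φ).toReal / (eLpNorm f 2 volume).toReal) := by
  have hM : maxPacket c φ ≠ ∞ := ((h.maxPacket_le hR hf).trans_lt ENNReal.ofReal_lt_top).ne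
  have hM0 := h.maxPacket_ne_zero hf0
  have hF : 0 < (eLpNorm f 2 volume).toReal := ENNReal.toReal_pos hf0 hf.2.ne
  refine ⟨div_pos (ENNReal.toReal_pos hM0 hM) hF, ?_⟩
  rw [ENNReal.ofReal_div_of_pos hF, ENNReal.ofReal_toReal hM, ENNReal.ofReal_toReal hf.2.ne,
    sizeRatio]

theorem rhs_eq (h : IsDecomposition R A K f c φ) (hR : 0 < R) (hf : MemLp f 2 volume)
    (hf0 : eLpNorm f 2 volume ≠ 0) {C : ℝ} (hC : 0 ≤ C) (ε : ℝ) :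
    ENNReal.ofReal C * ENNReal.ofReal (R ^ (1 / 8 + ε)) * sizeRatio f c φ ^ (1 / 4 - ε) *
        eLpNorm f 2 volume =
      ENNReal.ofReal (C * R ^ (1 / 8 + ε) *
        ((maxPacket c φ).toReal / (eLpNorm f 2 volume).toReal) ^ (1 / 4 - ε) *
        (eLpNorm f 2 volume).toReal) := by
  obtain ⟨hS, hSe⟩ := h.sizeRatio_eq hR hf hf0
  have h1 : 0 ≤ R ^ (1 / 8 + ε) := Real.rpow_nonneg hR.le _
  have h2 := Real.rpow_nonneg hS.le (1 / 4 - ε)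
  rw [hSe, ENNReal.ofReal_rpow_of_pos hS, ENNReal.ofReal_mul (mul_nonneg (mul_nonneg hC h1) h2),
    ENNReal.ofReal_mul (mul_nonneg hC h1), ENNReal.ofReal_mul hC, ENNReal.ofReal_toReal hf.2.ne]

/-- A bound for all finite sums of wave packets is a bound for `f`. -/
theorem eLpNorm_extensionOp_le (h : IsDecomposition R A K f c φ) (hR : 0 < R)
    (hf : MemLp f 2 volume) (hsupp : Function.support f ⊆ Icc (-1) 1) {p : ℝ≥0∞}
    {μ : Measure (ℝ × ℝ)} {B : ℝ≥0∞}
    (hB : ∀ s : Finset (Index R), eLpNorm (fun z : ℝ × ℝ =>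
      extensionOp (synth (extendIndex c) (extendIndex φ) (s.map (indexEmb R))) z.1 z.2) p μ ≤ B) :
    eLpNorm (fun z : ℝ × ℝ => extensionOp f z.1 z.2) p μ ≤ B := by
  have hpf := h.packetFamily hR
  obtain ⟨u, hu⟩ := exists_seq_tendsto (atTop : Filter (Finset (Index R)))
  have hlim := Lp.eLpNorm_lim_le_liminf_eLpNorm (μ := μ) (p := p)
    (f := fun n (z : ℝ × ℝ) => extensionOp (synth (extendIndex c)
      (extendIndex φ) ((u n).map (indexEmb R))) z.1 z.2)
    (fun n => (continuous_extensionOp (hpf.integrable_synth hR _ _)).aestronglyMeasurable)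
    (fun z : ℝ × ℝ => extensionOp f z.1 z.2)
    (Eventually.of_forall fun z => (h.tendsto_extensionOp hR hf hsupp z.1 z.2).comp hu)
  refine hlim.trans (liminf_le_of_le (by isBoundedDefault) fun b hb => ?_)
  obtain ⟨n, hn⟩ := hb.exists
  exact hn.trans (hB _)

/-- The estimate for a large scale. -/
theorem exists_bound_of_one_le (A : ℝ≥0) (K : ℕ → ℝ) {ε : ℝ} (hε : 0 < ε) : ∃ C : ℝ, 0 ≤ C ∧
    ∀ {R : ℝ} {f : ℝ → ℂ} {c : Index R → ℂ} {φ : Index R → ℝ → ℂ},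
    IsDecomposition R A K f c φ → 1 ≤ R → MemLp f 2 volume →
    Function.support f ⊆ Icc (-1) 1 → eLpNorm f 2 volume ≠ 0 →
    eLpNorm (fun z : ℝ × ℝ => extensionOp f z.1 z.2) 4 (volume.restrict (disc R)) ≤
      ENNReal.ofReal (C * R ^ (1 / 8 + ε) *
        ((maxPacket c φ).toReal / (eLpNorm f 2 volume).toReal) ^ (1 / 4 - ε) *
        (eLpNorm f 2 volume).toReal) := by
  obtain ⟨C, hC0, hC⟩ := PacketFamily.exists_lintegral_pow_four_le (fun N => |K N|) hε
  have hW := wtSum_nonneg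
  -- The upper bound for `S` given by Bessel's inequality.
  set σ := √(7 * |K 2| ^ 2 * wtSum) * √A with hσ
  have hσ0 : 0 ≤ σ := by positivity
  set C' := C * (A * √A ^ 3) with hC'
  have hA0 : (0 : ℝ) ≤ A := A.coe_nonneg
  have hC'0 : 0 ≤ C' := by positivity
  refine ⟨C' ^ (1 / 4 : ℝ) * σ ^ ε, by positivity, ?_⟩
  intro R f c φ h hR hf hsupp hf0
  have hR0 : 0 < R := by linarith
  have hpf := h.packetFamily hR0
  have hM : maxPacket c φ ≠ ∞ := ((h.maxPacket_le hR0 hf).trans_lt ENNReal.ofReal_lt_top).ne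
  obtain ⟨hS0, -⟩ := h.sizeRatio_eq hR0 hf hf0
  have hF : 0 < (eLpNorm f 2 volume).toReal := ENNReal.toReal_pos hf0 hf.2.ne
  have hSσ : (maxPacket c φ).toReal / (eLpNorm f 2 volume).toReal ≤ σ := by
    rw [div_le_iff₀ hF, hσ, mul_assoc]
    exact ENNReal.toReal_le_of_le_ofReal (by positivity) (h.maxPacket_le hR0 hf)
  set F := (eLpNorm f 2 volume).toReal with hFdef
  set M := (maxPacket c φ).toReal with hMdef
  have hM0 : 0 ≤ M := ENNReal.toReal_nonneg
  set S := M / F with hSdef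
  set Y := C' * R ^ (1 / 2 + 4 * ε) * (S * F ^ 4) with hY
  have hRp : 0 < R ^ (1 / 2 + 4 * ε) := Real.rpow_pos_of_pos hR0 _
  have hY0 : 0 ≤ Y := by positivity
  have hfin : ∀ s : Finset (Index R), eLpNorm (fun z : ℝ × ℝ =>
      extensionOp (synth (extendIndex c) (extendIndex φ) (s.map (indexEmb R))) z.1 z.2) 4
      (volume.restrict (disc R)) ≤ ENNReal.ofReal (Y ^ (1 / 4 : ℝ)) := by
    intro s
    refine (eLpNorm_mono_measure _ (restrict_disc_le_strip hR0.le)).trans ?_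
    rw [eLpNorm_eq_lintegral_rpow_enorm_toReal (by norm_num) (by norm_num),
      ← ENNReal.ofReal_rpow_of_nonneg hY0 (by norm_num)]
    have e4 : (4 : ℝ≥0∞).toReal = ((4 : ℕ) : ℝ) := by norm_num
    simp only [e4, ENNReal.rpow_natCast]
    rw [show (1 : ℝ) / ((4 : ℕ) : ℝ) = 1 / 4 by norm_num]
    refine ENNReal.rpow_le_rpow ?_ (by norm_num)
    -- Both bounds hold for the coefficients; the minimum ensures `b ≤ H`, and afterwards only `A *
    -- M` is used.
    have hcore := hC hpf hR (c := extendIndex c) (s := s.map (indexEmb R))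
      (fun p hp => abs_fst_le_of_mem_map hR0 hp) (b := min (A * M) (√A * F)) (H := √A * F)
      (by positivity) (min_le_right _ _)
      (fun p hp => by
        obtain ⟨q, -, rfl⟩ := Finset.mem_map.1 hp
        rw [extendIndex_emb]
        exact le_min (h.norm_coeff_le_maxPacket hR0 hf q) (h.norm_coeff_le hf q))
      (h.sum_sq_map_le hf s)
    refine hcore.trans (ENNReal.ofReal_le_ofReal ?_)
    calc _ ≤ C * R ^ (1 / 2 + 4 * ε) * (A * M * (√A * F) ^ 3) := by
          gcongr
          exact min_le_left _ _
      _ = Y := by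
          rw [hY, hC', hSdef]
          field_simp
  have hlim : eLpNorm (fun z : ℝ × ℝ => extensionOp f z.1 z.2) 4 (volume.restrict (disc R)) ≤
      ENNReal.ofReal (Y ^ (1 / 4 : ℝ)) :=
    h.eLpNorm_extensionOp_le hR0 hf hsupp hfin
  refine hlim.trans (ENNReal.ofReal_le_ofReal ?_)
  have e1 : Y ^ (1 / 4 : ℝ) = C' ^ (1 / 4 : ℝ) * R ^ (1 / 8 + ε) * (S ^ (1 / 4 : ℝ) * F) := by
    rw [hY, Real.mul_rpow (by positivity) (by positivity), Real.mul_rpow hC'0 hRp.le,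
      Real.mul_rpow hS0.le (by positivity), ← Real.rpow_mul hR0.le, ← Real.rpow_natCast F 4,
      ← Real.rpow_mul hF.le]
    congr 2
    · congr 1
      ring
    · norm_num
  -- Only `S^ε` is estimated, so the sign of `1 / 4 - ε` does not matter.
  have e2 : S ^ (1 / 4 : ℝ) ≤ S ^ (1 / 4 - ε) * σ ^ ε := by
    calc S ^ (1 / 4 : ℝ) = S ^ (1 / 4 - ε) * S ^ ε := by
          rw [← Real.rpow_add hS0, sub_add_cancel]
      _ ≤ _ := by gcongr
  rw [e1]
  calc _ ≤ C' ^ (1 / 4 : ℝ) * R ^ (1 / 8 + ε) * (S ^ (1 / 4 - ε) * σ ^ ε * F) := by gcongr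
    _ = _ := by ring

/-- The estimate for a small scale. -/
theorem exists_bound_of_lt_one (A : ℝ≥0) (K : ℕ → ℝ) {ε : ℝ} (hε : 0 < ε) (hε8 : ε ≤ 1 / 8) :
    ∃ C : ℝ, 0 ≤ C ∧ ∀ {R : ℝ} {f : ℝ → ℂ} {c : Index R → ℂ} {φ : Index R → ℝ → ℂ},
    IsDecomposition R A K f c φ → 0 < R → R < 1 → MemLp f 2 volume →
    Function.support f ⊆ Icc (-1) 1 → eLpNorm f 2 volume ≠ 0 →
    eLpNorm (fun z : ℝ × ℝ => extensionOp f z.1 z.2) 4 (volume.restrict (disc R)) ≤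
      ENNReal.ofReal (C * R ^ (1 / 8 + ε) *
        ((maxPacket c φ).toReal / (eLpNorm f 2 volume).toReal) ^ (1 / 4 - ε) *
        (eLpNorm f 2 volume).toReal) := by
  have hW := wtSum_nonneg
  set θ := 1 / 4 - ε with hθ
  have hθ0 : 0 ≤ θ := by linarith
  set D := |K 2| * A * wtSum with hD
  have hA0 : (0 : ℝ) ≤ A := A.coe_nonneg
  have hD0 : 0 ≤ D := by positivity
  refine ⟨4 ^ (1 / 4 : ℝ) * (D ^ θ * √2 ^ (1 - θ)), by positivity, ?_⟩
  intro R f c φ h hR hR1 hf hsupp hf0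
  have hpf := h.packetFamily hR
  obtain ⟨hS0, -⟩ := h.sizeRatio_eq hR hf hf0
  have hF : 0 < (eLpNorm f 2 volume).toReal := ENNReal.toReal_pos hf0 hf.2.ne
  set F := (eLpNorm f 2 volume).toReal with hFdef
  set M := (maxPacket c φ).toReal with hMdef
  have hM0 : 0 ≤ M := ENNReal.toReal_nonneg
  have hR4 : 0 < R ^ (-(1 / 4) : ℝ) := Real.rpow_pos_of_pos hR _
  have hr1 : √R < 1 := by
    rw [Real.sqrt_lt' one_pos]
    simpa using hR1
  -- Since `√R < 1`, the only frequency index is `0`, and the majorant is a single sum over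
  -- positions.
  have hbound1 : ∀ z ∈ disc R, ‖extensionOp f z.1 z.2‖ ≤ D * R ^ (-(1 / 4) : ℝ) * M := by
    intro z hz
    have hz' : |z.2| ≤ R := by
      have : z.1 ^ 2 + z.2 ^ 2 ≤ R ^ 2 := hz
      exact abs_le_of_sq_le_sq (by nlinarith [sq_nonneg z.1]) hR.le
    refine le_of_tendsto (h.tendsto_extensionOp hR hf hsupp z.1 z.2).norm
      (Eventually.of_forall fun s => ?_)
    refine (hpf.norm_extensionOp_synth_le hR _ _ hz').trans ?_
    have hmaj := majorant_le (c := extendIndex c) (u := s.map (indexEmb R)) (κ := {0})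
      (fun p hp => by
        have h1 := (abs_fst_le_of_mem_map hR hp).trans_lt hr1
        have h2 : |p.1| < 1 := by exact_mod_cast h1
        simpa using Int.abs_lt_one_iff.1 h2)
      (b := A * M) (by positivity)
      (fun p hp => by
        obtain ⟨q, -, rfl⟩ := Finset.mem_map.1 hp
        rw [extendIndex_emb]
        exact h.norm_coeff_le_maxPacket hR hf q) (z.1 / √R) (z.2 / R)
    calc _ ≤ |K 2| * R ^ (-(1 / 4) : ℝ) * (A * M * ((({0} : Finset ℤ).card : ℝ) * wtSum)) := by
          gcongr
      _ = _ := by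
          rw [Finset.card_singleton, hD]
          push_cast
          ring
  have hbound2 : ∀ z : ℝ × ℝ, ‖extensionOp f z.1 z.2‖ ≤ √2 * F := by
    intro z
    have h1 := enorm_extensionOp_le hf.1 hsupp z.1 z.2
    have h2 := ENNReal.toReal_mono (ENNReal.mul_ne_top
      (ENNReal.rpow_ne_top_of_nonneg (by norm_num) ENNReal.ofReal_ne_top) hf.2.ne) h1
    rw [toReal_enorm, ENNReal.toReal_mul, ← ENNReal.toReal_rpow,
      ENNReal.toReal_ofReal (by norm_num)] at h2
    rw [Real.sqrt_eq_rpow]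
    convert h2 using 3
    norm_num
  have hmeas : MeasurableSet (disc R) :=
    (isClosed_le (by fun_prop) continuous_const : IsClosed
      {z : ℝ × ℝ | z.1 ^ 2 + z.2 ^ 2 ≤ R ^ 2}).measurableSet
  set a₁ := D * R ^ (-(1 / 4) : ℝ) * M with ha₁
  set a₂ := √2 * F with ha₂
  have hle := eLpNorm_le_of_ae_bound (p := 4) (μ := volume.restrict (disc R))
    (f := fun z : ℝ × ℝ => extensionOp f z.1 z.2) (C := a₁ ^ θ * a₂ ^ (1 - θ))
    (ae_restrict_of_forall_mem hmeas fun z hz => le_rpow_mul_rpow (norm_nonneg _)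
      (hbound1 z hz) (hbound2 z) hθ0 (by linarith))
  refine hle.trans ?_
  rw [Measure.restrict_apply_univ]
  have ha₁0 : 0 ≤ a₁ := by positivity
  have ha₂0 : 0 ≤ a₂ := by positivity
  calc _ ≤ ENNReal.ofReal (4 * R ^ 2) ^ (1 / 4 : ℝ) * ENNReal.ofReal (a₁ ^ θ * a₂ ^ (1 - θ)) := by
        rw [show (4 : ℝ≥0∞).toReal⁻¹ = (1 / 4 : ℝ) by norm_num]
        gcongr
        exact volume_disc_le hR.le
    _ = ENNReal.ofReal ((4 * R ^ 2) ^ (1 / 4 : ℝ) * (a₁ ^ θ * a₂ ^ (1 - θ))) := by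
        rw [ENNReal.ofReal_rpow_of_nonneg (by positivity) (by norm_num),
          ← ENNReal.ofReal_mul (by positivity)]
    _ ≤ _ := by
        refine ENNReal.ofReal_le_ofReal ?_
        have e1 : (4 * R ^ 2) ^ (1 / 4 : ℝ) = 4 ^ (1 / 4 : ℝ) * R ^ (1 / 2 : ℝ) := by
          rw [Real.mul_rpow (by norm_num) (by positivity), ← Real.rpow_natCast R 2,
            ← Real.rpow_mul hR.le]
          norm_num
        have e2 : a₁ ^ θ = D ^ θ * R ^ (-(θ / 4)) * M ^ θ := by
          rw [ha₁, Real.mul_rpow (by positivity) hM0, Real.mul_rpow hD0 hR4.le,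
            ← Real.rpow_mul hR.le]
          congr 3
          ring
        have e3 : a₂ ^ (1 - θ) = √2 ^ (1 - θ) * F ^ (1 - θ) :=
          Real.mul_rpow (by positivity) hF.le
        have e4 : (M / F) ^ θ * F = M ^ θ * F ^ (1 - θ) := by
          rw [Real.div_rpow hM0 hF.le, Real.rpow_sub hF 1 θ, Real.rpow_one]
          field_simp
        -- As `R < 1`, this needs `7/16 + ε/4 ≥ 1/8 + ε`, that is `ε ≤ 5/12`.
        have e5 : R ^ (1 / 2 : ℝ) * R ^ (-(θ / 4)) ≤ R ^ (1 / 8 + ε) := by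
          rw [← Real.rpow_add hR]
          refine Real.rpow_le_rpow_of_exponent_ge hR hR1.le ?_
          rw [hθ]
          linarith
        rw [e1, e2, e3, mul_assoc (_ * R ^ (1 / 8 + ε)), e4]
        calc _ = 4 ^ (1 / 4 : ℝ) * (D ^ θ * √2 ^ (1 - θ)) *
              (R ^ (1 / 2 : ℝ) * R ^ (-(θ / 4))) * (M ^ θ * F ^ (1 - θ)) := by ring
          _ ≤ _ := by gcongr

end IsDecomposition

end WavePacket

end

theorem proposition4p1 (A : ℝ≥0) (K : ℕ → ℝ) (ε : ℝ) (hε : 0 < ε) :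
    ∃ C : ℝ≥0, ∀ R : ℝ, 0 < R → (ε ≤ 1 / 8 ∨ 1 ≤ R) →
      ∀ f : ℝ → ℂ, ContDiffOn ℝ ((⊤ : ℕ∞) : WithTop ℕ∞) f (Icc (-1) 1) → Function.support f ⊆ Icc (-1) 1 →
      ∀ (c : WavePacket.Index R → ℂ) (φ : WavePacket.Index R → ℝ → ℂ),
        WavePacket.IsDecomposition R A K f c φ →
        eLpNorm (fun z : ℝ × ℝ => WavePacket.extensionOp f z.1 z.2) 4
            (volume.restrict (WavePacket.disc R)) ≤
          C * ENNReal.ofReal (R ^ (1 / 8 + ε)) *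
            WavePacket.sizeRatio f c φ ^ (1 / 4 - ε) * eLpNorm f 2 volume := by
  obtain ⟨C₁, hC₁, hlarge⟩ := WavePacket.IsDecomposition.exists_bound_of_one_le A K hε
  obtain ⟨C₂, hC₂, hsmall⟩ : ∃ C₂ : ℝ, 0 ≤ C₂ ∧ (ε ≤ 1 / 8 → ∀ {R : ℝ} {f : ℝ → ℂ}
      {c : WavePacket.Index R → ℂ} {φ : WavePacket.Index R → ℝ → ℂ},
      WavePacket.IsDecomposition R A K f c φ → 0 < R → R < 1 → MemLp f 2 volume →
      Function.support f ⊆ Icc (-1) 1 → eLpNorm f 2 volume ≠ 0 →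
      eLpNorm (fun z : ℝ × ℝ => WavePacket.extensionOp f z.1 z.2) 4
        (volume.restrict (WavePacket.disc R)) ≤ ENNReal.ofReal (C₂ * R ^ (1 / 8 + ε) *
          ((WavePacket.maxPacket c φ).toReal / (eLpNorm f 2 volume).toReal) ^ (1 / 4 - ε) *
          (eLpNorm f 2 volume).toReal)) := by
    by_cases h8 : ε ≤ 1 / 8
    · obtain ⟨C, hC, h⟩ := WavePacket.IsDecomposition.exists_bound_of_lt_one A K hε h8
      exact ⟨C, hC, fun _ => h⟩
    -- For `ε > 1/8` scales below 1 are excluded, and any constant will do.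
    · exact ⟨0, le_rfl, fun h => absurd h h8⟩
  refine ⟨(C₁ + C₂).toNNReal, ?_⟩
  intro R hR hRε f hf hsupp c φ h
  have hf2 := WavePacket.memLp_of_contDiffOn hf hsupp
  by_cases hf0 : eLpNorm f 2 volume = 0
  · have hzero : ∀ z : ℝ × ℝ, WavePacket.extensionOp f z.1 z.2 = 0 := by
      intro z
      have := WavePacket.enorm_extensionOp_le hf2.1 hsupp z.1 z.2
      rw [hf0, mul_zero] at this
      exact enorm_eq_zero.1 (le_antisymm this zero_le)
    simp [hzero]
  change _ ≤ ENNReal.ofReal (C₁ + C₂) * _ * _ * _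
  rw [h.rhs_eq hR hf2 hf0 (by positivity)]
  have hS := (h.sizeRatio_eq hR hf2 hf0).1
  have hRp : 0 < R ^ (1 / 8 + ε) := Real.rpow_pos_of_pos hR _
  rcases lt_or_ge R 1 with hR1 | hR1
  · have hε8 : ε ≤ 1 / 8 := hRε.resolve_right (not_le.2 hR1)
    refine (hsmall hε8 h hR hR1 hf2 hsupp hf0).trans (ENNReal.ofReal_le_ofReal ?_)
    gcongr
    linarith
  · refine (hlarge h hR1 hf2 hsupp hf0).trans (ENNReal.ofReal_le_ofReal ?_)
    gcongr
    linarith
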